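/- **Setting.** For $v>0$, $\mathrm{GRM}^{\mathbb R}(n,v)$ is the class of random matrices $Y:\Omega\to M_n(\mathbb R)$ on a probability space $(\Omega,\mathcal F,\mathbb P)$ whose $n^2$ entries are i.i.d. with distribution $N(0,v)$. A $C^*$-probability space $(\mathcal A,\tau)$ is a unital $C^*$-algebra $\mathcal A$ with a state $\tau$. A semicircular system in $(\mathcal A,\tau)$ is a free family of self-adjoint elements, each with distribution $\frac1{2\pi}\sqrt{4-t^2}\,dt$ on $[-2,2]$; elements $y_1,\dots,y_r\in\mathcal A$ form a circular system if the $2r$ elements $\frac1{\sqrt2}(y_j+y_j^*)$, $\frac1{i\sqrt2}(y_j-y_j^*)$, $1\le j\le r$, form a semicircular system. Norms of matrices are operator norms, $\operatorname{tr}_n=\frac1n\operatorname{Tr}_n$ is the normalised trace on $M_n(\mathbb C)$, $e_{kl}^{(m)}$ are the matrix units of $M_m(\mathbb C)$, $\operatorname{Im}\lambda=\frac1{2i}(\lambda-\lambda^*)$, and $\operatorname{Im}\lambda>0$ means that $\operatorname{Im}\lambda$ is positive definite. $\lambda^t$ is the transpose of $\lambda$, and $\overline a$ is the matrix with complex conjugated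 entries. **Theorem.** Let $r,m\ge 1$, let $a_0,a_1,\dots,a_r\in M_m(\mathbb C)$ with $a_0^*=a_0$, and for each $n\ge1$ let $Y_1^{(n)},\dots,Y_r^{(n)}$ be independent random matrices from $\mathrm{GRM}^{\mathbb R}(n,\frac1n)$. Let $(\mathcal A,\tau)$ be a $C^*$-probability space and $y_1,\dots,y_r$ a circular system in it. Define $$s=a_0\otimes\mathbf 1_{\mathcal A}+\sum_{j=1}^r(a_j\otimes y_j+a_j^*\otimes y_j^*),\qquad \overline s=\overline{a_0}\otimes\mathbf 1_{\mathcal A}+\sum_{j=1}^r(\overline{a_j}\otimes y_j+\overline{a_j}^{\,*}\otimes y_j^*),$$ $$S_n=a_0\otimes\mathbf 1_n+\sum_{j=1}^r\big(a_j\otimes Y_j^{(n)}+a_j^*\otimes (Y_j^{(n)})^*\big),$$ and, for $\lambda\in M_m(\mathbb C)$ with $\operatorname{Im}\lambda>0$, $$G_n(\lambda)=\mathbb E\{(\mathrm{id}_m\otimes\operatorname{tr}_n)[(\lambda\otimes\mathbf 1_n-S_n)^{-1}]\},\qquad G(\lambda)=(\mathrm{id}_m\otimes\tau)[(\lambda\otimes\mathbf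 1_{\mathcal A}-s)^{-1}],$$ $$R(\lambda)=\sum_{j=1}^r\sum_{b\in\{a_j,\,a_j^*\}}\sum_{k,l=1}^m b\,e_{kl}^{(m)}\,(\mathrm{id}_m\otimes\tau)\big[(\lambda^t\otimes\mathbf 1_{\mathcal A}-\overline s)^{-1}(e_{kl}^{(m)}b\otimes\mathbf 1_{\mathcal A})(\lambda\otimes\mathbf 1_{\mathcal A}-s)^{-1}\big]$$ (the middle sum has two terms, $b=a_j$ and $b=a_j^*$, even if $a_j=a_j^*$), and $$L(\lambda)=(\mathrm{id}_m\otimes\tau)\big[(\lambda\otimes\mathbf 1_{\mathcal A}-s)^{-1}(R(\lambda)G(\lambda)^{-1}\otimes\mathbf 1_{\mathcal A})(\lambda\otimes\mathbf 1_{\mathcal A}-s)^{-1}\big].$$ All these objects are well defined: the inverses exist and the entries of $(\mathrm{id}_m\otimes\operatorname{tr}_n)[(\lambda\otimes\mathbf 1_n-S_n)^{-1}]$ are integrable. Moreover, there is a polynomial $P$ of degree $13$ with non-negative coefficients, depending only on $r$, $m$, $\|a_0\|,\dots,\|a_r\|$, such that for every $\lambda\in M_m(\mathbb C)$ with $\operatorname{Im}\lambda>0$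 and every integer $n\ge1$, $$\Big\|G(\lambda)-G_n(\lambda)+\tfrac1nL(\lambda)\Big\|\le\frac1{n^2}\,(\|\lambda\|+K')^8\,P\big(\|(\operatorname{Im}\lambda)^{-1}\|\big),\qquad K'=\|a_0\|+16\sum_{j=1}^r\|a_j\|+1 .$$ -/

import Mathlib

open scoped Matrix ComplexOrder Matrix.Norms.L2Operator NNReal

noncomputable section

namespace RealGaussian

/-! ### Tensors with `M_m(ℂ)`

The algebra `M_m(ℂ) ⊗ A` is realised as the algebra `Matrix (Fin m) (Fin m) A` of matrices with
entries in `A`.  This is used both for a C⋆-algebra `A` and for `A = M_n(ℂ)`. -/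

section Tensor

variable {m r : ℕ} {A : Type*} [Ring A] [Algebra ℂ A]

/-- The elementary tensor `a ⊗ x` in `M_m(ℂ) ⊗ A = M_m(A)`. -/
def tensor (a : Matrix (Fin m) (Fin m) ℂ) (x : A) : Matrix (Fin m) (Fin m) A :=
  Matrix.of fun i j => a i j • x

/-- The slice map `id_m ⊗ φ : M_m(ℂ) ⊗ A → M_m(ℂ)` of a linear functional `φ`. -/
def slice (φ : A →ₗ[ℂ] ℂ) (X : Matrix (Fin m) (Fin m) A) : Matrix (Fin m) (Fin m) ℂ :=
  Matrix.of fun i j => φ (X i j)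

/-- The element `a₀ ⊗ 1 + ∑ j, (a_j ⊗ y_j + a_j^* ⊗ y_j^*)` of `M_m(ℂ) ⊗ A`. -/
def pencil [Star A] (a₀ : Matrix (Fin m) (Fin m) ℂ) (a : Fin r → Matrix (Fin m) (Fin m) ℂ)
    (y : Fin r → A) : Matrix (Fin m) (Fin m) A :=
  tensor a₀ 1 + ∑ j, (tensor (a j) (y j) + tensor (a j)ᴴ (star (y j)))

/-- The resolvent `(z ⊗ 1 - X)⁻¹` in `M_m(ℂ) ⊗ A` of the element `X` at `z ∈ M_m(ℂ)`
(with the value `0` where `z ⊗ 1 - X` is not invertible). -/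
def resolvent (z : Matrix (Fin m) (Fin m) ℂ) (X : Matrix (Fin m) (Fin m) A) :
    Matrix (Fin m) (Fin m) A :=
  Ring.inverse (tensor z 1 - X)

end Tensor

/-- The imaginary part `(z - z^*) / (2 i)` of a complex matrix. -/
def imPart {m : ℕ} (z : Matrix (Fin m) (Fin m) ℂ) : Matrix (Fin m) (Fin m) ℂ :=
  (2 * Complex.I)⁻¹ • (z - zᴴ)

/-- The matrix with complex conjugated entries. -/
def conjEntries {m : ℕ} (a : Matrix (Fin m) (Fin m) ℂ) : Matrix (Fin m) (Fin m) ℂ :=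
  a.map star

/-! ### C⋆-probability spaces, freeness, semicircular and circular systems -/

section Free

variable {A : Type*} [CStarAlgebra A]

/-- `τ` is a state on the unital C⋆-algebra `A`, that is, `(A, τ)` is a C⋆-probability space. -/
structure IsState (τ : A →ₗ[ℂ] ℂ) : Prop where
  map_one : τ 1 = 1
  nonneg : ∀ a : A, 0 ≤ τ (star a * a)

/-- Freeness of a family of unital subalgebras with respect to `τ`: an alternating product
of centred elements is centred. A word is given as the list of its letters, each letter together
with the index of the subalgebra it belongs to. -/
def IsFreeFamily {ι : Type*} (τ : A →ₗ[ℂ] ℂ) (B : ι → Subalgebra ℂ A) : Prop :=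
  ∀ w : List (ι × A), w ≠ [] → (w.map Prod.fst).IsChain (· ≠ ·) →
    (∀ p ∈ w, p.2 ∈ B p.1 ∧ τ p.2 = 0) → τ (w.map Prod.snd).prod = 0

/-- `x` is a semicircular element with mean `0` and variance `1`: it is self-adjoint and its
distribution with respect to `τ` is `(2π)⁻¹ √(4 - t²) dt` on `[-2, 2]`. -/
structure IsSemicircular (τ : A →ₗ[ℂ] ℂ) (x : A) : Prop where
  isSelfAdjoint : IsSelfAdjoint x
  moment : ∀ p : ℕ,
    τ (x ^ p) = (((2 * Real.pi)⁻¹ * ∫ t in (-2 : ℝ)..2, t ^ p * Real.sqrt (4 - t ^ 2) : ℝ) : ℂ)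

/-- A semicircular system: a free family of standard semicircular elements. -/
structure IsSemicircularSystem {ι : Type*} (τ : A →ₗ[ℂ] ℂ) (x : ι → A) : Prop where
  semicircular : ∀ i, IsSemicircular τ (x i)
  free : IsFreeFamily τ fun i => Algebra.adjoin ℂ {x i}

/-- `y` is a circular system: the `2r` elements `(y_j + y_j^*) / √2` and
`(y_j - y_j^*) / (i √2)` form a semicircular system. -/
def IsCircularSystem {r : ℕ} (τ : A →ₗ[ℂ] ℂ) (y : Fin r → A) : Prop :=
  IsSemicircularSystem τ
    (Sum.elim (fun j : Fin r => ((Real.sqrt 2 : ℝ) : ℂ)⁻¹ • (y j + star (y j)))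
      (fun j : Fin r => (Complex.I * ((Real.sqrt 2 : ℝ) : ℂ))⁻¹ • (y j - star (y j))))

end Free

/-! ### Real Gaussian random matrices -/

section Gaussian

open MeasureTheory ProbabilityTheory

variable {Ω : Type*} [MeasurableSpace Ω]

/-- The class `GRM^ℝ(n, v)`: real random `n × n` matrices whose `n²` entries are independent and
`N(0, v)`-distributed (`v` is the variance). -/
structure IsGRMReal (P : Measure Ω) (n : ℕ) (v : ℝ≥0) (Y : Ω → Matrix (Fin n) (Fin n) ℝ) :
    Prop where
  hasLaw : ∀ k l, HasLaw (fun ω => Y ω k l) (gaussianReal 0 v) P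
  indep : iIndepFun (fun (p : Fin n × Fin n) ω => Y ω p.1 p.2) P

/-- The normalised trace `tr_n` on `M_n(ℂ)`. -/
def normTrace (n : ℕ) : Matrix (Fin n) (Fin n) ℂ →ₗ[ℂ] ℂ :=
  (n : ℂ)⁻¹ • Matrix.traceLinearMap (Fin n) ℂ ℂ

/-- The random matrix `S_n(ω) = a₀ ⊗ 1_n + ∑ j, (a_j ⊗ Y_j(ω) + a_j^* ⊗ Y_j(ω)^*)`. -/
def randomPencil {m r n : ℕ} (a₀ : Matrix (Fin m) (Fin m) ℂ)
    (a : Fin r → Matrix (Fin m) (Fin m) ℂ) (Y : Fin r → Ω → Matrix (Fin n) (Fin n) ℝ) (ω : Ω) :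
    Matrix (Fin m) (Fin m) (Matrix (Fin n) (Fin n) ℂ) :=
  pencil a₀ a fun j => (Y j ω).map Complex.ofReal

/-- The random matrix `H_n(z) = (id_m ⊗ tr_n)[(z ⊗ 1_n - S_n)⁻¹]`. -/
def randomCauchy {m r n : ℕ} (a₀ : Matrix (Fin m) (Fin m) ℂ)
    (a : Fin r → Matrix (Fin m) (Fin m) ℂ) (Y : Fin r → Ω → Matrix (Fin n) (Fin n) ℝ)
    (z : Matrix (Fin m) (Fin m) ℂ) (ω : Ω) : Matrix (Fin m) (Fin m) ℂ :=
  slice (normTrace n) (resolvent z (randomPencil a₀ a Y ω))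

/-- `G_n(z) = E{(id_m ⊗ tr_n)[(z ⊗ 1_n - S_n)⁻¹]}`, the expectation being taken entrywise. -/
def meanCauchy {m r n : ℕ} (P : Measure Ω) (a₀ : Matrix (Fin m) (Fin m) ℂ)
    (a : Fin r → Matrix (Fin m) (Fin m) ℂ) (Y : Fin r → Ω → Matrix (Fin n) (Fin n) ℝ)
    (z : Matrix (Fin m) (Fin m) ℂ) : Matrix (Fin m) (Fin m) ℂ :=
  Matrix.of fun i j => ∫ ω, randomCauchy a₀ a Y z ω i j ∂P

end Gaussian

/-! ### The limit objects -/

section Limit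

variable {m r : ℕ} {A : Type*} [CStarAlgebra A]

/-- `G(z) = (id_m ⊗ τ)[(z ⊗ 1 - s)⁻¹]`, where `s = a₀ ⊗ 1 + ∑ j, (a_j ⊗ y_j + a_j^* ⊗ y_j^*)`. -/
def limitCauchy (τ : A →ₗ[ℂ] ℂ) (a₀ : Matrix (Fin m) (Fin m) ℂ)
    (a : Fin r → Matrix (Fin m) (Fin m) ℂ) (y : Fin r → A) (z : Matrix (Fin m) (Fin m) ℂ) :
    Matrix (Fin m) (Fin m) ℂ :=
  slice τ (resolvent z (pencil a₀ a y))

/-- `s̄`, which is built like `s` from the matrices with conjugated entries. -/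
def conjPencil (a₀ : Matrix (Fin m) (Fin m) ℂ) (a : Fin r → Matrix (Fin m) (Fin m) ℂ)
    (y : Fin r → A) : Matrix (Fin m) (Fin m) A :=
  pencil (conjEntries a₀) (fun j => conjEntries (a j)) y

/-- For a matrix `b`, the sum
`∑ k l, b e_{kl} (id_m ⊗ τ)[(zᵗ ⊗ 1 - s̄)⁻¹ (e_{kl} b ⊗ 1) (z ⊗ 1 - s)⁻¹]`. -/
def limitRTerm (τ : A →ₗ[ℂ] ℂ) (a₀ : Matrix (Fin m) (Fin m) ℂ)
    (a : Fin r → Matrix (Fin m) (Fin m) ℂ) (y : Fin r → A) (z b : Matrix (Fin m) (Fin m) ℂ) :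
    Matrix (Fin m) (Fin m) ℂ :=
  ∑ k : Fin m, ∑ l : Fin m, b * Matrix.single k l (1 : ℂ) *
    slice τ (resolvent zᵀ (conjPencil a₀ a y) * tensor (Matrix.single k l (1 : ℂ) * b) 1 *
      resolvent z (pencil a₀ a y))

/-- The function `R(z)`. -/
def limitR (τ : A →ₗ[ℂ] ℂ) (a₀ : Matrix (Fin m) (Fin m) ℂ)
    (a : Fin r → Matrix (Fin m) (Fin m) ℂ) (y : Fin r → A) (z : Matrix (Fin m) (Fin m) ℂ) :
    Matrix (Fin m) (Fin m) ℂ :=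
  ∑ j, limitRTerm τ a₀ a y z (a j) + ∑ j, limitRTerm τ a₀ a y z (a j)ᴴ

/-- `L(z) = (id_m ⊗ τ)[(z ⊗ 1 - s)⁻¹ (R(z) G(z)⁻¹ ⊗ 1) (z ⊗ 1 - s)⁻¹]`. -/
def limitL (τ : A →ₗ[ℂ] ℂ) (a₀ : Matrix (Fin m) (Fin m) ℂ)
    (a : Fin r → Matrix (Fin m) (Fin m) ℂ) (y : Fin r → A) (z : Matrix (Fin m) (Fin m) ℂ) :
    Matrix (Fin m) (Fin m) ℂ :=
  slice τ (resolvent z (pencil a₀ a y) *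
    tensor (limitR τ a₀ a y z * (limitCauchy τ a₀ a y z)⁻¹) 1 * resolvent z (pencil a₀ a y))

end Limit

end RealGaussian

end

/-! # Second order expansion of the mean Cauchy transform of real Gaussian random matrices -/

/-! Write η for `covMap a`, G for the limit transform at z, H for the random slice of the resolvent,
and g for its mean (`meanC`). The proof compares the matrix Dyson equations of G and g.

The limit satisfies (z - a₀ - η(G)) G = 1 exactly (`IsCircularSystem.dyson`). Freeness enters
through alternating words in Chebyshev polynomials, which are centred. They give a Schwinger–Dyson
equation, hence a recursion for matrix-valued moments, hence the quadratic equation near infinity,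
and analytic continuation does the rest.

For the random matrices, Gaussian integration by parts gives (z - a₀) g = 1 + E[η(H) H] + E[Rₙ] / n
(`sub_mul_integral_cauchy`). Since the entries are real, differentiating in the entry (k, l) inserts
both e_kl and e_lk into the resolvent. One insertion produces a product of two normalised traces,
hence η(H) H. The other produces a transposed resolvent, is smaller by a factor 1/n, and gives Rₙ;
the transposed resolvent is the resolvent of the conjugate pencil at zᵗ, whence the shape of R. A
Poincaré inequality bounds the variance of H by O(n⁻²), so g solves the Dyson equation up to E[Rₙ] /
n and an error V = O(n⁻²) (`exists_dyson_meanC`).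

First order: if the total error is e, then g solves the exact Dyson equation at z - e g⁻¹. By
`dyson_unique`, g is the limit transform at that point, and the resolvent identity yields g - G =
O(1/n). The slices in R are off-diagonal blocks of the Cauchy transform of a pencil of twice the
size, so the same result also gives E[Rₙ] - R = O(1/n). This is why the index type ι is arbitrary.

Second order: D = g - G satisfies D = G η(D) G + G (η(D) D + V + E[Rₙ] / n), while L = G η(L) G + G
R. Therefore F = D - L/n satisfies F = G η(F) G + G W with W = O(n⁻²). The operator F ↦ F - G η(F) G
is inverted explicitly by the derivative of the Cauchy transform
(`IsCircularSystem.eq_of_linearized_dyson`), so its inverse has a polynomial bound.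

All estimates use a lower bound δ for the imaginary part of z. At the end δ = ‖(Im z)⁻¹‖⁻¹, so
powers of t = δ⁻¹ become powers of the argument of the polynomial. -/

noncomputable section

namespace RealGaussian

/-! ### Imaginary parts of quadratic forms -/

section Forms

variable {ι : Type*} [Fintype ι]

/-- The imaginary part of the quadratic form of a matrix. -/
def imForm (z : Matrix ι ι ℂ) (u : ι → ℂ) : ℝ := (star u ⬝ᵥ z *ᵥ u).im

/-- The squared Euclidean norm. -/
def sqNorm (u : ι → ℂ) : ℝ := ∑ i, ‖u i‖ ^ 2

/-- The imaginary part of `z` is at least `δ`. -/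
def ImGE (δ : ℝ) (z : Matrix ι ι ℂ) : Prop := ∀ u, δ * sqNorm u ≤ imForm z u

lemma sqNorm_nonneg (u : ι → ℂ) : 0 ≤ sqNorm u := Finset.sum_nonneg fun _ _ => sq_nonneg _

lemma sqNorm_eq (u : ι → ℂ) : sqNorm u = ‖WithLp.toLp 2 u‖ ^ 2 := by
  rw [EuclideanSpace.norm_sq_eq]; rfl

lemma imForm_add (z w : Matrix ι ι ℂ) (u : ι → ℂ) : imForm (z + w) u = imForm z u + imForm w u := by
  simp [imForm, Matrix.add_mulVec, dotProduct_add]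

lemma imForm_sub (z w : Matrix ι ι ℂ) (u : ι → ℂ) : imForm (z - w) u = imForm z u - imForm w u := by
  simp [imForm, Matrix.sub_mulVec, dotProduct_sub]

lemma imForm_sum {κ : Type*} (s : Finset κ) (f : κ → Matrix ι ι ℂ) (u : ι → ℂ) :
    imForm (∑ k ∈ s, f k) u = ∑ k ∈ s, imForm (f k) u := by
  simp [imForm, Matrix.sum_mulVec, dotProduct_sum]

lemma dotProduct_mulVec_adjoint (b : Matrix ι ι ℂ) (u v : ι → ℂ) :
    star u ⬝ᵥ b *ᵥ v = star (bᴴ *ᵥ u) ⬝ᵥ v := by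
  rw [Matrix.star_mulVec, Matrix.conjTranspose_conjTranspose, Matrix.dotProduct_mulVec]

lemma imForm_conj (b g : Matrix ι ι ℂ) (u : ι → ℂ) : imForm (b * g * bᴴ) u = imForm g (bᴴ *ᵥ u) := by
  rw [imForm, mul_assoc, ← Matrix.mulVec_mulVec, dotProduct_mulVec_adjoint, ← Matrix.mulVec_mulVec,
    imForm]

lemma imForm_conj' (b g : Matrix ι ι ℂ) (u : ι → ℂ) : imForm (bᴴ * g * b) u = imForm g (b *ᵥ u) := by
  simpa using imForm_conj bᴴ g u

lemma imForm_conjTranspose (g : Matrix ι ι ℂ) (u : ι → ℂ) : imForm gᴴ u = - imForm g u := by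
  have : star u ⬝ᵥ gᴴ *ᵥ u = star (star u ⬝ᵥ g *ᵥ u) := by
    rw [dotProduct_mulVec_adjoint, Matrix.conjTranspose_conjTranspose, Matrix.star_dotProduct]
  rw [imForm, this, imForm]; simp

lemma imForm_of_isHermitian {a : Matrix ι ι ℂ} (h : aᴴ = a) (u : ι → ℂ) : imForm a u = 0 := by
  have := imForm_conjTranspose a u
  rw [h] at this; linarith

lemma ImGE.transpose {δ : ℝ} {z : Matrix ι ι ℂ} (hz : ImGE δ z) : ImGE δ zᵀ := fun u => by
  have h : imForm zᵀ u = imForm z (star u) := by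
    rw [imForm, imForm, Matrix.mulVec_transpose, dotProduct_comm, ← Matrix.dotProduct_mulVec,
      star_star]
  have h2 : sqNorm (star u) = sqNorm u := by simp [sqNorm]
  rw [h, ← h2]; exact hz _

lemma ImGE.fromBlocks {δ : ℝ} {z w : Matrix ι ι ℂ} (hz : ImGE δ z) (hw : ImGE δ w) :
    ImGE δ (Matrix.fromBlocks z 0 0 w) := fun u => by
  have h1 := hz (u ∘ Sum.inl)
  have h2 := hw (u ∘ Sum.inr)
  have h3 : sqNorm u = sqNorm (u ∘ Sum.inl) + sqNorm (u ∘ Sum.inr) := by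
    simp [sqNorm, Fintype.sum_sum_type]
  have h4 : imForm (Matrix.fromBlocks z 0 0 w) u
      = imForm z (u ∘ Sum.inl) + imForm w (u ∘ Sum.inr) := by
    simp [imForm, Matrix.fromBlocks_mulVec, dotProduct, Fintype.sum_sum_type]
  rw [h3, h4]; linarith

variable [DecidableEq ι]

lemma sqNorm_mulVec_le (b : Matrix ι ι ℂ) (u : ι → ℂ) : sqNorm (b *ᵥ u) ≤ ‖b‖ ^ 2 * sqNorm u := by
  rw [sqNorm_eq, sqNorm_eq, ← mul_pow]
  gcongr
  exact Matrix.l2_opNorm_mulVec b (WithLp.toLp 2 u)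

lemma norm_dotProduct_mulVec_le (b : Matrix ι ι ℂ) (u v : ι → ℂ) :
    ‖star u ⬝ᵥ b *ᵥ v‖ ≤ ‖b‖ * ((sqNorm u + sqNorm v) / 2) := by
  have h1 : star u ⬝ᵥ b *ᵥ v = inner ℂ (WithLp.toLp 2 u) (WithLp.toLp 2 (b *ᵥ v)) := by
    rw [EuclideanSpace.inner_toLp_toLp, dotProduct_comm]
  have h2 := norm_inner_le_norm (𝕜 := ℂ) (WithLp.toLp 2 u) (WithLp.toLp 2 (b *ᵥ v))
  have h3 : ‖WithLp.toLp 2 (b *ᵥ v)‖ ≤ ‖b‖ * ‖WithLp.toLp 2 v‖ :=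
    Matrix.l2_opNorm_mulVec b (WithLp.toLp 2 v)
  rw [h1, sqNorm_eq, sqNorm_eq]
  refine h2.trans ((mul_le_mul_of_nonneg_left h3 (norm_nonneg _)).trans ?_)
  have := two_mul_le_add_sq ‖WithLp.toLp 2 u‖ ‖WithLp.toLp 2 v‖
  nlinarith [norm_nonneg b]

lemma abs_imForm_le (b : Matrix ι ι ℂ) (u : ι → ℂ) : |imForm b u| ≤ ‖b‖ * sqNorm u := by
  have := norm_dotProduct_mulVec_le b u u
  rw [add_self_div_two] at this
  exact (Complex.abs_im_le_norm _).trans this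

lemma ImGE.add_of_norm_le {δ ε : ℝ} {z w : Matrix ι ι ℂ} (hz : ImGE δ z) (hw : ‖w‖ ≤ ε) :
    ImGE (δ - ε) (z + w) := fun u => by
  have h1 := hz u
  have h2 := (abs_le.1 (abs_imForm_le w u)).1
  have h3 := mul_le_mul_of_nonneg_right hw (sqNorm_nonneg u)
  rw [imForm_add]; linarith

/-- The form is tested at a basis vector. The resulting inequality 1 ≤ ‖z‖ δ⁻¹ lets lower powers of
δ⁻¹ be absorbed into higher ones. -/
lemma ImGE.le_norm [Nonempty ι] {δ : ℝ} {z : Matrix ι ι ℂ} (hz : ImGE δ z) : δ ≤ ‖z‖ := by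
  obtain ⟨i⟩ := ‹Nonempty ι›
  have h := hz (Pi.single i 1)
  have h1 : sqNorm (Pi.single i (1 : ℂ)) = 1 := by
    rw [sqNorm, Finset.sum_eq_single i] <;> simp +contextual
  have h2 := (le_abs_self _).trans (abs_imForm_le z (Pi.single i 1))
  rw [h1] at h h2; linarith

/-- With x = g u one has u = w x, so ⟨u, g u⟩ = ⟨w x, x⟩ = ⟨x, wᴴ x⟩. The second version uses x = gᴴ
u; the uniqueness proof needs both, since g₁ acts on the left vector through its adjoint and g₂ acts
on the right one. -/
lemma imForm_of_mul_eq_one {w g : Matrix ι ι ℂ} (h : w * g = 1) (u : ι → ℂ) :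
    imForm g u = - imForm w (g *ᵥ u) := by
  have hu : u = w *ᵥ (g *ᵥ u) := by rw [Matrix.mulVec_mulVec, h, Matrix.one_mulVec]
  have : imForm g u = imForm wᴴ (g *ᵥ u) := by
    conv_lhs => rw [imForm]; enter [1, 1]; rw [hu]
    rw [imForm, dotProduct_mulVec_adjoint wᴴ, Matrix.conjTranspose_conjTranspose]
  rw [this, imForm_conjTranspose]

lemma imForm_of_mul_eq_one' {w g : Matrix ι ι ℂ} (h : w * g = 1) (u : ι → ℂ) :
    imForm g u = - imForm w (gᴴ *ᵥ u) := by
  have h' : wᴴ * gᴴ = 1 := by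
    rw [← Matrix.conjTranspose_mul, mul_eq_one_comm.1 h, Matrix.conjTranspose_one]
  have := imForm_of_mul_eq_one h' u
  rw [imForm_conjTranspose, imForm_conjTranspose] at this
  linarith

end Forms

/-! ### The covariance map and the matrix Dyson equation -/

section Dyson

variable {ι : Type*} [Fintype ι] {r : ℕ}

/-- The completely positive map `g ↦ ∑ j, (a_j g a_j^* + a_j^* g a_j)`. -/
def covMap (a : Fin r → Matrix ι ι ℂ) (g : Matrix ι ι ℂ) : Matrix ι ι ℂ :=
  ∑ j, (a j * g * (a j)ᴴ + (a j)ᴴ * g * a j)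

lemma covMap_sub (a : Fin r → Matrix ι ι ℂ) (g h : Matrix ι ι ℂ) :
    covMap a (g - h) = covMap a g - covMap a h := by
  simp only [covMap, ← Finset.sum_sub_distrib, mul_sub, sub_mul]
  exact Finset.sum_congr rfl fun _ _ => by abel

lemma covMap_add (a : Fin r → Matrix ι ι ℂ) (g h : Matrix ι ι ℂ) :
    covMap a (g + h) = covMap a g + covMap a h := by
  simp only [covMap, ← Finset.sum_add_distrib, mul_add, add_mul]
  exact Finset.sum_congr rfl fun _ _ => by abel

lemma covMap_smul (a : Fin r → Matrix ι ι ℂ) (c : ℂ) (g : Matrix ι ι ℂ) :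
    covMap a (c • g) = c • covMap a g := by
  simp [covMap, Finset.smul_sum]

lemma imForm_covMap (a : Fin r → Matrix ι ι ℂ) (g : Matrix ι ι ℂ) (u : ι → ℂ) :
    imForm (covMap a g) u = ∑ j, (imForm g ((a j)ᴴ *ᵥ u) + imForm g (a j *ᵥ u)) := by
  simp only [covMap, imForm_sum, imForm_add, imForm_conj, imForm_conj']

variable [DecidableEq ι]

lemma norm_covMap_le {κ : ℝ} {a : Fin r → Matrix ι ι ℂ} (ha : ∀ j, ‖a j‖ ≤ κ) (g : Matrix ι ι ℂ) :
    ‖covMap a g‖ ≤ 2 * r * κ ^ 2 * ‖g‖ := by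
  have h : ∀ j, ‖a j * g * (a j)ᴴ + (a j)ᴴ * g * a j‖ ≤ 2 * κ ^ 2 * ‖g‖ := fun j => by
    have hκ : 0 ≤ κ := (norm_nonneg _).trans (ha j)
    have h1 : ‖a j * g * (a j)ᴴ‖ ≤ κ * ‖g‖ * κ := by
      refine (norm_mul_le _ _).trans ?_
      rw [Matrix.l2_opNorm_conjTranspose]
      exact mul_le_mul ((norm_mul_le _ _).trans (by gcongr; exact ha j)) (ha j) (norm_nonneg _)
        (by positivity)
    have h2 : ‖(a j)ᴴ * g * a j‖ ≤ κ * ‖g‖ * κ := by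
      refine (norm_mul_le _ _).trans ?_
      refine mul_le_mul ((norm_mul_le _ _).trans ?_) (ha j) (norm_nonneg _) (by positivity)
      rw [Matrix.l2_opNorm_conjTranspose]
      gcongr; exact ha j
    refine (norm_add_le _ _).trans ((add_le_add h1 h2).trans (le_of_eq (by ring)))
  refine (norm_sum_le _ _).trans ((Finset.sum_le_sum fun j _ => h j).trans (le_of_eq ?_))
  simp; ring

section Unique

variable {a₀ : Matrix ι ι ℂ} {a : Fin r → Matrix ι ι ℂ} {μ g : Matrix ι ι ℂ} {δ : ℝ}

/-- For the inverse w of g, -Im ⟨u, g u⟩ = Im ⟨g u, w g u⟩ ≥ δ |g u|², because -Im η(g) ≥ 0 only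
helps. Moreover |u| ≤ ‖w‖ |g u|. This starts the iteration in `dyson_unique`. -/
lemma exists_imForm_coercive (h₀ : a₀ᴴ = a₀) (hδ : 0 < δ) (hμ : ImGE δ μ)
    (hg : ∀ u, imForm g u ≤ 0) (h : (μ - a₀ - covMap a g) * g = 1) :
    ∃ C, 0 ≤ C ∧ ∀ u, sqNorm u ≤ C * (- imForm g u) := by
  set w := μ - a₀ - covMap a g
  refine ⟨‖w‖ ^ 2 * δ⁻¹, by positivity, fun u => ?_⟩
  have h1 : sqNorm u ≤ ‖w‖ ^ 2 * sqNorm (g *ᵥ u) := by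
    have := sqNorm_mulVec_le w (g *ᵥ u)
    rwa [Matrix.mulVec_mulVec, h, Matrix.one_mulVec] at this
  have h2 : δ * sqNorm (g *ᵥ u) ≤ - imForm g u := by
    rw [imForm_of_mul_eq_one h, neg_neg, imForm_sub, imForm_sub, imForm_of_isHermitian h₀,
      imForm_covMap]
    have : ∑ j, (imForm g ((a j)ᴴ *ᵥ g *ᵥ u) + imForm g (a j *ᵥ g *ᵥ u)) ≤ 0 :=
      Finset.sum_nonpos fun j _ => add_nonpos (hg _) (hg _)
    linarith [hμ (g *ᵥ u)]
  calc sqNorm u ≤ ‖w‖ ^ 2 * sqNorm (g *ᵥ u) := h1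
    _ = ‖w‖ ^ 2 * δ⁻¹ * (δ * sqNorm (g *ᵥ u)) := by field_simp
    _ ≤ _ := by gcongr

/-- Put P(x) = -Im ⟨x, η(g) x⟩ ≤ M |x|² with M = ‖η(g)‖. Since Im ⟨x, w x⟩ ≥ δ |x|² + P(x), it
follows that P(x) ≤ M / (M + δ) · Im ⟨x, w x⟩, and the last form at x = g u or x = gᴴ u equals -Im
⟨u, g u⟩. The factor is less than 1 thanks to δ > 0. -/
lemma exists_imForm_contraction (h₀ : a₀ᴴ = a₀) (hδ : 0 < δ) (hμ : ImGE δ μ)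
    (h : (μ - a₀ - covMap a g) * g = 1) :
    ∃ ρ, 0 ≤ ρ ∧ ρ < 1 ∧ (∀ u, ∑ j, (- imForm g ((a j)ᴴ *ᵥ g *ᵥ u) - imForm g (a j *ᵥ g *ᵥ u))
        ≤ ρ * (- imForm g u)) ∧
      ∀ u, ∑ j, (- imForm g ((a j)ᴴ *ᵥ gᴴ *ᵥ u) - imForm g (a j *ᵥ gᴴ *ᵥ u))
        ≤ ρ * (- imForm g u) := by
  set w := μ - a₀ - covMap a g with hw
  set M := ‖covMap a g‖ with hM
  have hM0 : 0 ≤ M := norm_nonneg _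
  have key : ∀ x, ∑ j, (- imForm g ((a j)ᴴ *ᵥ x) - imForm g (a j *ᵥ x))
      ≤ M / (M + δ) * imForm w x := fun x => by
    have e : ∑ j, (- imForm g ((a j)ᴴ *ᵥ x) - imForm g (a j *ᵥ x)) = - imForm (covMap a g) x := by
      rw [imForm_covMap, ← Finset.sum_neg_distrib]
      exact Finset.sum_congr rfl fun _ _ => by ring
    rw [e, hw, imForm_sub, imForm_sub, imForm_of_isHermitian h₀, div_mul_eq_mul_div,
      le_div_iff₀ (by positivity)]
    have h1 : - imForm (covMap a g) x ≤ M * sqNorm x :=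
      (neg_le_abs _).trans (abs_imForm_le _ x)
    have h2 := mul_le_mul_of_nonneg_left (hμ x) hM0
    have h3 := mul_le_mul_of_nonneg_right h1 hδ.le
    linarith
  refine ⟨M / (M + δ), by positivity, (div_lt_one (by positivity)).2 (by linarith), fun u => ?_,
    fun u => ?_⟩
  · rw [imForm_of_mul_eq_one h, neg_neg]; exact key _
  · rw [imForm_of_mul_eq_one' h, neg_neg]; exact key _

/-- The matrix Dyson equation has at most one solution with non-positive imaginary part. -/
theorem dyson_unique {g₁ g₂ : Matrix ι ι ℂ} (h₀ : a₀ᴴ = a₀) (hδ : 0 < δ) (hμ : ImGE δ μ)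
    (hg₁ : ∀ u, imForm g₁ u ≤ 0) (h₁ : (μ - a₀ - covMap a g₁) * g₁ = 1)
    (hg₂ : ∀ u, imForm g₂ u ≤ 0) (h₂ : (μ - a₀ - covMap a g₂) * g₂ = 1) : g₁ = g₂ := by
  obtain ⟨C₁, hC₁, k₁⟩ := exists_imForm_coercive h₀ hδ hμ hg₁ h₁
  obtain ⟨C₂, hC₂, k₂⟩ := exists_imForm_coercive h₀ hδ hμ hg₂ h₂
  obtain ⟨ρ₁, hρ₁, hρ₁', -, c₁⟩ := exists_imForm_contraction h₀ hδ hμ h₁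
  obtain ⟨ρ₂, hρ₂, hρ₂', c₂, -⟩ := exists_imForm_contraction h₀ hδ hμ h₂
  set h := g₁ - g₂ with hh
  -- The terms μ - a₀ cancel in the difference of the inverses of g₂ and g₁, which leaves η(h).
  have hfix : h = g₁ * covMap a h * g₂ := by
    have e : covMap a h = (μ - a₀ - covMap a g₂) - (μ - a₀ - covMap a g₁) := by
      rw [hh, covMap_sub]; abel
    rw [e, mul_sub, sub_mul, mul_assoc, h₂, mul_eq_one_comm.1 h₁]; simp [hh]
  set ρ := max ρ₁ ρ₂
  have hρ : 0 ≤ ρ := le_max_of_le_left hρ₁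
  have hρ' : ρ < 1 := max_lt hρ₁' hρ₂'
  set p₁ : (ι → ℂ) → ℝ := fun u => - imForm g₁ u
  set p₂ : (ι → ℂ) → ℝ := fun u => - imForm g₂ u
  have hp₁ : ∀ u, 0 ≤ p₁ u := fun u => neg_nonneg.2 (hg₁ u)
  have hp₂ : ∀ u, 0 ≤ p₂ u := fun u => neg_nonneg.2 (hg₂ u)
  set K := ‖h‖ * (C₁ + C₂)
  have hK : 0 ≤ K := by positivity
  -- The fixed point identity for h is iterated k times. Coercivity gives the case k = 0, and each
  -- step gains the factor ρ by contraction. Letting k tend to infinity forces h = 0.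
  have main : ∀ k : ℕ, ∀ u v, ‖star u ⬝ᵥ h *ᵥ v‖ ≤ K * ρ ^ k * (p₁ u + p₂ v) := by
    intro k
    induction k with
    | zero =>
      intro u v
      refine (norm_dotProduct_mulVec_le h u v).trans ?_
      have h1 := k₁ u
      have h2 := k₂ v
      have h3 := mul_nonneg hC₁ (hp₂ v)
      have h4 := mul_nonneg hC₂ (hp₁ u)
      have h5 := sqNorm_nonneg u
      have h6 := sqNorm_nonneg v
      rw [pow_zero, mul_one, mul_assoc]
      refine mul_le_mul_of_nonneg_left ?_ (norm_nonneg _)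
      simp only [p₁, p₂] at *
      linarith
    | succ k ih =>
      intro u v
      have e : star u ⬝ᵥ h *ᵥ v = ∑ j,
          (star ((a j)ᴴ *ᵥ g₁ᴴ *ᵥ u) ⬝ᵥ h *ᵥ ((a j)ᴴ *ᵥ g₂ *ᵥ v)
            + star (a j *ᵥ g₁ᴴ *ᵥ u) ⬝ᵥ h *ᵥ (a j *ᵥ g₂ *ᵥ v)) := by
        conv_lhs => rw [hfix]
        rw [mul_assoc, ← Matrix.mulVec_mulVec, dotProduct_mulVec_adjoint, ← Matrix.mulVec_mulVec,
          covMap, Matrix.sum_mulVec, dotProduct_sum]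
        refine Finset.sum_congr rfl fun j _ => ?_
        rw [Matrix.add_mulVec, dotProduct_add, mul_assoc, ← Matrix.mulVec_mulVec,
          dotProduct_mulVec_adjoint (a j), ← Matrix.mulVec_mulVec, mul_assoc (a j)ᴴ,
          ← Matrix.mulVec_mulVec (g₂ *ᵥ v) (a j)ᴴ, dotProduct_mulVec_adjoint (a j)ᴴ,
          Matrix.conjTranspose_conjTranspose, ← Matrix.mulVec_mulVec]
      have b₁ := c₁ u
      have b₂ := c₂ v
      have b₁' : ρ₁ * p₁ u ≤ ρ * p₁ u := mul_le_mul_of_nonneg_right (le_max_left _ _) (hp₁ u)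
      have b₂' : ρ₂ * p₂ v ≤ ρ * p₂ v := mul_le_mul_of_nonneg_right (le_max_right _ _) (hp₂ v)
      calc ‖star u ⬝ᵥ h *ᵥ v‖ ≤ ∑ j, (K * ρ ^ k * (p₁ ((a j)ᴴ *ᵥ g₁ᴴ *ᵥ u) + p₂ ((a j)ᴴ *ᵥ g₂ *ᵥ v))
            + K * ρ ^ k * (p₁ (a j *ᵥ g₁ᴴ *ᵥ u) + p₂ (a j *ᵥ g₂ *ᵥ v))) := by
            rw [e]
            exact (norm_sum_le _ _).trans (Finset.sum_le_sum fun j _ =>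
              (norm_add_le _ _).trans (add_le_add (ih _ _) (ih _ _)))
        _ = K * ρ ^ k * (∑ j, (- imForm g₁ ((a j)ᴴ *ᵥ g₁ᴴ *ᵥ u) - imForm g₁ (a j *ᵥ g₁ᴴ *ᵥ u))
            + ∑ j, (- imForm g₂ ((a j)ᴴ *ᵥ g₂ *ᵥ v) - imForm g₂ (a j *ᵥ g₂ *ᵥ v))) := by
            rw [← Finset.sum_add_distrib, Finset.mul_sum]
            exact Finset.sum_congr rfl fun j _ => by simp only [p₁, p₂]; ring
        _ ≤ K * ρ ^ k * (ρ * p₁ u + ρ * p₂ v) := by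
            gcongr
            · exact b₁.trans b₁'
            · exact b₂.trans b₂'
        _ = _ := by ring
  have hzero : ∀ u v, star u ⬝ᵥ h *ᵥ v = 0 := fun u v => by
    have ht : Filter.Tendsto (fun k : ℕ => K * ρ ^ k * (p₁ u + p₂ v)) Filter.atTop (nhds 0) := by
      have := ((tendsto_pow_atTop_nhds_zero_of_lt_one hρ hρ').const_mul K).mul_const (p₁ u + p₂ v)
      simpa using this
    exact norm_le_zero_iff.1 (ge_of_tendsto' ht fun k => main k u v)
  have : h = 0 := by
    ext i j
    have := hzero (Pi.single i 1) (Pi.single j 1)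
    simpa [← Pi.single_star] using this
  exact sub_eq_zero.1 this

end Unique

end Dyson

/-! ### Invertibility of elements with strictly positive imaginary part. -/

section Abstract
variable {B : Type*} [CStarAlgebra B] [PartialOrder B] [StarOrderedRing B]

/-- An element of a C⋆-algebra whose imaginary part is at least `δ > 0` is invertible, and its
inverse has norm at most `δ⁻¹`. -/
theorem isUnit_of_im_ge {δ : ℝ} (hδ : 0 < δ) {z p : B} (hz : z - star z = (2 * Complex.I) • p)
    (hp : algebraMap ℝ B δ ≤ p) : IsUnit z ∧ ∀ x, z * x = 1 → ‖x‖ ≤ δ⁻¹ := by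
  have hp0 : 0 ≤ p := le_trans (algebraMap_nonneg B hδ.le) hp
  have hδu : IsUnit (algebraMap ℝ B δ) := (isUnit_iff_ne_zero.2 hδ.ne').map _
  have hpu : IsUnit p := CStarAlgebra.isUnit_of_le _ hp (isStrictlyPositive_algebraMap hδ)
  have hps : IsSelfAdjoint p := .of_nonneg hp0
  constructor
  -- With z = h + i p, h self-adjoint and q = √p, one has z = q (q⁻¹ h q⁻¹ + i) q. The middle factor
  -- is invertible since the spectrum of a self-adjoint element is real.
  · set q := CFC.sqrt p
    have hqs : star q = q := IsSelfAdjoint.of_nonneg (CFC.sqrt_nonneg p)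
    have hqq : q * q = p := CFC.sqrt_mul_sqrt_self p
    obtain ⟨v, hv⟩ : IsUnit q := (CFC.isUnit_sqrt_iff p).2 hpu
    set y : B := ↑v⁻¹
    have hvy : q * y = 1 := by rw [← hv]; exact v.mul_inv
    have hyv : y * q = 1 := by rw [← hv]; exact v.inv_mul
    have hys : star y = y := by
      have h1 : star y * q = 1 := by rw [← hqs, ← star_mul, hvy, star_one]
      calc star y = star y * (q * y) := by rw [hvy, mul_one]
        _ = y := by rw [← mul_assoc, h1, one_mul]
    set h := z - Complex.I • p
    have hhs : star h = h := by
      have : z = star z + (2 * Complex.I) • p := by rw [← hz]; abel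
      simp only [h, star_sub, star_smul, hps.star_eq, Complex.star_def, Complex.conj_I]
      conv_rhs => rw [this]
      module
    have hk : IsSelfAdjoint (y * h * y) := by
      simp [IsSelfAdjoint, hys, hhs, mul_assoc]
    have hu : IsUnit (y * h * y + algebraMap ℂ B Complex.I) := by
      by_contra hn
      have : -Complex.I ∈ spectrum ℂ (y * h * y) := by
        rw [spectrum.mem_iff]
        intro h'
        apply hn
        rw [← IsUnit.neg_iff]
        convert h' using 1
        simp; abel
      have := hk.im_eq_zero_of_mem_spectrum this
      simp at this
    have : z = q * (y * h * y + algebraMap ℂ B Complex.I) * q := by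
      rw [mul_add, add_mul]
      have e1 : q * (y * h * y) * q = h := by
        calc _ = (q * y) * h * (y * q) := by simp only [mul_assoc]
          _ = h := by rw [hvy, hyv]; simp
      have e2 : q * algebraMap ℂ B Complex.I * q = Complex.I • p := by
        rw [← Algebra.commutes, mul_assoc, hqq, Algebra.smul_def]
      rw [e1, e2]; simp [h]
    rw [this]
    have hq : IsUnit q := hv ▸ v.isUnit
    exact (hq.mul hu).mul hq
  · intro x hx
    have hx' : star x * star z = 1 := by rw [← star_mul, hx, star_one]
    -- From z x = 1 the element x* p x is (x* - x) / 2i, of norm at most ‖x‖. It dominates δ x* x,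
    -- so δ ‖x‖² ≤ ‖x‖.
    have e : star x * p * x = (2 * Complex.I)⁻¹ • (star x - x) := by
      have h2I : (2 * Complex.I) ≠ 0 := by simp
      rw [eq_inv_smul_iff₀ h2I]
      calc (2 * Complex.I) • (star x * p * x) = star x * ((2 * Complex.I) • p) * x := by
            simp
        _ = _ := by rw [← hz, mul_sub, sub_mul, mul_assoc, hx, mul_one, hx', one_mul]
    have h1 : δ • (star x * x) ≤ star x * p * x := by
      have := star_left_conjugate_le_conjugate hp x
      rwa [← Algebra.commutes, mul_assoc, ← Algebra.smul_def] at this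
    have h0 : 0 ≤ δ • (star x * x) := smul_nonneg hδ.le (star_mul_self_nonneg x)
    have h3 := CStarAlgebra.norm_le_norm_of_nonneg_of_le h0 h1
    rw [e, norm_smul, norm_smul, CStarRing.norm_star_mul_self] at h3
    have h4 : ‖star x - x‖ ≤ 2 * ‖x‖ := (norm_sub_le _ _).trans (by rw [norm_star]; linarith)
    have h5 : δ * (‖x‖ * ‖x‖) ≤ ‖x‖ := by
      have : ‖(2 * Complex.I)⁻¹‖ = 1 / 2 := by simp
      rw [this, Real.norm_of_nonneg hδ.le] at h3
      linarith
    rcases (norm_nonneg x).eq_or_lt with h6 | h6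
    · rw [← h6]; positivity
    · rw [le_inv_comm₀ h6 hδ, ← one_div, le_div_iff₀ h6]
      nlinarith

end Abstract

/-! ### Matrices over an algebra -/

section Amplification

variable {ι : Type*} {A : Type*} [Ring A] [Algebra ℂ A]

/-- The elementary tensor `a ⊗ x` in `M_ι(A)`. -/
def amp (a : Matrix ι ι ℂ) (x : A) : Matrix ι ι A := Matrix.of fun i j => a i j • x

/-- The slice map of a linear functional on `M_ι(A)`. -/
def sliceMap (φ : A →ₗ[ℂ] ℂ) (X : Matrix ι ι A) : Matrix ι ι ℂ := Matrix.of fun i j => φ (X i j)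

lemma amp_apply (a : Matrix ι ι ℂ) (x : A) (i j : ι) : amp a x i j = a i j • x := rfl

lemma sliceMap_apply (φ : A →ₗ[ℂ] ℂ) (X : Matrix ι ι A) (i j : ι) :
    sliceMap φ X i j = φ (X i j) := rfl

lemma amp_add (a b : Matrix ι ι ℂ) (x : A) : amp (a + b) x = amp a x + amp b x := by
  ext i j; simp [amp_apply, add_smul]

lemma amp_sub (a b : Matrix ι ι ℂ) (x : A) : amp (a - b) x = amp a x - amp b x := by
  ext i j; simp [amp_apply, sub_smul]

lemma amp_smul (c : ℂ) (a : Matrix ι ι ℂ) (x : A) : amp (c • a) x = c • amp a x := by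
  ext i j; simp [amp_apply, smul_smul]

lemma amp_one [DecidableEq ι] : amp (1 : Matrix ι ι ℂ) (1 : A) = 1 := by
  ext i j; by_cases h : i = j <;> simp [amp_apply, Matrix.one_apply, h]

lemma amp_conjTranspose [StarRing A] [StarModule ℂ A] (a : Matrix ι ι ℂ) (x : A) :
    (amp a x)ᴴ = amp aᴴ (star x) := by
  ext i j; simp [amp_apply, Matrix.conjTranspose_apply]

lemma sliceMap_add (φ : A →ₗ[ℂ] ℂ) (X Y : Matrix ι ι A) :
    sliceMap φ (X + Y) = sliceMap φ X + sliceMap φ Y := by ext i j; simp [sliceMap_apply]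

lemma sliceMap_sub (φ : A →ₗ[ℂ] ℂ) (X Y : Matrix ι ι A) :
    sliceMap φ (X - Y) = sliceMap φ X - sliceMap φ Y := by ext i j; simp [sliceMap_apply]

lemma sliceMap_smul (φ : A →ₗ[ℂ] ℂ) (c : ℂ) (X : Matrix ι ι A) :
    sliceMap φ (c • X) = c • sliceMap φ X := by ext i j; simp [sliceMap_apply]

lemma sliceMap_sum {κ : Type*} (φ : A →ₗ[ℂ] ℂ) (s : Finset κ) (f : κ → Matrix ι ι A) :
    sliceMap φ (∑ k ∈ s, f k) = ∑ k ∈ s, sliceMap φ (f k) := by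
  ext i j; simp [sliceMap_apply, Matrix.sum_apply]

lemma sliceMap_amp (φ : A →ₗ[ℂ] ℂ) (hφ : φ 1 = 1) (a : Matrix ι ι ℂ) :
    sliceMap φ (amp a (1 : A)) = a := by
  ext i j; simp [sliceMap_apply, amp_apply, hφ]

variable [Fintype ι]

lemma amp_mul_amp (a b : Matrix ι ι ℂ) (x y : A) : amp a x * amp b y = amp (a * b) (x * y) := by
  ext i j
  simp [amp_apply, Matrix.mul_apply, Finset.sum_smul, smul_smul, mul_comm]

lemma amp_mul_apply (a : Matrix ι ι ℂ) (x : A) (X : Matrix ι ι A) (i j : ι) :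
    (amp a x * X) i j = ∑ k, a i k • (x * X k j) := by
  simp [Matrix.mul_apply, amp_apply]

lemma sliceMap_amp_mul (φ : A →ₗ[ℂ] ℂ) (a : Matrix ι ι ℂ) (X : Matrix ι ι A) :
    sliceMap φ (amp a 1 * X) = a * sliceMap φ X := by
  ext i j; simp [sliceMap_apply, amp_apply, Matrix.mul_apply]

lemma sliceMap_mul_amp (φ : A →ₗ[ℂ] ℂ) (a : Matrix ι ι ℂ) (X : Matrix ι ι A) :
    sliceMap φ (X * amp a 1) = sliceMap φ X * a := by
  ext i j; simp [sliceMap_apply, amp_apply, Matrix.mul_apply, mul_comm]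

end Amplification

/-! ### Resolvents of self-adjoint elements of `M_ι(A)`. -/

section CStarAmplification

variable {ι : Type*} [Fintype ι] [DecidableEq ι] {A : Type*} [CStarAlgebra A]

/-- The matrix Im z - δ is positive semidefinite, hence a square qᴴ q. In this form positivity
survives tensoring with 1, because `amp` is multiplicative and respects adjoints. -/
lemma exists_conjTranspose_mul_self {δ : ℝ} {z : Matrix ι ι ℂ} (hz : ImGE δ z) :
    ∃ q : Matrix ι ι ℂ, z - zᴴ = (2 * Complex.I) • (qᴴ * q + (δ : ℂ) • 1) := by
  set p : Matrix ι ι ℂ := (2 * Complex.I)⁻¹ • (z - zᴴ) with hp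
  have h2I : (2 * Complex.I) ≠ 0 := by simp
  have hpp : pᴴ = p := by
    rw [hp, Matrix.conjTranspose_smul, Matrix.conjTranspose_sub, Matrix.conjTranspose_conjTranspose]
    simp only [star_inv₀, star_mul', Complex.star_def, Complex.conj_I, map_ofNat]
    rw [mul_neg, inv_neg, neg_smul, ← smul_neg, neg_sub]
  have hform : ∀ u, star u ⬝ᵥ p *ᵥ u = (imForm z u : ℂ) := fun u => by
    have h1 : star u ⬝ᵥ zᴴ *ᵥ u = star (star u ⬝ᵥ z *ᵥ u) := by
      rw [dotProduct_mulVec_adjoint, Matrix.conjTranspose_conjTranspose, Matrix.star_dotProduct]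
    rw [hp, Matrix.smul_mulVec, dotProduct_smul, Matrix.sub_mulVec, dotProduct_sub, h1,
      Complex.star_def, Complex.sub_conj, smul_eq_mul, imForm]
    field_simp
    push_cast
    ring
  have hnorm : ∀ u : ι → ℂ, star u ⬝ᵥ u = (sqNorm u : ℂ) := fun u => by
    simp [dotProduct, sqNorm, ← Complex.conj_mul']
  have hpos : (p - (δ : ℂ) • 1).PosSemidef := by
    refine Matrix.PosSemidef.of_dotProduct_mulVec_nonneg ?_ fun u => ?_
    · simp [Matrix.IsHermitian, hpp]
    · rw [Matrix.sub_mulVec, dotProduct_sub, hform, Matrix.smul_mulVec, Matrix.one_mulVec,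
        dotProduct_smul, hnorm, smul_eq_mul, ← Complex.ofReal_mul, ← Complex.ofReal_sub,
        Complex.zero_le_real]
      linarith [hz u]
  obtain ⟨q, hq⟩ : ∃ q : Matrix ι ι ℂ, p - (δ : ℂ) • 1 = star q * q := by
    open scoped MatrixOrder in exact CStarAlgebra.nonneg_iff_eq_star_mul_self.1 hpos.nonneg
  refine ⟨q, ?_⟩
  rw [← Matrix.star_eq_conjTranspose q, ← hq, sub_add_cancel, hp, smul_inv_smul₀ h2I]

/-- The resolvent of a self-adjoint element of `M_ι(A)` exists at every matrix with positive
imaginary part. -/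
theorem resolvent_bound {δ : ℝ} (hδ : 0 < δ) {z : Matrix ι ι ℂ} (hz : ImGE δ z)
    {s : Matrix ι ι A} (hs : sᴴ = s) : IsUnit (amp z 1 - s) ∧
      ∀ X, (amp z 1 - s) * X = 1 → ∀ i j, ‖X i j‖ ≤ δ⁻¹ := by
  let _ : PartialOrder A := CStarAlgebra.spectralOrder A
  have : StarOrderedRing A := CStarAlgebra.spectralOrderedRing A
  obtain ⟨q, hq⟩ := exists_conjTranspose_mul_self hz
  -- The abstract statement is applied in `CStarMatrix`, which carries the C⋆-norm; that norm
  -- dominates the norm of every entry.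
  let e := CStarMatrix.ofMatrixRingEquiv (n := ι) (A := A)
  have he : ∀ x, e xᴴ = star (e x) := fun x => rfl
  have hz' : e (amp z 1 - s) - star (e (amp z 1 - s))
      = (2 * Complex.I) • e (amp (qᴴ * q + (δ : ℂ) • 1) 1) := by
    have : (amp z 1 - s) - (amp z 1 - s)ᴴ
        = (2 * Complex.I) • amp (qᴴ * q + (δ : ℂ) • 1) (1 : A) := by
      rw [← amp_smul, ← hq, Matrix.conjTranspose_sub, hs, amp_conjTranspose, star_one, amp_sub]
      abel
    rw [← he, ← map_sub, this]; rfl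
  have hp : algebraMap ℝ _ δ ≤ e (amp (qᴴ * q + (δ : ℂ) • 1) 1) := by
    have e1 : e (amp (qᴴ * q + (δ : ℂ) • 1) 1) = star (e (amp q 1)) * e (amp q 1)
        + algebraMap ℝ _ δ := by
      rw [amp_add, map_add, ← he, ← map_mul, amp_conjTranspose, amp_mul_amp, star_one, mul_one,
        amp_smul, amp_one, Algebra.algebraMap_eq_smul_one]
      rfl
    rw [e1]
    exact le_add_of_nonneg_left (star_mul_self_nonneg _)
  obtain ⟨h1, h2⟩ := isUnit_of_im_ge hδ hz' hp
  refine ⟨(MulEquiv.isUnit_map e).1 h1, fun X hX i j => ?_⟩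
  have := h2 (e X) (by rw [← map_mul, hX, map_one])
  exact CStarMatrix.norm_entry_le_norm.trans this

end CStarAmplification

/-! ### Norms of matrices and their entries -/

section Entries

variable {ι : Type*} [Fintype ι] [DecidableEq ι]

lemma norm_single_le (i j : ι) : ‖(Matrix.single i j 1 : Matrix ι ι ℂ)‖ ≤ 1 := by
  have h := Matrix.l2_opNorm_conjTranspose_mul_self (Matrix.single i j 1 : Matrix ι ι ℂ)
  rw [Matrix.conjTranspose_single, Matrix.single_mul_single_same, star_one, one_mul,
    ← Matrix.diagonal_single, Matrix.l2_opNorm_diagonal, Pi.norm_single, norm_one] at h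
  nlinarith [norm_nonneg (Matrix.single i j 1 : Matrix ι ι ℂ)]

/-- Operator norms are compared with entries at the cost of powers of the dimension. This is
harmless, since the final polynomial may depend on m. -/
lemma norm_le_of_entries_le {M : Matrix ι ι ℂ} {c : ℝ} (h : ∀ i j, ‖M i j‖ ≤ c) :
    ‖M‖ ≤ (Fintype.card ι : ℝ) ^ 2 * c := by
  rw [Matrix.matrix_eq_sum_single M]
  have h1 : ∀ i j, ‖Matrix.single i j (M i j)‖ ≤ c := fun i j => by
    have : Matrix.single i j (M i j) = M i j • Matrix.single i j (1 : ℂ) := by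
      rw [Matrix.smul_single, smul_eq_mul, mul_one]
    rw [this, norm_smul]
    exact (mul_le_of_le_one_right (norm_nonneg _) (norm_single_le i j)).trans (h i j)
  refine (norm_sum_le _ _).trans ((Finset.sum_le_sum fun i _ => (norm_sum_le _ _).trans
    (Finset.sum_le_sum fun j _ => h1 i j)).trans (le_of_eq ?_))
  simp; ring

lemma norm_entry_le (M : Matrix ι ι ℂ) (i j : ι) : ‖M i j‖ ≤ ‖M‖ := by
  have h := norm_dotProduct_mulVec_le M (Pi.single i 1) (Pi.single j 1)
  have h1 : ∀ k : ι, sqNorm (Pi.single k (1 : ℂ)) = 1 := fun k => by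
    rw [sqNorm, Finset.sum_eq_single k] <;> simp +contextual
  rw [h1, h1] at h
  simpa [← Pi.single_star] using h

end Entries

/-! ### States -/

section State

variable {A : Type*} [CStarAlgebra A] {τ : A →ₗ[ℂ] ℂ}

/-- Positivity of τ at (1 + c x)* (1 + c x) makes the imaginary part of c τ(x) + c̄ τ(x*) vanish.
The choices c = 1 and c = i give the two coordinates. -/
lemma IsState.map_star (hτ : IsState τ) (x : A) : τ (star x) = star (τ x) := by
  have key : ∀ c : ℂ, 0 ≤ 1 + c * τ x + star c * τ (star x) + star c * c * τ (star x * x) := by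
    intro c
    have := hτ.nonneg (1 + c • x)
    simp only [star_add, star_one, star_smul, add_mul, mul_add, one_mul, mul_one, map_add,
      hτ.map_one, map_smul, smul_eq_mul, smul_mul_smul_comm] at this
    convert this using 1
    ring
  have hq := Complex.nonneg_iff.1 (hτ.nonneg x)
  have h1 := (Complex.nonneg_iff.1 (key 1)).2
  have h2 := (Complex.nonneg_iff.1 (key Complex.I)).2
  simp at h1 h2
  apply Complex.ext
  · simp; linarith
  · simp; linarith

/-- Positivity at x - τ(x) 1 gives |τ(x)|² ≤ τ(x* x), and ‖x‖² - x* x is itself of the form b* b. -/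
lemma IsState.norm_le (hτ : IsState τ) (x : A) : ‖τ x‖ ≤ ‖x‖ := by
  let _ : PartialOrder A := CStarAlgebra.spectralOrder A
  have : StarOrderedRing A := CStarAlgebra.spectralOrderedRing A
  have h1 : ∃ b : A, algebraMap ℝ A (‖x‖ ^ 2) - star x * x = star b * b :=
    CStarAlgebra.nonneg_iff_eq_star_mul_self.1
      (sub_nonneg.2 CStarAlgebra.star_mul_le_algebraMap_norm_sq)
  obtain ⟨b, hb⟩ := h1
  have h2 : (τ (star x * x)).re ≤ ‖x‖ ^ 2 := by
    have h3 := (Complex.nonneg_iff.1 (hτ.nonneg b)).1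
    rw [← hb, map_sub, IsScalarTower.algebraMap_apply ℝ ℂ A, Algebra.algebraMap_eq_smul_one,
      map_smul, hτ.map_one, Complex.sub_re] at h3
    simp only [Complex.coe_algebraMap, smul_eq_mul, mul_one, Complex.ofReal_re] at h3
    linarith
  have h4 : ‖τ x‖ ^ 2 ≤ (τ (star x * x)).re := by
    have := (Complex.nonneg_iff.1 (hτ.nonneg (x - τ x • 1))).1
    simp only [star_sub, star_smul, star_one, sub_mul, mul_sub, mul_smul_comm, mul_one, smul_mul_assoc,
      one_mul, map_sub, map_smul, hτ.map_one, hτ.map_star, smul_eq_mul, Complex.star_def] at this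
    rw [Complex.sq_norm, Complex.normSq_apply]
    simp at this
    nlinarith
  exact le_of_sq_le_sq (h4.trans h2) (norm_nonneg x)

end State

/-! ### Positivity and norm bounds for slices by a state. -/

section StateSlice

variable {ι : Type*} [Fintype ι] {A : Type*} [CStarAlgebra A] {τ : A →ₗ[ℂ] ℂ}

lemma dotProduct_sliceMap (X : Matrix ι ι A) (u : ι → ℂ) :
    star u ⬝ᵥ sliceMap τ X *ᵥ u = τ (∑ i, ∑ j, (star (u i) * u j) • X i j) := by
  simp only [dotProduct, Matrix.mulVec, sliceMap_apply, map_sum, map_smul, smul_eq_mul,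
    Finset.mul_sum, Pi.star_apply]
  exact Finset.sum_congr rfl fun i _ => Finset.sum_congr rfl fun j _ => by ring

/-- The quadratic form equals ∑ₖ τ(bₖ* bₖ) with bₖ = ∑ⱼ uⱼ W k j; this is the complete positivity of
a state. -/
lemma IsState.dotProduct_sliceMap_nonneg (hτ : IsState τ) (W : Matrix ι ι A) (u : ι → ℂ) :
    0 ≤ star u ⬝ᵥ sliceMap τ (Wᴴ * W) *ᵥ u := by
  have e : ∑ i, ∑ j, (star (u i) * u j) • (Wᴴ * W) i j
      = ∑ k, star (∑ j, u j • W k j) * ∑ j, u j • W k j := by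
    simp only [Matrix.mul_apply, Matrix.conjTranspose_apply, star_sum, star_smul, Finset.sum_mul,
      Finset.mul_sum, Finset.smul_sum, smul_mul_smul_comm]
    rw [Finset.sum_comm]
    refine (Finset.sum_congr rfl fun j _ => Finset.sum_comm).trans (Finset.sum_comm.trans ?_)
    refine Finset.sum_congr rfl fun k _ => ?_
    rw [Finset.sum_comm]
  rw [dotProduct_sliceMap, e, map_sum]
  exact Finset.sum_nonneg fun k _ => hτ.nonneg _

variable [DecidableEq ι]

lemma IsState.norm_sliceMap_le (hτ : IsState τ) {X : Matrix ι ι A} {c : ℝ}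
    (h : ∀ i j, ‖X i j‖ ≤ c) : ‖sliceMap τ X‖ ≤ (Fintype.card ι : ℝ) ^ 2 * c :=
  norm_le_of_entries_le fun i j => (hτ.norm_le _).trans (h i j)

lemma norm_mul_amp_mul_entry_le {X Y : Matrix ι ι A} {c : Matrix ι ι ℂ} {s t : ℝ}
    (hX : ∀ i j, ‖X i j‖ ≤ s) (hY : ∀ i j, ‖Y i j‖ ≤ t) (i j : ι) :
    ‖(X * amp c 1 * Y : Matrix ι ι A) i j‖ ≤ (Fintype.card ι : ℝ) ^ 2 * (s * ‖c‖ * t) := by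
  have e : (X * amp c 1 * Y : Matrix ι ι A) i j = ∑ p, ∑ q, c p q • (X i p * Y q j) := by
    rw [mul_assoc, Matrix.mul_apply]
    simp [amp_mul_apply, Finset.mul_sum]
  have h : ∀ p q, ‖c p q • (X i p * Y q j)‖ ≤ s * ‖c‖ * t := fun p q => by
    have hs := (norm_nonneg _).trans (hX i p)
    have ht := (norm_nonneg _).trans (hY q j)
    rw [norm_smul]
    calc ‖c p q‖ * ‖X i p * Y q j‖ ≤ ‖c‖ * (s * t) :=
          mul_le_mul (norm_entry_le c p q) ((norm_mul_le _ _).trans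
            (mul_le_mul (hX i p) (hY q j) (norm_nonneg _) hs)) (norm_nonneg _) (norm_nonneg _)
      _ = _ := by ring
  rw [e]
  refine (norm_sum_le _ _).trans ((Finset.sum_le_sum fun p _ => (norm_sum_le _ _).trans
    (Finset.sum_le_sum fun q _ => h p q)).trans (le_of_eq ?_))
  simp; ring

lemma IsState.norm_sliceMap_mul_amp_mul_le (hτ : IsState τ) {X Y : Matrix ι ι A} {c : Matrix ι ι ℂ}
    {s t : ℝ} (hX : ∀ i j, ‖X i j‖ ≤ s) (hY : ∀ i j, ‖Y i j‖ ≤ t) :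
    ‖sliceMap τ (X * amp c 1 * Y)‖ ≤ (Fintype.card ι : ℝ) ^ 4 * (s * ‖c‖ * t) :=
  (hτ.norm_sliceMap_le (norm_mul_amp_mul_entry_le hX hY)).trans (le_of_eq (by ring))

/-- The slice of the resolvent at a matrix with positive imaginary part has non-positive imaginary
part. -/
lemma IsState.imForm_sliceMap_nonpos (hτ : IsState τ) {δ : ℝ} (hδ : 0 < δ) {z : Matrix ι ι ℂ}
    (hz : ImGE δ z) {s X : Matrix ι ι A} (hs : sᴴ = s) (hX : (amp z 1 - s) * X = 1) (u : ι → ℂ) :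
    imForm (sliceMap τ X) u ≤ 0 := by
  obtain ⟨q, hq⟩ := exists_conjTranspose_mul_self hz
  set Z := amp z 1 - s
  have hX' : Xᴴ * Zᴴ = 1 := by
    rw [← Matrix.conjTranspose_mul, hX, Matrix.conjTranspose_one]
  have hZ : Z - Zᴴ = (2 * Complex.I) • ((amp q 1)ᴴ * amp q 1 + (δ : ℂ) • (1 : Matrix ι ι A)) := by
    have e : (amp q (1 : A))ᴴ * amp q 1 + (δ : ℂ) • (1 : Matrix ι ι A)
        = amp (qᴴ * q + (δ : ℂ) • 1) 1 := by
      rw [amp_add, amp_conjTranspose, amp_mul_amp, star_one, mul_one, amp_smul, amp_one]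
    rw [e, ← amp_smul, ← hq, Matrix.conjTranspose_sub, hs, amp_conjTranspose, star_one, amp_sub]
    simp only [Z]
    abel
  -- X* - X = X* (Z - Z*) X, and the middle factor is 2i times a sum of squares. Slicing this
  -- identity gives the sign of the imaginary part.
  have hXX : Xᴴ - X = (2 * Complex.I) • ((amp q 1 * X)ᴴ * (amp q 1 * X) + (δ : ℂ) • (Xᴴ * X)) := by
    have : Xᴴ - X = Xᴴ * (Z - Zᴴ) * X := by
      rw [mul_sub, sub_mul, mul_assoc, hX, mul_one, hX', one_mul]
    rw [this, hZ, Matrix.conjTranspose_mul]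
    simp only [Matrix.mul_smul, Matrix.smul_mul, mul_add, add_mul, mul_one, mul_assoc]
  have hG : (sliceMap τ X)ᴴ - sliceMap τ X = (2 * Complex.I) •
      (sliceMap τ ((amp q 1 * X)ᴴ * (amp q 1 * X)) + (δ : ℂ) • sliceMap τ (Xᴴ * X)) := by
    have e1 : (sliceMap τ X)ᴴ = sliceMap τ Xᴴ := by
      ext i j; simp [sliceMap_apply, Matrix.conjTranspose_apply, hτ.map_star]
    rw [e1, ← sliceMap_sub, hXX, sliceMap_smul, sliceMap_add, sliceMap_smul]
  have h1 := imForm_sub (sliceMap τ X)ᴴ (sliceMap τ X) u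
  rw [imForm_conjTranspose, hG] at h1
  have p1 := (Complex.nonneg_iff.1 (hτ.dotProduct_sliceMap_nonneg (amp q 1 * X) u)).1
  have p2 := (Complex.nonneg_iff.1 (hτ.dotProduct_sliceMap_nonneg X u)).1
  have h2 : imForm ((2 * Complex.I) •
      (sliceMap τ ((amp q 1 * X)ᴴ * (amp q 1 * X)) + (δ : ℂ) • sliceMap τ (Xᴴ * X))) u
      = 2 * ((star u ⬝ᵥ sliceMap τ ((amp q 1 * X)ᴴ * (amp q 1 * X)) *ᵥ u).re
        + δ * (star u ⬝ᵥ sliceMap τ (Xᴴ * X) *ᵥ u).re) := by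
    simp [imForm, Matrix.smul_mulVec, Matrix.add_mulVec, dotProduct_add, dotProduct_smul, mul_add]
  rw [h2] at h1
  have := mul_nonneg hδ.le p2
  linarith

end StateSlice

/-! ### Linear pencils and their resolvents -/

section Pencil

variable {ι : Type*} {r : ℕ} {A : Type*}

/-- The linear pencil `a₀ ⊗ 1 + ∑ j, (a_j ⊗ y_j + a_j^* ⊗ y_j^*)`. -/
def linPencil [Ring A] [Algebra ℂ A] [Star A] (a₀ : Matrix ι ι ℂ) (a : Fin r → Matrix ι ι ℂ)
    (y : Fin r → A) : Matrix ι ι A :=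
  amp a₀ 1 + ∑ j, (amp (a j) (y j) + amp (a j)ᴴ (star (y j)))

lemma linPencil_conjTranspose [Ring A] [Algebra ℂ A] [StarRing A] [StarModule ℂ A]
    {a₀ : Matrix ι ι ℂ} (h : a₀ᴴ = a₀) (a : Fin r → Matrix ι ι ℂ) (y : Fin r → A) :
    (linPencil a₀ a y)ᴴ = linPencil a₀ a y := by
  rw [linPencil, Matrix.conjTranspose_add, amp_conjTranspose, h, star_one,
    Matrix.conjTranspose_sum]
  congr 1
  refine Finset.sum_congr rfl fun j _ => ?_
  rw [Matrix.conjTranspose_add, amp_conjTranspose, amp_conjTranspose, star_star,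
    Matrix.conjTranspose_conjTranspose, add_comm]

variable [Fintype ι] [DecidableEq ι]

/-- The resolvent `(z ⊗ 1 - X)⁻¹`. -/
def res [Ring A] [Algebra ℂ A] (z : Matrix ι ι ℂ) (X : Matrix ι ι A) : Matrix ι ι A :=
  Ring.inverse (amp z 1 - X)

variable [CStarAlgebra A] {δ : ℝ} {z : Matrix ι ι ℂ} {s : Matrix ι ι A}

lemma sub_mul_res (hδ : 0 < δ) (hz : ImGE δ z) (hs : sᴴ = s) : (amp z 1 - s) * res z s = 1 :=
  Ring.mul_inverse_cancel _ (resolvent_bound hδ hz hs).1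

lemma res_mul_sub (hδ : 0 < δ) (hz : ImGE δ z) (hs : sᴴ = s) : res z s * (amp z 1 - s) = 1 :=
  Ring.inverse_mul_cancel _ (resolvent_bound hδ hz hs).1

lemma norm_res_entry_le (hδ : 0 < δ) (hz : ImGE δ z) (hs : sᴴ = s) (i j : ι) :
    ‖res z s i j‖ ≤ δ⁻¹ :=
  (resolvent_bound hδ hz hs).2 _ (sub_mul_res hδ hz hs) i j

/-- The resolvent identity. -/
lemma res_sub_res {ε : ℝ} {w : Matrix ι ι ℂ} (hδ : 0 < δ) (hz : ImGE δ z) (hε : 0 < ε)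
    (hw : ImGE ε w) (hs : sᴴ = s) :
    res z s - res w s = res z s * amp (w - z) 1 * res w s := by
  have e : amp (w - z) 1 = (amp w 1 - s) - (amp z 1 - s) := by rw [amp_sub]; abel
  rw [e, mul_sub, sub_mul, mul_assoc, sub_mul_res hε hw hs, mul_one, res_mul_sub hδ hz hs, one_mul]

end Pencil

/-! ### Chebyshev polynomials of semicircular elements -/

section Chebyshev

open Polynomial

lemma integral_sin_mul_sin {k : ℕ} (hk : k ≠ 0) :
    ∫ θ in (0 : ℝ)..Real.pi, Real.sin ((k + 1) * θ) * Real.sin θ = 0 := by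
  have e : ∀ θ : ℝ, Real.sin ((k + 1) * θ) * Real.sin θ
      = (1 / 2) * Real.cos (k * θ) - (1 / 2) * Real.cos ((k + 2 : ℕ) * θ) := fun θ => by
    have h1 : (k : ℝ) * θ = (k + 1) * θ - θ := by ring
    have h2 : ((k + 2 : ℕ) : ℝ) * θ = (k + 1) * θ + θ := by push_cast; ring
    rw [h1, h2, Real.cos_sub, Real.cos_add]; ring
  have h : ∀ n : ℕ, n ≠ 0 → ∫ θ in (0 : ℝ)..Real.pi, Real.cos (n * θ) = 0 := fun n hn => by
    rw [intervalIntegral.integral_comp_mul_left _ (Nat.cast_ne_zero.2 hn), integral_cos]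
    simp [Real.sin_nat_mul_pi]
  simp_rw [e]
  rw [intervalIntegral.integral_sub, intervalIntegral.integral_const_mul,
    intervalIntegral.integral_const_mul, h k hk, h (k + 2) (by omega)]
  · simp
  · exact (by fun_prop : Continuous _).intervalIntegrable _ _
  · exact (by fun_prop : Continuous _).intervalIntegrable _ _

/-- Under t = 2 cos θ the weight becomes 4 sin² θ dθ and S_k(2 cos θ) sin θ = sin((k+1) θ), so this
is the orthogonality of sin((k+1) θ) and sin θ. Hence the S_k with k ≥ 1 are centred and may be used
as letters in the freeness condition. -/
lemma integral_chebyshevS {k : ℕ} (hk : k ≠ 0) :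
    ∫ t in (-2 : ℝ)..2, (Chebyshev.S ℝ k).eval t * Real.sqrt (4 - t ^ 2) = 0 := by
  have hsub := intervalIntegral.integral_comp_mul_deriv (a := Real.pi) (b := 0)
    (f := fun θ => 2 * Real.cos θ) (f' := fun θ => 2 * (- Real.sin θ))
    (g := fun t => (Chebyshev.S ℝ k).eval t * Real.sqrt (4 - t ^ 2))
    (fun θ _ => (Real.hasDerivAt_cos θ).const_mul 2) (by fun_prop) (by fun_prop)
  simp only [Real.cos_pi, Real.cos_zero, mul_neg, mul_one] at hsub
  rw [← hsub, intervalIntegral.integral_symm, neg_eq_zero]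
  have e : ∀ θ ∈ Set.uIcc 0 Real.pi,
      -(((fun t => (Chebyshev.S ℝ k).eval t * Real.sqrt (4 - t ^ 2)) ∘ fun θ => 2 * Real.cos θ) θ
        * (2 * Real.sin θ)) = (-4) * (Real.sin ((k + 1) * θ) * Real.sin θ) := fun θ hθ => by
    rw [Set.uIcc_of_le Real.pi_pos.le] at hθ
    have hs : 0 ≤ Real.sin θ := Real.sin_nonneg_of_mem_Icc hθ
    have h1 : Real.sqrt (4 - (2 * Real.cos θ) ^ 2) = 2 * Real.sin θ := by
      have : 4 - (2 * Real.cos θ) ^ 2 = (2 * Real.sin θ) ^ 2 := by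
        have := Real.sin_sq_add_cos_sq θ; nlinarith
      rw [this, Real.sqrt_sq (by positivity)]
    have h2 := Chebyshev.U_real_cos (θ := θ) (k : ℤ)
    rw [← Chebyshev.S_comp_two_mul_X] at h2
    simp only [eval_comp, eval_mul, eval_X, eval_ofNat, Int.cast_natCast] at h2
    simp only [Function.comp_apply, h1]
    rw [← h2]; ring
  rw [intervalIntegral.integral_congr e, intervalIntegral.integral_const_mul,
    integral_sin_mul_sin hk, mul_zero]

variable {A : Type*} [CStarAlgebra A] {τ : A →ₗ[ℂ] ℂ}

lemma IsSemicircular.map_aeval {x : A} (hx : IsSemicircular τ x) (p : ℝ[X]) :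
    τ (aeval x p)
      = (((2 * Real.pi)⁻¹ * ∫ t in (-2 : ℝ)..2, p.eval t * Real.sqrt (4 - t ^ 2) : ℝ) : ℂ) := by
  induction p using Polynomial.induction_on' with
  | add p q hp hq =>
    rw [map_add, map_add, hp, hq, ← Complex.ofReal_add, ← mul_add,
      ← intervalIntegral.integral_add]
    · simp only [eval_add, add_mul]
    · exact (by fun_prop : Continuous _).intervalIntegrable _ _
    · exact (by fun_prop : Continuous _).intervalIntegrable _ _
  | monomial n c =>
    have e : aeval x (monomial n c) = (c : ℂ) • x ^ n := by
      rw [aeval_monomial, ← Algebra.smul_def, Complex.coe_smul]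
    rw [e, map_smul, hx.moment, smul_eq_mul, ← Complex.ofReal_mul]
    simp only [eval_monomial, mul_assoc]
    rw [intervalIntegral.integral_const_mul]
    congr 1; ring

/-- The rescaled Chebyshev polynomial of the second kind of degree `k`, evaluated at `x`. -/
def cheb (x : A) (k : ℕ) : A := aeval x (Chebyshev.S ℝ k)

lemma cheb_zero (x : A) : cheb x 0 = 1 := by simp [cheb]

lemma cheb_one (x : A) : cheb x 1 = x := by simp [cheb]

lemma mul_cheb_succ (x : A) (k : ℕ) : x * cheb x (k + 1) = cheb x (k + 2) + cheb x k := by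
  have h := Chebyshev.S_add_two ℝ (k : ℤ)
  have : aeval x (Chebyshev.S ℝ (k + 2)) + aeval x (Chebyshev.S ℝ k)
      = x * aeval x (Chebyshev.S ℝ (k + 1)) := by
    rw [h, map_sub, map_mul, aeval_X, sub_add_cancel]
  simpa [cheb] using this.symm

lemma IsSemicircular.map_cheb {x : A} (hx : IsSemicircular τ x) {k : ℕ} (hk : k ≠ 0) :
    τ (cheb x k) = 0 := by
  rw [cheb, hx.map_aeval, integral_chebyshevS hk]; simp

lemma cheb_mem (x : A) (k : ℕ) : cheb x k ∈ Algebra.adjoin ℂ {x} := by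
  have hx : x ∈ Algebra.adjoin ℂ {x} := Algebra.self_mem_adjoin_singleton ℂ x
  induction k using Nat.twoStepInduction with
  | zero => rw [cheb_zero]; exact one_mem _
  | one => rw [cheb_one]; exact hx
  | more k h1 h2 =>
    rw [← add_sub_cancel_right (cheb x (k + 2)) (cheb x k), ← mul_cheb_succ]
    exact sub_mem (mul_mem hx h2) h1

end Chebyshev

/-! ### The Schwinger–Dyson equation of a semicircular system -/

section SchwingerDyson

variable {I : Type*} {A : Type*} [CStarAlgebra A] {τ : A →ₗ[ℂ] ℂ} {x : I → A}

/-- The product of the Chebyshev polynomials listed in a word; the letter `(i, a)` stands for the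
polynomial of degree `a + 1` in `x i`. -/
def chebWord (x : I → A) (w : List (I × ℕ)) : A := (w.map fun p => cheb (x p.1) (p.2 + 1)).prod

lemma chebWord_nil (x : I → A) : chebWord x [] = 1 := rfl

lemma chebWord_cons (x : I → A) (p : I × ℕ) (w : List (I × ℕ)) :
    chebWord x (p :: w) = cheb (x p.1) (p.2 + 1) * chebWord x w := by simp [chebWord]

lemma chebWord_concat (x : I → A) (p : I × ℕ) (w : List (I × ℕ)) :
    chebWord x (w ++ [p]) = chebWord x w * cheb (x p.1) (p.2 + 1) := by simp [chebWord]

/-- A word is alternating if neighbouring letters belong to different variables. -/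
def Alternating (w : List (I × ℕ)) : Prop := (w.map Prod.fst).IsChain (· ≠ ·)

variable [DecidableEq I]

/-- The slice by `τ` on the right-hand factor of the `i`-th free difference quotient of
`chebWord`. -/
def chebWordDiff (x : I → A) : List (I × ℕ) → I → A
  | [], _ => 0
  | [p], i => if i = p.1 then cheb (x p.1) p.2 else 0
  | p :: q :: w, i => cheb (x p.1) (p.2 + 1) * chebWordDiff x (q :: w) i

/-- The operator of left multiplication by `x k` on pairs of an element and its sliced free
difference quotients. -/
def leftMulPair (τ : A →ₗ[ℂ] ℂ) (x : I → A) (k : I) : A × (I → A) →ₗ[ℂ] A × (I → A) where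
  toFun p := (x k * p.1, fun i => x k * p.2 i + if i = k then τ p.1 • (1 : A) else 0)
  map_add' p q := by
    ext i
    · simp [mul_add]
    · by_cases h : i = k <;> simp [h, mul_add, add_smul]; abel
  map_smul' c p := by
    ext i
    · simp
    · by_cases h : i = k <;> simp [h, smul_smul]

/-- The span of the pairs of an alternating Chebyshev word and its sliced difference quotients. -/
def chebSpan (x : I → A) : Submodule ℂ (A × (I → A)) :=
  Submodule.span ℂ {p | ∃ w, Alternating w ∧ p = (chebWord x w, chebWordDiff x w)}

lemma mem_chebSpan {w : List (I × ℕ)} (hw : Alternating w) :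
    (chebWord x w, chebWordDiff x w) ∈ chebSpan x := Submodule.subset_span ⟨w, hw, rfl⟩

omit [DecidableEq I] in
lemma IsSemicircularSystem.map_chebWord (hx : IsSemicircularSystem τ x) {w : List (I × ℕ)}
    (hw : Alternating w) (hne : w ≠ []) : τ (chebWord x w) = 0 := by
  have := hx.free (w.map fun p => (p.1, cheb (x p.1) (p.2 + 1))) (by simpa using hne)
    (by rw [List.map_map]; exact hw) (by
      intro p hp
      obtain ⟨q, -, rfl⟩ := List.mem_map.1 hp
      exact ⟨cheb_mem _ _, (hx.semicircular _).map_cheb (Nat.succ_ne_zero _)⟩)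
  rw [List.map_map] at this
  exact this

lemma IsSemicircularSystem.leftMulPair_mem (hτ : IsState τ) (hx : IsSemicircularSystem τ x) (k : I)
    {p : A × (I → A)} (hp : p ∈ chebSpan x) : leftMulPair τ x k p ∈ chebSpan x := by
  induction hp using Submodule.span_induction with
  | zero => simp
  | add p q _ _ h1 h2 => rw [map_add]; exact add_mem h1 h2
  | smul c p _ h => rw [map_smul]; exact Submodule.smul_mem _ _ h
  | mem p hp =>
    obtain ⟨w, hw, rfl⟩ := hp
    match w, hw with
    | [], _ =>
      have e : leftMulPair τ x k (chebWord x [], chebWordDiff x [])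
          = (chebWord x [(k, 0)], chebWordDiff x [(k, 0)]) := by
        ext i
        · simp [leftMulPair, chebWord, cheb_one]
        · simp [leftMulPair, chebWord, chebWordDiff, cheb_zero, hτ.map_one]
      rw [e]; exact mem_chebSpan (List.isChain_singleton _)
    | (l, a) :: w, hw =>
      by_cases hk : k = l
      · subst hk
        have h2 : Alternating ((k, a + 1) :: w) := hw
        -- The recurrence x S_{a+1} = S_{a+2} + S_a splits the product into two words. The
        -- difference quotient sees the changed letter only if it is also the last one, that is, if
        -- w = [].
        have e : leftMulPair τ x k (chebWord x ((k, a) :: w), chebWordDiff x ((k, a) :: w))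
            = (chebWord x ((k, a + 1) :: w), chebWordDiff x ((k, a + 1) :: w))
              + (cheb (x k) a * chebWord x w,
                fun i => if w = [] then (if i = k ∧ a ≠ 0 then cheb (x k) (a - 1) else 0)
                  else cheb (x k) a * chebWordDiff x w i) := by
          have h0 := hx.map_chebWord hw (List.cons_ne_nil _ _)
          ext i
          · simp [leftMulPair, chebWord_cons, ← mul_assoc, mul_cheb_succ, add_mul]
          · match w with
            | [] =>
              by_cases hi : i = k
              · cases a with
                | zero => simp [leftMulPair, chebWordDiff, hi, h0, cheb_one, cheb_zero]
                | succ a => simp [leftMulPair, chebWordDiff, hi, h0, mul_cheb_succ]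
              · simp [leftMulPair, chebWordDiff, hi]
            | q :: w =>
              simp [leftMulPair, chebWordDiff, h0, ← mul_assoc, mul_cheb_succ, add_mul]
        rw [e]
        refine add_mem (mem_chebSpan h2) ?_
        cases a with
        -- The first letter has degree one, so in the second word it disappears altogether.
        | zero =>
          have hw' : Alternating w := by
            have := hw.tail; simpa [Alternating] using this
          convert mem_chebSpan (x := x) hw' using 2
          · simp [cheb_zero]
          · ext i
            cases w <;> simp [cheb_zero, chebWordDiff]
        | succ a =>
          have hw' : Alternating ((k, a) :: w) := hw
          convert mem_chebSpan (x := x) hw' using 2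
          · simp [chebWord_cons]
          · ext i
            cases w <;> simp [chebWordDiff]
      · have hw' : Alternating ((k, 0) :: (l, a) :: w) := by
          simp only [Alternating, List.map_cons] at hw ⊢
          exact List.isChain_cons_cons.2 ⟨hk, hw⟩
        have e : leftMulPair τ x k (chebWord x ((l, a) :: w), chebWordDiff x ((l, a) :: w))
            = (chebWord x ((k, 0) :: (l, a) :: w), chebWordDiff x ((k, 0) :: (l, a) :: w)) := by
          have h0 := hx.map_chebWord hw (List.cons_ne_nil _ _)
          ext i
          · simp [leftMulPair, chebWord_cons, cheb_one]
          · simp [leftMulPair, chebWordDiff, cheb_one, h0]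
        rw [e]; exact mem_chebSpan hw'

/-- Only the last letter changes: its degree drops by one, or it disappears. As the word has at
least two letters, what remains is a nonempty alternating word. The prefix u collects the letters
that the recursion has already passed. -/
lemma IsSemicircularSystem.map_chebWord_mul_diff (hx : IsSemicircularSystem τ x) (i : I)
    (w : List (I × ℕ)) : ∀ u : List (I × ℕ), Alternating (u ++ w) → 2 ≤ (u ++ w).length →
      τ (chebWord x u * chebWordDiff x w i) = 0 := by
  induction w with
  | nil => intro u _ _; simp [chebWordDiff]
  | cons p w ih =>
    intro u hu hl
    match w with
    | [] =>
      by_cases hi : i = p.1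
      · have hne : u ≠ [] := by rintro rfl; simp at hl
        simp only [chebWordDiff, hi, if_true]
        cases hp : p.2 with
        | zero =>
          rw [cheb_zero, mul_one]
          refine hx.map_chebWord ?_ hne
          simp only [Alternating, List.map_append] at hu ⊢
          exact hu.left_of_append
        | succ a =>
          have := chebWord_concat x (p.1, a) u
          simp only at this
          rw [← this]
          refine hx.map_chebWord ?_ (by simp)
          simpa [Alternating] using hu
      · simp [chebWordDiff, hi]
    | q :: w =>
      simp only [chebWordDiff]
      rw [← mul_assoc, ← chebWord_concat]
      exact ih (u ++ [p]) (by simpa using hu) (by simp; omega)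

/-- The Schwinger–Dyson equation of a semicircular system. -/
theorem IsSemicircularSystem.schwingerDyson (hx : IsSemicircularSystem τ x)
    (i : I) {p : A × (I → A)} (hp : p ∈ chebSpan x) : τ (x i * p.1) = τ (p.2 i) := by
  induction hp using Submodule.span_induction with
  | zero => simp
  | add p q _ _ h1 h2 => simp [mul_add, h1, h2]
  | smul c p _ h => simp [h]
  | mem p hp =>
    obtain ⟨w, hw, rfl⟩ := hp
    match w, hw with
    | [], _ =>
      have := (hx.semicircular i).map_cheb one_ne_zero
      rw [cheb_one] at this
      simp [chebWord, chebWordDiff, this]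
    | [(k, a)], hw =>
      by_cases hi : i = k
      · subst hi
        have := (hx.semicircular i).map_cheb (k := a + 2) (by omega)
        simp [chebWord, chebWordDiff, mul_cheb_succ, this]
      · have hw' : Alternating [(i, 0), (k, a)] := by
          simpa [Alternating] using hi
        have := hx.map_chebWord hw' (by simp)
        simp only [chebWord_cons, chebWord_nil, zero_add, cheb_one] at this
        simp [chebWord, chebWordDiff, hi]
        simpa using this
    | (k, a) :: q :: w, hw =>
      have h1 := hx.map_chebWord_mul_diff i _ [] hw (by simp)
      rw [chebWord_nil, one_mul] at h1
      simp only [h1]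
      by_cases hi : i = k
      · subst hi
        have h2 : Alternating ((i, a + 1) :: q :: w) := hw
        have h3 := hx.map_chebWord h2 (by simp)
        rw [chebWord_cons] at h3
        rw [chebWord_cons, ← mul_assoc, mul_cheb_succ, add_mul, map_add, h3, zero_add]
        cases a with
        | zero =>
          rw [cheb_zero, one_mul]
          refine hx.map_chebWord ?_ (by simp)
          have := hw.tail; simpa [Alternating] using this
        | succ a =>
          have h2 : Alternating ((i, a) :: q :: w) := hw
          have := hx.map_chebWord h2 (by simp)
          rwa [chebWord_cons] at this
      · have hw' : Alternating ((i, 0) :: (k, a) :: q :: w) := by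
          simp only [Alternating, List.map_cons] at hw ⊢
          exact List.isChain_cons_cons.2 ⟨hi, hw⟩
        have := hx.map_chebWord hw' (by simp)
        rwa [chebWord_cons, zero_add, cheb_one] at this

end SchwingerDyson

/-! ### The Dyson equation of the limit -/

section Moments

variable {I ι : Type*} [Fintype I] [DecidableEq I] [Fintype ι] [DecidableEq ι]
  {A : Type*} [CStarAlgebra A] {τ : A →ₗ[ℂ] ℂ} {x : I → A}

/-- The sliced free difference quotients of the powers of a matrix `s` which is affine in `x` with
coefficients `b`. -/
def powDiff (τ : A →ₗ[ℂ] ℂ) (b : I → Matrix ι ι ℂ) (s : Matrix ι ι A) : ℕ → I → Matrix ι ι A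
  | 0, _ => 0
  | k + 1, i => s * powDiff τ b s k i + amp (b i * sliceMap τ (s ^ k)) 1

omit [Fintype I] [DecidableEq I] in
lemma powDiff_succ_eq_sum (b : I → Matrix ι ι ℂ) (s : Matrix ι ι A) (k : ℕ) (i : I) :
    powDiff τ b s (k + 1) i = ∑ p ∈ Finset.HasAntidiagonal.antidiagonal k,
      s ^ p.1 * amp (b i * sliceMap τ (s ^ p.2)) 1 := by
  induction k with
  | zero => simp [powDiff]
  | succ k ih =>
    rw [powDiff, ih, Finset.Nat.sum_antidiagonal_succ, Finset.mul_sum, add_comm]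
    simp only [pow_zero, one_mul, pow_succ', mul_assoc]

variable {b : I → Matrix ι ι ℂ} {c : Matrix ι ι ℂ} {s : Matrix ι ι A}

/-- Left multiplication by s acts on entries as a combination of c and of the operators
`leftMulPair`, and the recursion defining `powDiff` is the matching Leibniz rule. Hence the
Schwinger–Dyson equation applies to every entry of a power of s. -/
lemma IsSemicircularSystem.pow_mem_chebSpan (hτ : IsState τ) (hx : IsSemicircularSystem τ x)
    (hs : s = amp c 1 + ∑ i, amp (b i) (x i)) (k : ℕ) (p q : ι) :
    ((s ^ k) p q, fun i => powDiff τ b s k i p q) ∈ chebSpan x := by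
  induction k generalizing p q with
  | zero =>
    have h1 := mem_chebSpan (x := x) (w := []) List.isChain_nil
    by_cases h : p = q
    · subst h
      simpa [powDiff, chebWord, chebWordDiff, Pi.zero_def] using! h1
    · simpa [powDiff, h, Pi.zero_def] using! zero_mem _
  | succ k ih =>
    have e : ((s ^ (k + 1)) p q, fun i => powDiff τ b s (k + 1) i p q)
        = ∑ u, (c p u • ((s ^ k) u q, fun i => powDiff τ b s k i u q) + ∑ j, b j p u •
          leftMulPair τ x j ((s ^ k) u q, fun i => powDiff τ b s k i u q)) := by
      have hmul : ∀ W : Matrix ι ι A, (s * W) p q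
          = ∑ u, (c p u • W u q + ∑ j, b j p u • (x j * W u q)) := fun W => by
        rw [hs, add_mul, Matrix.add_apply, amp_mul_apply, Finset.sum_mul, Matrix.sum_apply]
        simp only [amp_mul_apply, one_mul, Finset.sum_add_distrib]
        rw [Finset.sum_comm]
      refine Prod.ext ?_ (funext fun i => ?_)
      · simp only [pow_succ', hmul, Prod.fst_sum, Prod.fst_add, Prod.smul_fst, leftMulPair,
          LinearMap.coe_mk, AddHom.coe_mk]
      · simp only [powDiff, Matrix.add_apply, hmul, Prod.snd_sum, Prod.snd_add, Prod.smul_snd,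
          leftMulPair, LinearMap.coe_mk, AddHom.coe_mk, Finset.sum_apply, Pi.add_apply,
          Pi.smul_apply, smul_add, Finset.sum_add_distrib, add_assoc, smul_ite, smul_zero,
          Finset.sum_ite_eq, Finset.mem_univ, if_true]
        congr 2
        simp [amp_apply, Matrix.mul_apply, Finset.sum_smul, smul_smul, sliceMap_apply]
    rw [e]
    exact Submodule.sum_mem _ fun u _ => add_mem (Submodule.smul_mem _ _ (ih u q))
      (Submodule.sum_mem _ fun j _ => Submodule.smul_mem _ _ (hx.leftMulPair_mem hτ j (ih u q)))

lemma IsSemicircularSystem.sliceMap_pow_succ (hτ : IsState τ) (hx : IsSemicircularSystem τ x)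
    (hs : s = amp c 1 + ∑ i, amp (b i) (x i)) (k : ℕ) :
    sliceMap τ (s ^ (k + 1)) = c * sliceMap τ (s ^ k)
      + ∑ i, b i * sliceMap τ (powDiff τ b s k i) := by
  have h : ∀ i, sliceMap τ (amp (b i) (x i) * s ^ k) = b i * sliceMap τ (powDiff τ b s k i) := by
    intro i
    ext p q
    rw [sliceMap_apply, amp_mul_apply, map_sum, Matrix.mul_apply]
    refine Finset.sum_congr rfl fun u _ => ?_
    have := hx.schwingerDyson i (hx.pow_mem_chebSpan hτ hs k u q)
    rw [map_smul, smul_eq_mul, sliceMap_apply]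
    simp only at this
    rw [this]
  have e : s ^ (k + 1) = amp c 1 * s ^ k + ∑ i, amp (b i) (x i) * s ^ k := by
    rw [pow_succ', ← Finset.sum_mul, ← add_mul, ← hs]
  rw [e, sliceMap_add, sliceMap_sum, sliceMap_amp_mul]
  simp only [h]

end Moments

lemma ring_inverse_eq {R : Type*} [Ring R] {a b : R} (h₁ : a * b = 1) (h₂ : b * a = 1) :
    Ring.inverse a = b := Ring.inverse_unit ⟨a, b, h₁, h₂⟩

/-! ### From a moment recursion to the quadratic equation of the Cauchy transform. -/

section Series

variable {I ι : Type*} [Fintype I] [Fintype ι] [DecidableEq ι]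
  {B : Type*} [NormedRing B] [NormedAlgebra ℂ B] [CompleteSpace B] {s : B}
  {L : B →L[ℂ] Matrix ι ι ℂ} {b : I → Matrix ι ι ℂ} {c : Matrix ι ι ℂ}

/-- A recursion for the matrix-valued moments of `s` gives a quadratic equation for the Cauchy
transform near infinity. -/
lemma cauchy_equation_of_norm_lt (h0 : L 1 = 1) (h1 : L s = c)
    (hrec : ∀ k, L (s ^ (k + 2)) = c * L (s ^ (k + 1))
      + ∑ i, b i * ∑ p ∈ Finset.HasAntidiagonal.antidiagonal k, L (s ^ p.1) * b i * L (s ^ p.2))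
    {ζ : ℂ} (hζ : ‖s‖ < ‖ζ‖) :
    (ζ • 1 - c - ∑ i, b i * L (Ring.inverse (ζ • 1 - s)) * b i) * L (Ring.inverse (ζ • 1 - s))
      = 1 := by
  have hζ0 : ζ ≠ 0 := norm_pos_iff.1 ((norm_nonneg s).trans_lt hζ)
  have hv : ‖ζ⁻¹ • s‖ < 1 := by
    rw [norm_smul, norm_inv, inv_mul_lt_one₀ (norm_pos_iff.2 hζ0)]; exact hζ
  have hsum : Summable fun k => ‖(ζ⁻¹ • s) ^ k‖ := by
    -- The zeroth power is split off because ‖1‖ = 1 is not assumed; the bound on powers is used for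
    -- positive exponents only.
    refine (summable_nat_add_iff 1).1 ?_
    refine Summable.of_nonneg_of_le (fun _ => norm_nonneg _)
      (fun k => norm_pow_le' _ (Nat.succ_pos k)) ?_
    exact (summable_nat_add_iff 1).2 (summable_geometric_of_lt_one (norm_nonneg _) hv)
  have hu : ζ • (1 : B) - s = ζ • (1 - ζ⁻¹ • s) := by rw [smul_sub, smul_inv_smul₀ hζ0]
  have hgeom : (1 - ζ⁻¹ • s) * ∑' k, (ζ⁻¹ • s) ^ k = 1 := mul_neg_geom_series _ hv
  have hgeom' : (∑' k, (ζ⁻¹ • s) ^ k) * (1 - ζ⁻¹ • s) = 1 := geom_series_mul_neg _ hv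
  have hinv : Ring.inverse (ζ • 1 - s) = ζ⁻¹ • ∑' k, (ζ⁻¹ • s) ^ k := by
    refine ring_inverse_eq ?_ ?_
    · rw [hu, smul_mul_smul_comm, hgeom, mul_inv_cancel₀ hζ0, one_smul]
    · rw [hu, smul_mul_smul_comm, hgeom', inv_mul_cancel₀ hζ0, one_smul]
  set G := L (Ring.inverse (ζ • 1 - s)) with hG
  set f : ℕ → Matrix ι ι ℂ := fun k => ζ⁻¹ ^ (k + 1) • L (s ^ k) with hf
  have hfe : ∀ k, f k = L (ζ⁻¹ • (ζ⁻¹ • s) ^ k) := fun k => by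
    rw [smul_pow, smul_smul, map_smul, ← pow_succ']
  have hfs : HasSum f G := by
    have := (hsum.of_norm.hasSum.const_smul ζ⁻¹).mapL L
    rw [← hinv] at this
    simpa only [← hfe] using this
  have hfn : Summable fun k => ‖f k‖ := by
    refine Summable.of_nonneg_of_le (fun _ => norm_nonneg _) (fun k => ?_)
      (hsum.mul_left (‖L‖ * ‖ζ⁻¹‖))
    rw [hfe, mul_assoc, ← norm_smul]
    exact L.le_opNorm _
  have hconv : ∀ i, HasSum (fun k => ∑ p ∈ Finset.HasAntidiagonal.antidiagonal k, f p.1 * (b i * f p.2))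
      (G * (b i * G)) := fun i => by
    have h2 : HasSum (fun k => b i * f k) (b i * G) := hfs.mul_left _
    have h2n : Summable fun k => ‖b i * f k‖ :=
      Summable.of_nonneg_of_le (fun _ => norm_nonneg _) (fun k => norm_mul_le _ _)
        (hfn.mul_left ‖b i‖)
    have h3 := tsum_mul_tsum_eq_tsum_sum_antidiagonal_of_summable_norm hfn h2n
    have h4 := summable_norm_sum_mul_antidiagonal_of_summable_norm hfn h2n
    rw [hfs.tsum_eq, h2.tsum_eq] at h3
    rw [h3]
    exact h4.of_norm.hasSum
  have hshift : HasSum (fun k => ζ • f (k + 2)) (ζ • (G - (f 0 + f 1))) := by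
    have := (hasSum_nat_add_iff' 2).2 hfs
    simp only [Finset.sum_range_succ, Finset.sum_range_zero, zero_add] at this
    exact this.const_smul ζ
  have hshift1 : HasSum (fun k => c * f (k + 1)) (c * (G - f 0)) := by
    have := (hasSum_nat_add_iff' 1).2 hfs
    simp only [Finset.sum_range_succ, Finset.sum_range_zero, zero_add] at this
    exact this.mul_left c
  -- This is the recursion divided by ζ^(k+2). Its quadratic part is the k-th term of a Cauchy
  -- product, so summing over k gives the quadratic equation.
  have hterm : ∀ k, ζ • f (k + 2) = c * f (k + 1)
      + ∑ i, b i * ∑ p ∈ Finset.HasAntidiagonal.antidiagonal k, f p.1 * (b i * f p.2) := fun k => by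
    simp only [hf]
    rw [hrec, smul_add, smul_add, Matrix.mul_smul, smul_smul, smul_smul, pow_succ' ζ⁻¹ (k + 2),
      mul_inv_cancel_left₀ hζ0, Finset.smul_sum]
    congr 1
    refine Finset.sum_congr rfl fun i _ => ?_
    rw [← Matrix.mul_smul, Finset.smul_sum]
    congr 1
    refine Finset.sum_congr rfl fun p hp => ?_
    rw [Matrix.mul_smul, smul_mul_smul_comm, ← pow_add, ← Finset.HasAntidiagonal.mem_antidiagonal.1 hp, mul_assoc]
    congr 2; omega
  have key : ζ • (G - (f 0 + f 1)) = c * (G - f 0) + ∑ i, b i * (G * (b i * G)) := by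
    refine hshift.unique ?_
    simp only [hterm]
    exact hshift1.add (hasSum_sum fun i _ => (hconv i).mul_left (b i))
  have hf0 : ζ • f 0 = 1 := by simp [hf, h0, hζ0]
  have hf1 : ζ • f 1 = c * f 0 := by simp [hf, h0, h1, hζ0, pow_two, smul_smul]
  rw [smul_sub, smul_add, hf0, hf1, mul_sub] at key
  have key2 : ζ • G - c * G - ∑ i, b i * G * b i * G = 1 := by
    simp only [← mul_assoc] at key
    rw [sub_eq_iff_eq_add] at key
    rw [key]; abel
  rw [sub_mul, sub_mul, smul_mul_assoc, one_mul, Finset.sum_mul, key2]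

/-- The quadratic equation for the Cauchy transform extends to a half-plane by analytic
continuation. -/
lemma cauchy_equation_of_isUnit (h0 : L 1 = 1) (h1 : L s = c)
    (hrec : ∀ k, L (s ^ (k + 2)) = c * L (s ^ (k + 1))
      + ∑ i, b i * ∑ p ∈ Finset.HasAntidiagonal.antidiagonal k, L (s ^ p.1) * b i * L (s ^ p.2))
    {ε : ℝ} (hU : ∀ ζ : ℂ, -ε < ζ.im → IsUnit (ζ • 1 - s)) {ζ : ℂ} (hζ : -ε < ζ.im) :
    (ζ • 1 - c - ∑ i, b i * L (Ring.inverse (ζ • 1 - s)) * b i) * L (Ring.inverse (ζ • 1 - s))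
      = 1 := by
  set U : Set ℂ := {ζ | -ε < ζ.im} with hUdef
  have hUo : IsOpen U := isOpen_lt continuous_const Complex.continuous_im
  have hUc : IsPreconnected U := (convex_halfSpace_im_gt (-ε)).isPreconnected
  set G : ℂ → Matrix ι ι ℂ := fun ζ => L (Ring.inverse (ζ • 1 - s))
  set f : ℂ → Matrix ι ι ℂ := fun ζ => (ζ • 1 - c - ∑ i, b i * G ζ * b i) * G ζ - 1
  have hG : DifferentiableOn ℂ G U := fun ζ hζ => by
    refine DifferentiableAt.differentiableWithinAt ?_
    refine L.differentiableAt.comp ζ ?_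
    refine DifferentiableAt.comp ζ (g := Ring.inverse) ?_ (by fun_prop)
    exact differentiableAt_inverse (hU ζ hζ)
  have hf : DifferentiableOn ℂ f U := by
    refine DifferentiableOn.sub_const (DifferentiableOn.mul ?_ hG) 1
    refine DifferentiableOn.sub (by fun_prop) ?_
    exact DifferentiableOn.fun_sum fun i _ => (hG.const_mul (b i)).mul_const (b i)
  have hfa : AnalyticOnNhd ℂ f U := hf.analyticOnNhd hUo
  -- A point of the half-plane with modulus above ‖s‖, near which the power series argument applies.
  set ζ₀ : ℂ := ((‖s‖ + 1 + |ε| : ℝ) : ℂ) * Complex.I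
  have hζ₀ : ζ₀ ∈ U := by
    simp [hUdef, ζ₀]
    nlinarith [neg_abs_le ε, norm_nonneg s, abs_nonneg ε]
  have hn : ‖s‖ < ‖ζ₀‖ := by
    simp only [ζ₀, norm_mul, Complex.norm_I, mul_one, Complex.norm_real, Real.norm_eq_abs]
    exact lt_of_lt_of_le (by linarith [abs_nonneg ε]) (le_abs_self _)
  have hev : f =ᶠ[nhds ζ₀] 0 := by
    filter_upwards [continuous_norm.continuousAt.eventually (lt_mem_nhds hn)] with ζ hζ
    simp only [f, G, Pi.zero_apply]
    rw [cauchy_equation_of_norm_lt h0 h1 hrec hζ, sub_self]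
  have := hfa.eqOn_zero_of_preconnected_of_eventuallyEq_zero hUc hζ₀ hev hζ
  exact sub_eq_zero.1 this

end Series

/-! ### The Dyson equation of a pencil in a circular system. -/

section LimitDyson

variable {ι : Type*} [Fintype ι] [DecidableEq ι] {r : ℕ} {A : Type*} [CStarAlgebra A]
  {τ : A →ₗ[ℂ] ℂ} {a₀ : Matrix ι ι ℂ} {a : Fin r → Matrix ι ι ℂ} {y : Fin r → A}

/-- The Cauchy transform of a linear pencil. -/
def cauchy (τ : A →ₗ[ℂ] ℂ) (a₀ : Matrix ι ι ℂ) (a : Fin r → Matrix ι ι ℂ) (y : Fin r → A)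
    (z : Matrix ι ι ℂ) : Matrix ι ι ℂ := sliceMap τ (res z (linPencil a₀ a y))

/-- The coefficients of a pencil with respect to the real and imaginary parts of its variables. -/
def reimCoeff (a : Fin r → Matrix ι ι ℂ) : Fin r ⊕ Fin r → Matrix ι ι ℂ :=
  Sum.elim (fun j => ((Real.sqrt 2 : ℝ) : ℂ)⁻¹ • (a j + (a j)ᴴ))
    (fun j => (Complex.I * ((Real.sqrt 2 : ℝ) : ℂ)⁻¹) • (a j - (a j)ᴴ))

lemma sqrt_two_inv_mul_self : (((Real.sqrt 2 : ℝ) : ℂ)⁻¹) * (((Real.sqrt 2 : ℝ) : ℂ)⁻¹) = 1 / 2 := by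
  rw [← mul_inv, ← Complex.ofReal_mul, Real.mul_self_sqrt (by norm_num)]; norm_num

/-- The factor i in the second family turns the sum into ½ ((a + a*) g (a + a*) - (a - a*) g (a -
a*)), whose pure terms a g a and a* g a* cancel. -/
lemma sum_reimCoeff (a : Fin r → Matrix ι ι ℂ) (g : Matrix ι ι ℂ) :
    ∑ i, reimCoeff a i * g * reimCoeff a i = covMap a g := by
  rw [Fintype.sum_sum_type, ← Finset.sum_add_distrib, covMap]
  refine Finset.sum_congr rfl fun j _ => ?_
  have hI : (Complex.I * ((Real.sqrt 2 : ℝ) : ℂ)⁻¹) * (Complex.I * ((Real.sqrt 2 : ℝ) : ℂ)⁻¹)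
      = - (1 / 2) := by
    rw [mul_mul_mul_comm, Complex.I_mul_I, sqrt_two_inv_mul_self]; ring
  simp only [reimCoeff, Sum.elim_inl, Sum.elim_inr, Matrix.smul_mul, Matrix.mul_smul, smul_smul,
    sqrt_two_inv_mul_self, hI]
  simp only [add_mul, mul_add, sub_mul, mul_sub]
  module

omit [Fintype ι] [DecidableEq ι] in
lemma linPencil_eq_reim (a₀ : Matrix ι ι ℂ) (a : Fin r → Matrix ι ι ℂ) (y : Fin r → A) :
    linPencil a₀ a y = amp a₀ 1 + ∑ i, amp (reimCoeff a i)
      (Sum.elim (fun j : Fin r => ((Real.sqrt 2 : ℝ) : ℂ)⁻¹ • (y j + star (y j)))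
      (fun j : Fin r => (Complex.I * ((Real.sqrt 2 : ℝ) : ℂ))⁻¹ • (y j - star (y j))) i) := by
  rw [linPencil, Fintype.sum_sum_type, ← Finset.sum_add_distrib]
  congr 1
  refine Finset.sum_congr rfl fun j _ => ?_
  have hI : (Complex.I * ((Real.sqrt 2 : ℝ) : ℂ)⁻¹) * (Complex.I * ((Real.sqrt 2 : ℝ) : ℂ))⁻¹
      = 1 / 2 := by
    rw [mul_inv, mul_mul_mul_comm, mul_inv_cancel₀ Complex.I_ne_zero, sqrt_two_inv_mul_self,
      one_mul]
  have h : ∀ (c d : ℂ) (e : Matrix ι ι ℂ) (x : A), amp (c • e) (d • x) = (c * d) • amp e x := by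
    intro c d e x; ext i k; simp only [amp_apply, Matrix.smul_apply, smul_smul, smul_eq_mul]
    congr 1; ring
  simp only [reimCoeff, Sum.elim_inl, Sum.elim_inr, h, sqrt_two_inv_mul_self, hI]
  ext i k
  simp only [amp_apply, Matrix.add_apply, Matrix.smul_apply, Matrix.sub_apply]
  module

/-- The Dyson equation for the Cauchy transform of a pencil in a circular system. -/
theorem IsCircularSystem.dyson (hτ : IsState τ) (hy : IsCircularSystem τ y) (h₀ : a₀ᴴ = a₀)
    {δ : ℝ} (hδ : 0 < δ) {z : Matrix ι ι ℂ} (hz : ImGE δ z) :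
    (z - a₀ - covMap a (cauchy τ a₀ a y z)) * cauchy τ a₀ a y z = 1 := by
  let _ : PartialOrder A := CStarAlgebra.spectralOrder A
  have : StarOrderedRing A := CStarAlgebra.spectralOrderedRing A
  set t := linPencil a₀ a y with ht
  -- The matrix z is absorbed into the constant coefficient, which becomes a₀ - z. The equation is
  -- continued in the scalar ζ, where ζ - s has imaginary part at least δ + Im ζ, and is then read
  -- off at ζ = 0.
  set s : Matrix ι ι A := t - amp z 1 with hs
  set e := CStarMatrix.ofMatrixRingEquiv (n := ι) (A := A)
  set b := reimCoeff a
  have hsx : s = amp (a₀ - z) 1 + ∑ i, amp (b i)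
      (Sum.elim (fun j : Fin r => ((Real.sqrt 2 : ℝ) : ℂ)⁻¹ • (y j + star (y j)))
      (fun j : Fin r => (Complex.I * ((Real.sqrt 2 : ℝ) : ℂ))⁻¹ • (y j - star (y j))) i) := by
    rw [hs, ht, linPencil_eq_reim, amp_sub]; abel
  let L₀ : CStarMatrix ι ι A →ₗ[ℂ] Matrix ι ι ℂ :=
    { toFun := fun X => sliceMap τ (e.symm X)
      map_add' := fun X Y => sliceMap_add τ X Y
      map_smul' := fun c X => sliceMap_smul τ c X }
  let L : CStarMatrix ι ι A →L[ℂ] Matrix ι ι ℂ := L₀.mkContinuous ((Fintype.card ι : ℝ) ^ 2)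
    fun X => hτ.norm_sliceMap_le fun i j => CStarMatrix.norm_entry_le_norm
  have hL : ∀ X, L (e X) = sliceMap τ X := fun X => rfl
  have hrec := fun k => hy.sliceMap_pow_succ hτ hsx k
  have hU : ∀ ζ : ℂ, -δ < ζ.im → IsUnit (ζ • 1 - e s) := fun ζ hζ => by
    have h1 : ImGE (δ + ζ.im) (z + ζ • 1) := fun u => by
      have e1 : imForm (ζ • (1 : Matrix ι ι ℂ)) u = ζ.im * sqNorm u := by
        have : star u ⬝ᵥ u = (sqNorm u : ℂ) := by
          simp [dotProduct, sqNorm, ← Complex.conj_mul']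
        rw [imForm, Matrix.smul_mulVec, Matrix.one_mulVec, dotProduct_smul, this, smul_eq_mul,
          Complex.im_mul_ofReal]
      rw [imForm_add, e1, add_mul]; linarith [hz u]
    have h2 := (resolvent_bound (by linarith) h1 (linPencil_conjTranspose h₀ a y)).1
    have h3 : ζ • 1 - e s = e (amp (z + ζ • 1) 1 - t) := by
      have : amp (z + ζ • 1) 1 - t = ζ • 1 - s := by
        rw [hs, amp_add, amp_smul, amp_one]; abel
      rw [this]; rfl
    rw [h3]; exact h2.map e
  have key := cauchy_equation_of_isUnit (L := L) (b := b) (c := a₀ - z) (s := e s)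
    (by rw [← map_one e, hL, ← amp_one, sliceMap_amp τ hτ.map_one])
    (by
      have := hrec 0
      simp only [zero_add, pow_one, pow_zero, powDiff] at this
      have h0 : sliceMap τ (0 : Matrix ι ι A) = 0 := by ext; simp [sliceMap_apply]
      rw [hL, this, ← amp_one, sliceMap_amp τ hτ.map_one, h0]
      simp)
    (fun k => by
      simp only [← map_pow, hL]
      rw [hrec (k + 1)]
      congr 1
      refine Finset.sum_congr rfl fun i _ => ?_
      rw [powDiff_succ_eq_sum, sliceMap_sum]
      simp only [sliceMap_mul_amp, mul_assoc])
    hU (ζ := 0) (by simpa using hδ)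
  have hinv : Ring.inverse ((0 : ℂ) • 1 - e s) = e (res z t) := by
    have : (0 : ℂ) • 1 - e s = e (amp z 1 - t) := by
      rw [zero_smul, zero_sub, ← map_neg, hs, neg_sub]
    rw [this, res]
    have hs' := linPencil_conjTranspose h₀ a y
    refine ring_inverse_eq ?_ ?_
    · rw [← map_mul, ← map_one e]; exact congrArg e (sub_mul_res hδ hz hs')
    · rw [← map_mul, ← map_one e]; exact congrArg e (res_mul_sub hδ hz hs')
  rw [hinv, hL, sum_reimCoeff] at key
  simpa [cauchy] using key

end LimitDyson

/-! ### Stability of the Dyson equation at its solution -/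

section Stability

variable {ι : Type*} [Fintype ι] [DecidableEq ι] {r : ℕ} {A : Type*} [CStarAlgebra A]
  {τ : A →ₗ[ℂ] ℂ} {a₀ : Matrix ι ι ℂ} {a : Fin r → Matrix ι ι ℂ} {y : Fin r → A}
  {δ : ℝ} {z : Matrix ι ι ℂ}

omit [DecidableEq ι] in
lemma continuous_covMap (a : Fin r → Matrix ι ι ℂ) : Continuous (covMap a) := by
  unfold covMap; fun_prop

lemma IsState.norm_cauchy_le (hτ : IsState τ) (h₀ : a₀ᴴ = a₀) (hδ : 0 < δ) (hz : ImGE δ z) :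
    ‖cauchy τ a₀ a y z‖ ≤ (Fintype.card ι : ℝ) ^ 2 * δ⁻¹ :=
  hτ.norm_sliceMap_le (norm_res_entry_le hδ hz (linPencil_conjTranspose h₀ a y))

lemma IsState.imForm_cauchy_nonpos (hτ : IsState τ) (h₀ : a₀ᴴ = a₀) (hδ : 0 < δ) (hz : ImGE δ z)
    (u : ι → ℂ) : imForm (cauchy τ a₀ a y z) u ≤ 0 :=
  hτ.imForm_sliceMap_nonpos hδ hz (linPencil_conjTranspose h₀ a y)
    (sub_mul_res hδ hz (linPencil_conjTranspose h₀ a y)) u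

lemma cauchy_sub_cauchy {ε : ℝ} {w : Matrix ι ι ℂ} (h₀ : a₀ᴴ = a₀) (hδ : 0 < δ) (hz : ImGE δ z)
    (hε : 0 < ε) (hw : ImGE ε w) : cauchy τ a₀ a y z - cauchy τ a₀ a y w
      = sliceMap τ (res z (linPencil a₀ a y) * amp (w - z) 1 * res w (linPencil a₀ a y)) := by
  rw [cauchy, cauchy, ← sliceMap_sub, res_sub_res hδ hz hε hw (linPencil_conjTranspose h₀ a y)]

/-- The linearised Dyson equation, satisfied by the directional derivatives of the Cauchy
transform. -/
theorem IsCircularSystem.linearized_dyson (hτ : IsState τ) (hy : IsCircularSystem τ y)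
    (h₀ : a₀ᴴ = a₀) (hδ : 0 < δ) (hz : ImGE δ z) (w : Matrix ι ι ℂ) :
    sliceMap τ (res z (linPencil a₀ a y) * amp w 1 * res z (linPencil a₀ a y))
      = cauchy τ a₀ a y z * (w + covMap a (sliceMap τ (res z (linPencil a₀ a y) * amp w 1 *
        res z (linPencil a₀ a y)))) * cauchy τ a₀ a y z := by
  set s := linPencil a₀ a y with hs
  have hss : sᴴ = s := linPencil_conjTranspose h₀ a y
  set G := cauchy τ a₀ a y
  set K : ℝ → Matrix ι ι ℂ := fun ε => sliceMap τ (res z s * amp w 1 * res (z + (ε : ℂ) • w) s)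
  set K₀ := sliceMap τ (res z s * amp w 1 * res z s)
  -- For ε < ε₀ the perturbation ε w has norm at most δ/2, so z + ε w keeps imaginary part at least
  -- δ/2.
  set ε₀ := δ / (2 * (‖w‖ + 1))
  have hε₀ : 0 < ε₀ := by positivity
  have hzε : ∀ ε ∈ Set.Ioo 0 ε₀, ImGE (δ / 2) (z + (ε : ℂ) • w) := fun ε hε => by
    have h1 : ‖(ε : ℂ) • w‖ ≤ δ / 2 := by
      rw [norm_smul, Complex.norm_real, Real.norm_of_nonneg hε.1.le]
      have h2 : ε * (2 * (‖w‖ + 1)) < δ := (lt_div_iff₀ (by positivity)).1 hε.2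
      nlinarith [hε.1]
    have := hz.add_of_norm_le h1
    rwa [sub_half] at this
  have hδ2 : 0 < δ / 2 := by positivity
  have hGsub : ∀ ε ∈ Set.Ioo 0 ε₀, G z - G (z + (ε : ℂ) • w) = (ε : ℂ) • K ε := fun ε hε => by
    rw [cauchy_sub_cauchy h₀ hδ hz hδ2 (hzε ε hε), add_sub_cancel_left, amp_smul, Matrix.mul_smul,
      Matrix.smul_mul, sliceMap_smul]
  have hbK : ∀ ε ∈ Set.Ioo 0 ε₀, ‖K ε‖ ≤ (Fintype.card ι : ℝ) ^ 4 * (δ⁻¹ * ‖w‖ * (δ / 2)⁻¹) :=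
    fun ε hε => hτ.norm_sliceMap_mul_amp_mul_le (norm_res_entry_le hδ hz hss)
      (norm_res_entry_le hδ2 (hzε ε hε) hss)
  have hmem : ∀ᶠ ε in nhdsWithin (0 : ℝ) (Set.Ioi 0), ε ∈ Set.Ioo 0 ε₀ := Ioo_mem_nhdsGT hε₀
  have hlim : ∀ C : ℝ, Filter.Tendsto (fun ε : ℝ => C * ε) (nhdsWithin (0 : ℝ) (Set.Ioi 0))
      (nhds 0) := fun C => by
    have : Filter.Tendsto (fun ε : ℝ => C * ε) (nhds 0) (nhds (C * 0)) :=
      (continuous_const.mul continuous_id).tendsto 0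
    rw [mul_zero] at this
    exact this.mono_left nhdsWithin_le_nhds
  have hGlim : Filter.Tendsto (fun ε : ℝ => G (z + (ε : ℂ) • w)) (nhdsWithin (0 : ℝ) (Set.Ioi 0))
      (nhds (G z)) := by
    rw [tendsto_iff_norm_sub_tendsto_zero]
    refine squeeze_zero' (Filter.Eventually.of_forall fun _ => norm_nonneg _) ?_
      (hlim ((Fintype.card ι : ℝ) ^ 4 * (δ⁻¹ * ‖w‖ * (δ / 2)⁻¹)))
    filter_upwards [hmem] with ε hε
    rw [norm_sub_rev, hGsub ε hε, norm_smul, Complex.norm_real, Real.norm_of_nonneg hε.1.le, mul_comm]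
    exact mul_le_mul_of_nonneg_right (hbK ε hε) hε.1.le
  have hKlim : Filter.Tendsto K (nhdsWithin (0 : ℝ) (Set.Ioi 0)) (nhds K₀) := by
    rw [tendsto_iff_norm_sub_tendsto_zero]
    refine squeeze_zero' (Filter.Eventually.of_forall fun _ => norm_nonneg _) ?_
      (hlim ((Fintype.card ι : ℝ) ^ 4 * (δ⁻¹ * ‖w‖
        * ((Fintype.card ι : ℝ) ^ 2 * (δ⁻¹ * ‖w‖ * (δ / 2)⁻¹)))))
    filter_upwards [hmem] with ε hε
    have e1 : K ε - K₀ = (ε : ℂ) • sliceMap τ (res z s * amp (-w) 1 *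
        (res z s * amp w 1 * res (z + (ε : ℂ) • w) s)) := by
      have e2 := res_sub_res hδ hz hδ2 (hzε ε hε) hss
      rw [add_sub_cancel_left, amp_smul, Matrix.mul_smul, Matrix.smul_mul] at e2
      have e3 : amp (-w) (1 : A) = - amp w 1 := by ext; simp [amp_apply]
      rw [← sliceMap_sub, ← mul_sub, ← sliceMap_smul, ← Matrix.mul_smul, ← e2, e3, mul_neg, neg_mul,
        ← mul_neg, neg_sub]
    rw [e1, norm_smul, Complex.norm_real, Real.norm_of_nonneg hε.1.le, mul_comm]
    refine mul_le_mul_of_nonneg_right ?_ hε.1.le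
    have := hτ.norm_sliceMap_mul_amp_mul_le (c := -w) (norm_res_entry_le hδ hz hss)
      (norm_mul_amp_mul_entry_le (c := w) (norm_res_entry_le hδ hz hss)
        (norm_res_entry_le hδ2 (hzε ε hε) hss))
    rwa [norm_neg] at this
  -- Subtracting the Dyson equations at z and z + ε w and dividing by ε gives the linearised
  -- equation with a difference quotient; the limit ε → 0 is taken below.
  have heq : ∀ ε ∈ Set.Ioo 0 ε₀, K ε = G z * (w + covMap a (K ε)) * G (z + (ε : ℂ) • w) := by
    intro ε hε
    have d1 := hy.dyson (a := a) hτ h₀ hδ hz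
    have d2 := hy.dyson (a := a) hτ h₀ hδ2 (hzε ε hε)
    have d1' := mul_eq_one_comm.1 d1
    have hε0 : (ε : ℂ) ≠ 0 := Complex.ofReal_ne_zero.2 hε.1.ne'
    have e1 : (ε : ℂ) • K ε = (ε : ℂ) • (G z * (w + covMap a (K ε)) * G (z + (ε : ℂ) • w)) := by
      rw [← Matrix.smul_mul, ← Matrix.mul_smul, smul_add, ← covMap_smul, ← hGsub ε hε, covMap_sub]
      have e2 : (ε : ℂ) • w + (covMap a (G z) - covMap a (G (z + (ε : ℂ) • w)))
          = (z + (ε : ℂ) • w - a₀ - covMap a (G (z + (ε : ℂ) • w)))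
            - (z - a₀ - covMap a (G z)) := by abel
      rw [e2, mul_sub, sub_mul, mul_assoc, d2, d1', mul_one, one_mul]
    exact smul_right_injective _ hε0 e1
  have hRlim : Filter.Tendsto (fun ε : ℝ => G z * (w + covMap a (K ε)) * G (z + (ε : ℂ) • w))
      (nhdsWithin (0 : ℝ) (Set.Ioi 0)) (nhds (G z * (w + covMap a K₀) * G z)) :=
    ((tendsto_const_nhds.add (((continuous_covMap a).tendsto _).comp hKlim)).const_mul _).mul hGlim
  refine tendsto_nhds_unique hKlim (hRlim.congr' ?_)
  filter_upwards [hmem] with ε hε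
  exact (heq ε hε).symm

/-- The solution of an inhomogeneous linearised Dyson equation is given by the derivative of the
Cauchy transform. -/
theorem IsCircularSystem.eq_of_linearized_dyson (hτ : IsState τ) (hy : IsCircularSystem τ y)
    (h₀ : a₀ᴴ = a₀) (hδ : 0 < δ) (hz : ImGE δ z) {F W : Matrix ι ι ℂ}
    (hF : F = cauchy τ a₀ a y z * covMap a F * cauchy τ a₀ a y z + cauchy τ a₀ a y z * W) :
    F = sliceMap τ (res z (linPencil a₀ a y) *
      amp (W * (z - a₀ - covMap a (cauchy τ a₀ a y z))) 1 * res z (linPencil a₀ a y)) := by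
  set s := linPencil a₀ a y
  set G := cauchy τ a₀ a y z
  set V := z - a₀ - covMap a G
  have hVG : V * G = 1 := hy.dyson hτ h₀ hδ hz
  have hGV : G * V = 1 := mul_eq_one_comm.1 hVG
  let Φ : Matrix ι ι ℂ →ₗ[ℂ] Matrix ι ι ℂ :=
    { toFun := fun e => sliceMap τ (res z s * amp (V * e * V) 1 * res z s)
      map_add' := fun e f => by
        rw [mul_add, add_mul, amp_add, mul_add, add_mul, sliceMap_add]
      map_smul' := fun c e => by
        rw [Matrix.mul_smul, Matrix.smul_mul, amp_smul, Matrix.mul_smul, Matrix.smul_mul,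
          sliceMap_smul, RingHom.id_apply] }
  let T : Matrix ι ι ℂ →ₗ[ℂ] Matrix ι ι ℂ :=
    { toFun := fun e => e - G * covMap a e * G
      map_add' := fun e f => by rw [covMap_add, mul_add, add_mul]; abel
      map_smul' := fun c e => by
        rw [covMap_smul, Matrix.mul_smul, Matrix.smul_mul, RingHom.id_apply, smul_sub] }
  -- The linearised Dyson equation says that Φ is a right inverse of T. In finite dimension it is
  -- then a two-sided inverse, so the injectivity of T needs no separate argument.
  have hTΦ : T * Φ = 1 := by
    refine LinearMap.ext fun e => ?_
    have h := hy.linearized_dyson (a := a) hτ h₀ hδ hz (V * e * V)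
    change Φ e - G * covMap a (Φ e) * G = e
    change Φ e = G * (V * e * V + covMap a (Φ e)) * G at h
    rw [sub_eq_iff_eq_add]
    conv_lhs => rw [h]
    rw [mul_add, add_mul, ← mul_assoc, ← mul_assoc, hGV, one_mul, mul_assoc, hVG, mul_one]
  have hΦT : Φ * T = 1 := mul_eq_one_comm.1 hTΦ
  have h1 : Φ (T F) = F := by
    have := LinearMap.congr_fun hΦT F
    exact this
  have h2 : T F = G * W := by
    change F - G * covMap a F * G = G * W
    rw [sub_eq_iff_eq_add, add_comm]; exact hF
  rw [← h1, h2]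
  change sliceMap τ (res z s * amp (V * (G * W) * V) 1 * res z s) = _
  rw [← mul_assoc V, hVG, one_mul]

end Stability

/-! ### Gaussian integration by parts -/

section Stein

open MeasureTheory ProbabilityTheory

lemma hasDerivAt_gaussianPDFReal {v : ℝ≥0} (hv : v ≠ 0) (x : ℝ) :
    HasDerivAt (gaussianPDFReal 0 v) (-(x / v) * gaussianPDFReal 0 v x) x := by
  have hv' : (v : ℝ) ≠ 0 := NNReal.coe_ne_zero.2 hv
  have h1 : HasDerivAt (fun x : ℝ => -(x - 0) ^ 2 / (2 * v)) (-(x / v)) x := by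
    have := ((((hasDerivAt_id x).sub_const 0).pow 2).neg).div_const (2 * (v : ℝ))
    refine this.congr_deriv ?_
    simp only [id_eq, sub_zero]; field_simp; norm_num
  have h2 := (h1.exp).const_mul (Real.sqrt (2 * Real.pi * v))⁻¹
  rw [gaussianPDFReal_def]
  refine h2.congr_deriv ?_
  ring

/-- Stein's identity in one variable. -/
lemma integral_mul_gaussianReal {v : ℝ≥0} (hv : v ≠ 0) {f f' : ℝ → ℂ}
    (hf : ∀ x, HasDerivAt f (f' x) x) (hf'c : Continuous f') {C C' : ℝ} (hb : ∀ x, ‖f x‖ ≤ C)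
    (hb' : ∀ x, ‖f' x‖ ≤ C') :
    ∫ x, (x : ℂ) * f x ∂gaussianReal 0 v = v * ∫ x, f' x ∂gaussianReal 0 v := by
  have hv' : (v : ℝ) ≠ 0 := NNReal.coe_ne_zero.2 hv
  have hfc : Continuous f := continuous_iff_continuousAt.2 fun x => (hf x).continuousAt
  set p := gaussianPDFReal 0 v
  have hp : ∀ x, HasDerivAt (fun x => (p x : ℂ)) ((-(x / v) * p x : ℝ) : ℂ) x := fun x =>
    (hasDerivAt_gaussianPDFReal hv x).ofReal_comp
  have hpi : Integrable p := integrable_gaussianPDFReal 0 v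
  have hpi1 : Integrable fun x => x * p x := by
    have h1 : Integrable (fun x : ℝ => x) (gaussianReal 0 v) :=
      (memLp_id_gaussianReal (μ := 0) (v := v) 1).integrable le_rfl
    rw [gaussianReal_of_var_ne_zero 0 hv, integrable_withDensity_iff_integrable_smul'
      (measurable_gaussianPDF 0 v) (Filter.Eventually.of_forall fun x => gaussianPDF_lt_top)] at h1
    simpa [toReal_gaussianPDF, mul_comm, p] using h1
  have i1 : Integrable fun x => f x * ((-(x / v) * p x : ℝ) : ℂ) := by
    refine Integrable.bdd_mul (c := C) ?_ hfc.aestronglyMeasurable (Filter.Eventually.of_forall hb)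
    have : Integrable fun x => -(x / v) * p x := by
      have := hpi1.const_mul (-(1 / (v : ℝ)))
      refine this.congr (Filter.Eventually.of_forall fun x => ?_)
      simp only; ring
    exact this.ofReal
  have i2 : Integrable fun x => f' x * (p x : ℂ) :=
    Integrable.bdd_mul (c := C') hpi.ofReal hf'c.aestronglyMeasurable
      (Filter.Eventually.of_forall hb')
  have i3 : Integrable fun x => f x * (p x : ℂ) :=
    Integrable.bdd_mul (c := C) hpi.ofReal hfc.aestronglyMeasurable (Filter.Eventually.of_forall hb)
  -- The Gaussian density satisfies p' = -(x/v) p, so integrating f p' by parts is Stein's identity.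
  have key := integral_mul_deriv_eq_deriv_mul_of_integrable (fun x _ => hf x) (fun x _ => hp x)
    i1 i2 i3
  rw [integral_gaussianReal_eq_integral_smul hv, integral_gaussianReal_eq_integral_smul hv]
  have e1 : ∀ x, gaussianPDFReal 0 v x • ((x : ℂ) * f x)
      = (-(v : ℂ)) * (f x * ((-(x / v) * p x : ℝ) : ℂ)) := fun x => by
    have : (v : ℂ) ≠ 0 := by exact_mod_cast hv'
    simp only [Complex.real_smul, p]
    push_cast
    field_simp
  have e2 : ∀ x, gaussianPDFReal 0 v x • f' x = f' x * (p x : ℂ) := fun x => by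
    rw [Complex.real_smul, mul_comm]
  simp_rw [e1, e2]
  rw [integral_const_mul, key]; simp

variable {κ : Type*} [Fintype κ]

/-- The law of a family of independent centred Gaussian variables of variance `v`. -/
def gaussPi (κ : Type*) [Fintype κ] (v : ℝ≥0) : Measure (κ → ℝ) :=
  Measure.pi fun _ => gaussianReal 0 v

instance (v : ℝ≥0) : IsProbabilityMeasure (gaussPi κ v) := by unfold gaussPi; infer_instance

lemma integrable_eval_gaussPi (v : ℝ≥0) (i : κ) : Integrable (fun x : κ → ℝ => x i) (gaussPi κ v) :=
  (measurePreserving_eval (fun _ => gaussianReal 0 v) i).integrable_comp_of_integrable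
    (g := fun x => x) ((memLp_id_gaussianReal (μ := 0) (v := v) 1).integrable le_rfl)

variable [DecidableEq κ]

/-- Replacing one coordinate by an independent copy does not change the product law. Fubini then
reduces Stein's identity to the variable i without splitting the index set. -/
lemma measurePreserving_update (v : ℝ≥0) (i : κ) :
    MeasurePreserving (fun p : (κ → ℝ) × ℝ => Function.update p.1 i p.2)
      ((gaussPi κ v).prod (gaussianReal 0 v)) (gaussPi κ v) := by
  have hm : Measurable fun p : (κ → ℝ) × ℝ => Function.update p.1 i p.2 := by
    refine measurable_pi_iff.2 fun j => ?_
    by_cases h : j = i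
    · subst h; simpa using measurable_snd
    · simp only [Function.update_of_ne h]
      exact (measurable_pi_apply j).comp measurable_fst
  refine ⟨hm, ?_⟩
  symm
  refine Measure.pi_eq fun S hS => ?_
  rw [Measure.map_apply hm (MeasurableSet.univ_pi hS)]
  have e : (fun p : (κ → ℝ) × ℝ => Function.update p.1 i p.2) ⁻¹' Set.univ.pi S
      = (Set.univ.pi (Function.update S i Set.univ)) ×ˢ S i := by
    ext ⟨x, s⟩
    simp only [Set.mem_preimage, Set.mem_pi, Set.mem_univ, true_implies, Set.mem_prod]
    constructor
    · intro h
      refine ⟨fun j => ?_, by simpa using h i⟩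
      by_cases hj : j = i
      · subst hj; simp
      · simpa [hj] using h j
    · rintro ⟨h1, h2⟩ j
      by_cases hj : j = i
      · subst hj; simpa using h2
      · simpa [hj] using h1 j
  rw [e, Measure.prod_prod, gaussPi, Measure.pi_pi,
    ← Finset.mul_prod_erase Finset.univ _ (Finset.mem_univ i),
    ← Finset.mul_prod_erase Finset.univ (fun j => gaussianReal 0 v (S j)) (Finset.mem_univ i)]
  simp only [Function.update_self, measure_univ, one_mul]
  rw [mul_comm]
  congr 1
  refine Finset.prod_congr rfl fun j hj => ?_
  rw [Function.update_of_ne (Finset.ne_of_mem_erase hj)]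

/-- Stein's identity for independent Gaussian variables. -/
theorem integral_mul_gaussPi {v : ℝ≥0} (hv : v ≠ 0) (i : κ) {f f' : (κ → ℝ) → ℂ}
    (hfc : Continuous f) (hf'c : Continuous f')
    (hf : ∀ x s, HasDerivAt (fun s => f (Function.update x i s)) (f' (Function.update x i s)) s)
    {C C' : ℝ} (hb : ∀ x, ‖f x‖ ≤ C) (hb' : ∀ x, ‖f' x‖ ≤ C') :
    ∫ x, (x i : ℂ) * f x ∂gaussPi κ v = v * ∫ x, f' x ∂gaussPi κ v := by
  have hmp := measurePreserving_update v i
  have i1 : Integrable (fun x : κ → ℝ => (x i : ℂ) * f x) (gaussPi κ v) :=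
    Integrable.mul_bdd (c := C) (integrable_eval_gaussPi v i).ofReal hfc.aestronglyMeasurable
      (Filter.Eventually.of_forall hb)
  have i2 : Integrable f' (gaussPi κ v) :=
    Integrable.of_bound hf'c.aestronglyMeasurable C' (Filter.Eventually.of_forall hb')
  rw [← hmp.map_eq] at i1 i2 ⊢
  rw [integral_map hmp.measurable.aemeasurable i1.aestronglyMeasurable,
    integral_map hmp.measurable.aemeasurable i2.aestronglyMeasurable]
  have i1' := (integrable_map_measure i1.aestronglyMeasurable hmp.measurable.aemeasurable).1 i1
  have i2' := (integrable_map_measure i2.aestronglyMeasurable hmp.measurable.aemeasurable).1 i2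
  simp only [Function.comp_def] at i1' i2'
  rw [integral_prod _ i1', integral_prod _ i2', ← integral_const_mul]
  refine integral_congr_ae (Filter.Eventually.of_forall fun x => ?_)
  simp only [Function.update_self]
  refine integral_mul_gaussianReal hv (hf x) ?_ (fun s => hb _) (fun s => hb' _)
  exact hf'c.comp (continuous_const.update i continuous_id)

end Stein

/-! ### A Poincaré inequality for Gaussian measures -/

section Poincare

open MeasureTheory ProbabilityTheory
open scoped ENNReal

lemma sq_lintegral_le {α : Type*} [MeasurableSpace α] (μ : Measure α) {g : α → ℝ≥0∞}
    (hg : AEMeasurable g μ) : (∫⁻ x, g x ∂μ) ^ 2 ≤ μ Set.univ * ∫⁻ x, g x ^ 2 ∂μ := by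
  have h := ENNReal.lintegral_mul_le_Lp_mul_Lq μ Real.HolderConjugate.two_two hg
    (aemeasurable_const (b := (1 : ℝ≥0∞)))
  simp only [Pi.mul_apply, mul_one, ENNReal.rpow_ofNat, one_pow, lintegral_const, one_mul] at h
  calc (∫⁻ x, g x ∂μ) ^ 2
      ≤ ((∫⁻ x, g x ^ 2 ∂μ) ^ (1 / 2 : ℝ) * (μ Set.univ) ^ (1 / 2 : ℝ)) ^ 2 := by gcongr
    _ = _ := by
      rw [mul_pow, ← ENNReal.rpow_natCast, ← ENNReal.rpow_natCast, ← ENNReal.rpow_mul,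
        ← ENNReal.rpow_mul]
      norm_num [mul_comm]

variable {E : Type*} [NormedAddCommGroup E] [NormedSpace ℝ E] [FiniteDimensional ℝ E]
  [MeasurableSpace E] [BorelSpace E]

/-- Pisier's form of the Gaussian Poincaré inequality. -/
theorem lintegral_sub_sq_le (γ : Measure E) [IsGaussian γ] (hγ : ∫ x, x ∂γ = 0) {f : E → ℂ}
    {f' : E → E →L[ℝ] ℂ} (hf : ∀ x, HasFDerivAt f (f' x) x) (hf'c : Continuous f') {K : ℝ≥0∞}
    (hK : ∀ x, ∫⁻ y, ‖f' x y‖ₑ ^ 2 ∂γ ≤ K) :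
    ∫⁻ p, ‖f p.2 - f p.1‖ₑ ^ 2 ∂(γ.prod γ) ≤ ENNReal.ofReal (Real.pi / 2) ^ 2 * K := by
  have : ProperSpace E := FiniteDimensional.proper ℝ E
  have : SecondCountableTopology E := secondCountable_of_proper
  have hfc : Continuous f := continuous_iff_continuousAt.2 fun x => (hf x).continuousAt
  set Φ : E × E → ℝ≥0∞ := fun q => ‖f' q.1 q.2‖ₑ ^ 2 with hΦ
  have hΦc : Continuous Φ := by
    have : Continuous fun q : E × E => f' q.1 q.2 := (hf'c.comp continuous_fst).clm_apply continuous_snd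
    exact (ENNReal.continuous_pow 2).comp this.enorm
  have hrot : Continuous fun q : (E × E) × ℝ => ContinuousLinearMap.rotation q.2 q.1 := by
    simp only [ContinuousLinearMap.rotation_apply]
    fun_prop
  set ν := volume.restrict (Set.Ioc (0 : ℝ) (Real.pi / 2))
  have hν : ν Set.univ = ENNReal.ofReal (Real.pi / 2) := by simp [ν]
  have hpt : ∀ p : E × E, ‖f p.2 - f p.1‖ₑ ^ 2
      ≤ ENNReal.ofReal (Real.pi / 2) * ∫⁻ θ, Φ (ContinuousLinearMap.rotation θ p) ∂ν := fun p => by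
    -- f(p₂) - f(p₁) is the integral of the derivative along the quarter circle cos θ p₁ + sin θ p₂.
    -- Cauchy–Schwarz in θ costs one factor π/2.
    set g : ℝ → ℂ := fun θ => f' (Real.cos θ • p.1 + Real.sin θ • p.2)
      (-Real.sin θ • p.1 + Real.cos θ • p.2)
    have hgc : Continuous g := by
      refine Continuous.clm_apply (hf'c.comp (by fun_prop)) (by fun_prop)
    have hder : ∀ θ, HasDerivAt (fun θ => f (Real.cos θ • p.1 + Real.sin θ • p.2)) (g θ) θ :=
      fun θ => (hf _).comp_hasDerivAt θ (((Real.hasDerivAt_cos θ).smul_const p.1).add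
        ((Real.hasDerivAt_sin θ).smul_const p.2))
    have hint := intervalIntegral.integral_eq_sub_of_hasDerivAt (a := 0) (b := Real.pi / 2)
      (fun θ _ => hder θ) (hgc.intervalIntegrable _ _)
    simp only [Real.cos_pi_div_two, Real.sin_pi_div_two, Real.cos_zero, Real.sin_zero, zero_smul,
      one_smul, zero_add, add_zero] at hint
    rw [intervalIntegral.integral_of_le (by positivity)] at hint
    rw [← hint, ← hν]
    calc ‖∫ θ, g θ ∂ν‖ₑ ^ 2 ≤ (∫⁻ θ, ‖g θ‖ₑ ∂ν) ^ 2 := by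
          gcongr; exact enorm_integral_le_lintegral_enorm _
      _ ≤ ν Set.univ * ∫⁻ θ, ‖g θ‖ₑ ^ 2 ∂ν := sq_lintegral_le ν hgc.enorm.measurable.aemeasurable
      _ = _ := rfl
  have hmeas : Measurable fun q : (E × E) × ℝ => Φ (ContinuousLinearMap.rotation q.2 q.1) :=
    (hΦc.comp hrot).measurable
  calc ∫⁻ p, ‖f p.2 - f p.1‖ₑ ^ 2 ∂(γ.prod γ)
      ≤ ∫⁻ p, ENNReal.ofReal (Real.pi / 2) *
          ∫⁻ θ, Φ (ContinuousLinearMap.rotation θ p) ∂ν ∂(γ.prod γ) := lintegral_mono hpt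
    _ = ENNReal.ofReal (Real.pi / 2) *
          ∫⁻ θ, ∫⁻ p, Φ (ContinuousLinearMap.rotation θ p) ∂(γ.prod γ) ∂ν := by
        rw [lintegral_const_mul' _ _ ENNReal.ofReal_ne_top, lintegral_lintegral_swap]
        exact hmeas.aemeasurable
    _ ≤ ENNReal.ofReal (Real.pi / 2) * ∫⁻ _, K ∂ν := by
        gcongr with θ
        -- The position and velocity of the path form a rotation of (p₁, p₂), and γ ⊗ γ is rotation
        -- invariant. They are therefore independent with law γ, and the bound K applies for each θ.
        rw [← lintegral_map hΦc.measurable (ContinuousLinearMap.rotation θ).continuous.measurable,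
          IsGaussian.map_rotation_eq_self (by simpa using hγ), lintegral_prod _ hΦc.aemeasurable]
        calc ∫⁻ x, ∫⁻ y, Φ (x, y) ∂γ ∂γ ≤ ∫⁻ _, K ∂γ := lintegral_mono hK
          _ = K := by simp
    _ = _ := by rw [lintegral_const, hν, pow_two]; ring

variable {κ : Type*} [Fintype κ]

instance (v : ℝ≥0) : IsGaussian (gaussPi κ v) := by
  have h1 : iIndepFun (fun (i : κ) (x : κ → ℝ) => x i) (gaussPi κ v) := by
    have := iIndepFun_pi (μ := fun _ : κ => gaussianReal 0 v) (X := fun _ x => x)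
      (fun _ => aemeasurable_id)
    exact this
  have h2 : ∀ i : κ, HasGaussianLaw (fun x : κ → ℝ => x i) (gaussPi κ v) := fun i => by
    have := (measurePreserving_eval (fun _ : κ => gaussianReal 0 v) i).map_eq
    refine ⟨?_⟩
    change IsGaussian ((gaussPi κ v).map (Function.eval i))
    rw [gaussPi, this]; infer_instance
  have h3 := (h1.hasGaussianLaw h2).isGaussian_map
  have : (fun (x : κ → ℝ) (i : κ) => x i) = id := rfl
  rwa [this, Measure.map_id] at h3

lemma integral_eval_gaussPi (v : ℝ≥0) (i : κ) : ∫ x, x i ∂gaussPi κ v = 0 := by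
  have h := measurePreserving_eval (fun _ : κ => gaussianReal 0 v) i
  have := integral_map (μ := gaussPi κ v) (f := fun x : ℝ => x) h.measurable.aemeasurable
    (by fun_prop)
  rw [gaussPi, h.map_eq, integral_id_gaussianReal] at this
  exact this.symm

lemma integral_id_gaussPi (v : ℝ≥0) : ∫ x, x ∂gaussPi κ v = 0 := by
  funext i
  rw [eval_integral fun i => integrable_eval_gaussPi v i, integral_eval_gaussPi]; rfl

lemma memLp_eval_gaussPi (v : ℝ≥0) (i : κ) : MemLp (fun x : κ → ℝ => x i) 2 (gaussPi κ v) :=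
  (memLp_id_gaussianReal (μ := 0) (v := v) 2).comp_measurePreserving
    (measurePreserving_eval (fun _ => gaussianReal 0 v) i)

lemma integral_sq_sum_gaussPi (v : ℝ≥0) (c : κ → ℝ) :
    ∫ x, (∑ i, c i * x i) ^ 2 ∂gaussPi κ v = v * ∑ i, c i ^ 2 := by
  have hm : ∀ i ∈ Finset.univ, MemLp (fun x : κ → ℝ => c i * x i) 2 (gaussPi κ v) := fun i _ =>
    (memLp_eval_gaussPi v i).const_mul (c i)
  have hind := iIndepFun_pi (μ := fun _ : κ => gaussianReal 0 v) (X := fun i x => c i * x)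
      (fun _ => by fun_prop)
  have hv := IndepFun.variance_sum hm (fun i _ j _ hij => hind.indepFun hij)
  have h0 : ∫ x, (∑ i, fun x : κ → ℝ => c i * x i) x ∂gaussPi κ v = 0 := by
    simp only [Finset.sum_apply]
    rw [integral_finsetSum _ fun i _ => (integrable_eval_gaussPi v i).const_mul (c i)]
    simp [integral_const_mul, integral_eval_gaussPi]
  rw [variance_of_integral_eq_zero (memLp_finsetSum' _ hm).aemeasurable h0] at hv
  simp only [Finset.sum_apply] at hv
  rw [hv, Finset.mul_sum]
  refine Finset.sum_congr rfl fun i _ => ?_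
  rw [variance_const_mul, mul_comm]
  congr 1
  have h := measurePreserving_eval (fun _ : κ => gaussianReal 0 v) i
  have := h.variance_fun_comp (f := fun x : ℝ => x) (by fun_prop)
  rw [variance_fun_id_gaussianReal] at this
  exact this

variable [DecidableEq κ]

/-- The real and imaginary parts of ℓ are linear combinations of independent centred variables, so
their variances add. -/
lemma lintegral_clm_gaussPi (v : ℝ≥0) (ℓ : (κ → ℝ) →L[ℝ] ℂ) :
    ∫⁻ y, ‖ℓ y‖ₑ ^ 2 ∂gaussPi κ v = ENNReal.ofReal (v * ∑ i, ‖ℓ (Pi.single i 1)‖ ^ 2) := by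
  have hexp : ∀ y, ℓ y = ∑ i, (y i : ℂ) * ℓ (Pi.single i 1) := fun y => by
    conv_lhs => rw [pi_eq_sum_univ' y, map_sum]
    refine Finset.sum_congr rfl fun i _ => ?_
    rw [map_smul, Complex.real_smul]
  have hsq : ∀ y, ‖ℓ y‖ ^ 2 = (∑ i, (ℓ (Pi.single i 1)).re * y i) ^ 2
      + (∑ i, (ℓ (Pi.single i 1)).im * y i) ^ 2 := fun y => by
    rw [hexp, Complex.sq_norm, Complex.normSq_apply, Complex.re_sum, Complex.im_sum]
    simp only [Complex.re_ofReal_mul, Complex.im_ofReal_mul, pow_two, mul_comm]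
  have hint : ∀ c : κ → ℝ, Integrable (fun y : κ → ℝ => (∑ i, c i * y i) ^ 2) (gaussPi κ v) :=
    fun c => (memLp_finsetSum _ fun i _ => (memLp_eval_gaussPi v i).const_mul (c i)).integrable_sq
  have h1 : ∀ y, ‖ℓ y‖ₑ ^ 2 = ENNReal.ofReal (‖ℓ y‖ ^ 2) := fun y => by
    rw [ENNReal.ofReal_pow (norm_nonneg _), ofReal_norm]
  simp_rw [h1]
  rw [← ofReal_integral_eq_lintegral_ofReal]
  · congr 1
    rw [integral_congr_ae (Filter.Eventually.of_forall hsq),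
      integral_add (hint _) (hint _), integral_sq_sum_gaussPi, integral_sq_sum_gaussPi, ← mul_add,
      ← Finset.sum_add_distrib]
    congr 1
    refine Finset.sum_congr rfl fun i _ => ?_
    rw [Complex.sq_norm, Complex.normSq_apply]; ring
  · simp_rw [hsq]; exact (hint _).add (hint _)
  · exact Filter.Eventually.of_forall fun y => sq_nonneg _

/-- A Gaussian Poincaré inequality for bounded functions of independent Gaussian variables. -/
theorem integral_norm_sub_integral_sq_le (v : ℝ≥0) {f : (κ → ℝ) → ℂ}
    {f' : (κ → ℝ) → (κ → ℝ) →L[ℝ] ℂ} (hf : ∀ x, HasFDerivAt f (f' x) x) (hf'c : Continuous f')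
    {C K : ℝ} (hb : ∀ x, ‖f x‖ ≤ C) (hK : ∀ x, ∑ i, ‖f' x (Pi.single i 1)‖ ^ 2 ≤ K) :
    ∫ x, ‖f x - ∫ y, f y ∂gaussPi κ v‖ ^ 2 ∂gaussPi κ v ≤ (Real.pi / 2) ^ 2 * (v * K) := by
  set γ := gaussPi κ v
  have hfc : Continuous f := continuous_iff_continuousAt.2 fun x => (hf x).continuousAt
  have hfi : Integrable f γ :=
    Integrable.of_bound hfc.aestronglyMeasurable C (Filter.Eventually.of_forall hb)
  have hK0 : 0 ≤ K := (Finset.sum_nonneg fun i _ => sq_nonneg _).trans (hK 0)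
  have h1 := lintegral_sub_sq_le γ (integral_id_gaussPi v) hf hf'c
    (K := ENNReal.ofReal (v * K)) (fun x => by
      rw [lintegral_clm_gaussPi]
      exact ENNReal.ofReal_le_ofReal (mul_le_mul_of_nonneg_left (hK x) v.2))
  -- Jensen's inequality in the second variable: the mean is replaced by an independent copy.
  have h2 : ∫⁻ x, ‖f x - ∫ y, f y ∂γ‖ₑ ^ 2 ∂γ ≤ ∫⁻ p, ‖f p.2 - f p.1‖ₑ ^ 2 ∂(γ.prod γ) := by
    have hm : Measurable fun p : (κ → ℝ) × (κ → ℝ) => ‖f p.2 - f p.1‖ₑ ^ 2 :=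
      (((hfc.comp continuous_snd).sub (hfc.comp continuous_fst)).enorm.measurable).pow_const 2
    rw [lintegral_prod _ hm.aemeasurable]
    refine lintegral_mono fun x => ?_
    have e : f x - ∫ y, f y ∂γ = - ∫ y, (f y - f x) ∂γ := by
      rw [integral_sub hfi (integrable_const _)]; simp
    rw [e, enorm_neg]
    calc ‖∫ y, (f y - f x) ∂γ‖ₑ ^ 2 ≤ (∫⁻ y, ‖f y - f x‖ₑ ∂γ) ^ 2 := by
          gcongr; exact enorm_integral_le_lintegral_enorm _
      _ ≤ γ Set.univ * ∫⁻ y, ‖f y - f x‖ₑ ^ 2 ∂γ :=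
          sq_lintegral_le γ (hfc.sub continuous_const).enorm.measurable.aemeasurable
      _ = _ := by rw [measure_univ, one_mul]
  have h3 := h2.trans h1
  have e1 : ∀ x, ‖f x - ∫ y, f y ∂γ‖ₑ ^ 2 = ENNReal.ofReal (‖f x - ∫ y, f y ∂γ‖ ^ 2) := fun x => by
    rw [ENNReal.ofReal_pow (norm_nonneg _), ofReal_norm]
  simp_rw [e1] at h3
  rw [← ENNReal.ofReal_pow (by positivity), ← ENNReal.ofReal_mul (by positivity)] at h3
  rw [integral_eq_lintegral_of_nonneg_ae (Filter.Eventually.of_forall fun x => sq_nonneg _)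
    (by fun_prop)]
  exact ENNReal.toReal_le_of_le_ofReal (by positivity) h3

end Poincare

/-! ### Smoothness of the resolvent of a random pencil -/

section Smooth

/-- The derivative of an inverse in direction v is X (T v) X. Bare functions with linearity
hypotheses are used so that B can be `CStarMatrix`, while the conclusion mentions only the scalar φ
(X x) and does not depend on a norm of B. -/
lemma exists_hasFDerivAt_inverse {B E : Type*} [NormedRing B] [NormedAlgebra ℂ B] [CompleteSpace B]
    [FiniteDimensional ℂ B] [NormedAddCommGroup E] [NormedSpace ℝ E] [FiniteDimensional ℝ E]
    (b : B) (S X T : E → B) (φ : B → ℂ) (hTa : ∀ x y, T (x + y) = T x + T y)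
    (hTs : ∀ (c : ℝ) x, T (c • x) = (c : ℂ) • T x) (hφa : ∀ x y, φ (x + y) = φ x + φ y)
    (hφs : ∀ (c : ℂ) x, φ (c • x) = c * φ x) (hS : ∀ x, S x = b - T x) (h₁ : ∀ x, S x * X x = 1)
    (h₂ : ∀ x, X x * S x = 1) :
    ∃ f' : E → E →L[ℝ] ℂ, Continuous f' ∧ (∀ x, HasFDerivAt (fun x => φ (X x)) (f' x) x) ∧
      ∀ x v, f' x v = φ (X x * T v * X x) := by
  let T' : E →L[ℝ] B := LinearMap.toContinuousLinearMap ⟨⟨T, hTa⟩, fun c x => hTs c x⟩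
  let φ₁ : B →L[ℂ] ℂ := LinearMap.toContinuousLinearMap ⟨⟨φ, hφa⟩, hφs⟩
  let φ' : B →L[ℝ] ℂ := φ₁.restrictScalars ℝ
  have hu : ∀ x, ∃ u : Bˣ, (u : B) = b - T' x ∧ ((u⁻¹ : Bˣ) : B) = X x := fun x =>
    ⟨⟨S x, X x, h₁ x, h₂ x⟩, hS x, rfl⟩
  have hX : ∀ x, X x = Ring.inverse (b - T' x) := fun x => by
    obtain ⟨u, h, h'⟩ := hu x
    rw [← h, Ring.inverse_unit, h']
  have hinv : Continuous X := continuous_iff_continuousAt.2 fun x => by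
    obtain ⟨u, hu', -⟩ := hu x
    rw [funext hX]
    have h1 : ContinuousAt Ring.inverse (b - T' x) := hu' ▸ NormedRing.inverse_continuousAt u
    exact ContinuousAt.comp (f := fun x => b - T' x) h1 (by fun_prop)
  refine ⟨fun x => φ'.comp ((ContinuousLinearMap.mulLeftRight ℝ B (X x) (X x)).comp T'), ?_,
    fun x => ?_, fun x v => ?_⟩
  · have h1 : Continuous fun x => ContinuousLinearMap.mulLeftRight ℝ B (X x) (X x) :=
      ((ContinuousLinearMap.mulLeftRight ℝ B).continuous.comp hinv).clm_apply hinv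
    exact continuous_const.clm_comp (h1.clm_comp continuous_const)
  · obtain ⟨u, hu', h4⟩ := hu x
    have h1 : HasFDerivAt (fun x => b - T' x) (-T') x := T'.hasFDerivAt.const_sub b
    have h2 := hasFDerivAt_ringInverse (𝕜 := ℝ) u
    rw [hu'] at h2
    have h3 := φ'.hasFDerivAt.comp x (h2.comp x h1)
    have h5 : (fun x => φ (X x)) = φ' ∘ Ring.inverse ∘ fun x => b - T' x :=
      funext fun x => congrArg φ (hX x)
    rw [h5]
    refine h3.congr_fderiv ?_
    ext v
    simp [← h4]
  · rfl

variable {ι : Type*} [Fintype ι] [DecidableEq ι] {r n : ℕ}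

/-- The real random matrices with prescribed entries, viewed as complex matrices. -/
def entryMat (x : Fin r × Fin n × Fin n → ℝ) (j : Fin r) : Matrix (Fin n) (Fin n) ℂ :=
  Matrix.of fun k l => (x (j, k, l) : ℂ)

/-- The homogeneous part of a linear pencil. -/
def linPart {A : Type*} [Ring A] [Algebra ℂ A] [Star A] (a : Fin r → Matrix ι ι ℂ) (y : Fin r → A) :
    Matrix ι ι A := ∑ j, (amp (a j) (y j) + amp (a j)ᴴ (star (y j)))

omit [Fintype ι] [DecidableEq ι] in
lemma linPart_entryMat_apply (a : Fin r → Matrix ι ι ℂ) (x : Fin r × Fin n × Fin n → ℝ) (p q : ι)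
    (k l : Fin n) : linPart a (entryMat x) p q k l
      = ∑ j, (a j p q * x (j, k, l) + (a j)ᴴ p q * x (j, l, k)) := by
  simp only [linPart, Matrix.sum_apply, Matrix.add_apply, amp_apply, Matrix.smul_apply, smul_eq_mul,
    Matrix.star_eq_conjTranspose, Matrix.conjTranspose_apply, entryMat, Matrix.of_apply,
    Complex.star_def, Complex.conj_ofReal]

-- A real entry occurs in Y and in Y*, so one coordinate direction carries both e_kl and e_lk. This
-- doubling is the source of the 1/n term.
omit [Fintype ι] [DecidableEq ι] in
lemma linPart_entryMat_single (a : Fin r → Matrix ι ι ℂ) (j : Fin r) (k l : Fin n) :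
    linPart a (entryMat (Pi.single (j, k, l) 1)) = amp (a j) (Matrix.single k l (1 : ℂ))
      + amp (a j)ᴴ (Matrix.single l k (1 : ℂ)) := by
  ext p q k' l'
  rw [linPart_entryMat_apply, Finset.sum_eq_single j]
  · simp only [Matrix.add_apply, amp_apply, Matrix.smul_apply, smul_eq_mul, Matrix.single_apply,
      Pi.single_apply, Prod.mk.injEq, true_and]
    congr 2
    · simp [eq_comm, apply_ite]
    · simp [eq_comm, and_comm, apply_ite]
  · intro j' _ hj
    simp [hj]
  · simp

omit [Fintype ι] [DecidableEq ι] in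
lemma linPart_entryMat_add (a : Fin r → Matrix ι ι ℂ) (x y : Fin r × Fin n × Fin n → ℝ) :
    linPart a (entryMat (x + y)) = linPart a (entryMat x) + linPart a (entryMat y) := by
  ext p q k l
  rw [Matrix.add_apply, Matrix.add_apply]
  simp only [linPart_entryMat_apply, Pi.add_apply, Complex.ofReal_add, ← Finset.sum_add_distrib]
  exact Finset.sum_congr rfl fun _ _ => by ring

omit [Fintype ι] [DecidableEq ι] in
lemma linPart_entryMat_smul (a : Fin r → Matrix ι ι ℂ) (c : ℝ) (x : Fin r × Fin n × Fin n → ℝ) :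
    linPart a (entryMat (c • x)) = (c : ℂ) • linPart a (entryMat x) := by
  ext p q k l
  rw [Matrix.smul_apply, Matrix.smul_apply]
  simp only [linPart_entryMat_apply, Pi.smul_apply, smul_eq_mul, Complex.ofReal_mul,
    Finset.mul_sum]
  exact Finset.sum_congr rfl fun _ _ => by ring

variable {a₀ : Matrix ι ι ℂ} {a : Fin r → Matrix ι ι ℂ} {δ : ℝ} {z : Matrix ι ι ℂ}

lemma exists_hasFDerivAt_res (h₀ : a₀ᴴ = a₀) (hδ : 0 < δ) (hz : ImGE δ z)
    (φ : Matrix ι ι (Matrix (Fin n) (Fin n) ℂ) →ₗ[ℂ] ℂ) :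
    ∃ f' : (Fin r × Fin n × Fin n → ℝ) → (Fin r × Fin n × Fin n → ℝ) →L[ℝ] ℂ, Continuous f' ∧
      (∀ x, HasFDerivAt (fun x => φ (res z (linPencil a₀ a (entryMat x)))) (f' x) x) ∧
      ∀ x v, f' x v = φ (res z (linPencil a₀ a (entryMat x)) * linPart a (entryMat v) *
        res z (linPencil a₀ a (entryMat x))) := by
  let A := Matrix (Fin n) (Fin n) ℂ
  let _ : PartialOrder A := CStarAlgebra.spectralOrder A
  have : StarOrderedRing A := CStarAlgebra.spectralOrderedRing A
  let e := CStarMatrix.ofMatrixRingEquiv (n := ι) (A := A)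
  have hfd : FiniteDimensional ℂ (CStarMatrix ι ι A) :=
    inferInstanceAs (FiniteDimensional ℂ (Matrix ι ι A))
  have hs := fun x => linPencil_conjTranspose h₀ a (entryMat (n := n) x)
  refine exists_hasFDerivAt_inverse (B := CStarMatrix ι ι A) (e (amp (z - a₀) 1))
    (fun x => e (amp z 1 - linPencil a₀ a (entryMat x)))
    (fun x => e (res z (linPencil a₀ a (entryMat x)))) (fun x => e (linPart a (entryMat x)))
    (fun X => φ (e.symm X)) (fun x y => ?_) (fun c x => ?_) (fun X Y => φ.map_add _ _)
    (fun c X => φ.map_smul c _) (fun x => ?_) (fun x => ?_) (fun x => ?_)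
  · rw [linPart_entryMat_add, map_add]
  · rw [linPart_entryMat_smul]; rfl
  · have : amp z 1 - linPencil a₀ a (entryMat x) = amp (z - a₀) 1 - linPart a (entryMat x) := by
      rw [linPencil, amp_sub, linPart]; abel
    rw [this, map_sub]
  · rw [← map_mul, ← map_one e]; exact congrArg e (sub_mul_res hδ hz (hs x))
  · rw [← map_mul, ← map_one e]; exact congrArg e (res_mul_sub hδ hz (hs x))

end Smooth

/-! ### The normalised trace. -/

section NormTrace

lemma normTrace_apply (n : ℕ) (M : Matrix (Fin n) (Fin n) ℂ) :
    normTrace n M = (n : ℂ)⁻¹ * ∑ k, M k k := by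
  simp [normTrace, Matrix.trace]

lemma isState_normTrace {n : ℕ} (hn : 0 < n) : IsState (normTrace n) where
  map_one := by
    have : (n : ℂ) ≠ 0 := Nat.cast_ne_zero.2 hn.ne'
    simp [normTrace_apply, this]
  nonneg M := by
    have h : 0 ≤ (Mᴴ * M).trace := (Matrix.posSemidef_conjTranspose_mul_self M).trace_nonneg
    have h2 : (0 : ℂ) ≤ (n : ℂ)⁻¹ := by
      rw [← Complex.ofReal_natCast, ← Complex.ofReal_inv, Complex.zero_le_real]; positivity
    simpa [normTrace, Matrix.star_eq_conjTranspose] using mul_nonneg h2 h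

lemma sum_norm_sq_le {n : ℕ} (M : Matrix (Fin n) (Fin n) ℂ) :
    ∑ k, ∑ l, ‖M k l‖ ^ 2 ≤ n * ‖M‖ ^ 2 := by
  rw [Finset.sum_comm]
  have h : ∀ l : Fin n, ∑ k, ‖M k l‖ ^ 2 ≤ ‖M‖ ^ 2 := fun l => by
    have h1 := sqNorm_mulVec_le M (Pi.single l 1)
    have h2 : sqNorm (Pi.single l (1 : ℂ)) = 1 := by
      rw [sqNorm, Finset.sum_eq_single l] <;> simp +contextual
    rw [h2, mul_one] at h1
    simpa [sqNorm] using h1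
  refine (Finset.sum_le_sum fun l _ => h l).trans (le_of_eq (by simp))

end NormTrace

/-! ### The correction term -/

section Correction

variable {ι : Type*} [Fintype ι] [DecidableEq ι] {r : ℕ} {A : Type*} [Ring A] [Algebra ℂ A]
  [Star A]

/-- The pencil with complex conjugated coefficients. -/
def conjLinPencil (a₀ : Matrix ι ι ℂ) (a : Fin r → Matrix ι ι ℂ) (y : Fin r → A) : Matrix ι ι A :=
  linPencil (a₀.map star) (fun j => (a j).map star) y

/-- The contribution of a coefficient `b` to `R(z)`. -/
def corrTerm (τ : A →ₗ[ℂ] ℂ) (a₀ : Matrix ι ι ℂ) (a : Fin r → Matrix ι ι ℂ) (y : Fin r → A)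
    (z b : Matrix ι ι ℂ) : Matrix ι ι ℂ :=
  ∑ k, ∑ l, b * Matrix.single k l (1 : ℂ) * sliceMap τ (res zᵀ (conjLinPencil a₀ a y) *
    amp (Matrix.single k l (1 : ℂ) * b) 1 * res z (linPencil a₀ a y))

/-- The function `R(z)`. -/
def corr (τ : A →ₗ[ℂ] ℂ) (a₀ : Matrix ι ι ℂ) (a : Fin r → Matrix ι ι ℂ) (y : Fin r → A)
    (z : Matrix ι ι ℂ) : Matrix ι ι ℂ :=
  ∑ j, (corrTerm τ a₀ a y z (a j) + corrTerm τ a₀ a y z (a j)ᴴ)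

omit [Fintype ι] [DecidableEq ι] in
lemma map_star_conjTranspose {a₀ : Matrix ι ι ℂ} (h₀ : a₀ᴴ = a₀) :
    (a₀.map star)ᴴ = a₀.map star := by
  ext i j
  have := congr_fun₂ h₀ j i
  simpa [Matrix.conjTranspose_apply] using this.symm

/-- The matrix units only contract indices. This entrywise form is the one in which the correction
arises from integration by parts. -/
lemma corrTerm_apply (τ : A →ₗ[ℂ] ℂ) (a₀ : Matrix ι ι ℂ) (a : Fin r → Matrix ι ι ℂ) (y : Fin r → A)
    (z b : Matrix ι ι ℂ) (i q : ι) : corrTerm τ a₀ a y z b i q = ∑ p, ∑ u, ∑ v, b i p * b u v *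
      τ (res zᵀ (conjLinPencil a₀ a y) u p * res z (linPencil a₀ a y) v q) := by
  simp only [corrTerm, Matrix.sum_apply]
  refine Finset.sum_congr rfl fun p _ => Finset.sum_congr rfl fun u _ => ?_
  rw [Matrix.mul_apply, Finset.sum_eq_single u]
  · rw [Matrix.mul_single_apply_same, mul_one, sliceMap_apply, Matrix.mul_apply, map_sum,
      Finset.mul_sum]
    refine Finset.sum_congr rfl fun v _ => ?_
    rw [Matrix.mul_apply, Finset.sum_eq_single p]
    · rw [amp_apply, Matrix.single_mul_apply_same, one_mul, mul_smul_comm, mul_one, smul_mul_assoc,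
        map_smul, smul_eq_mul, mul_assoc]
    · intro s _ hs
      rw [amp_apply, Matrix.single_mul_apply_of_ne _ _ _ _ _ hs, zero_smul, mul_zero]
    · simp
  · intro s _ hs
    rw [Matrix.mul_single_apply_of_ne _ _ _ _ _ hs, zero_mul]
  · simp

end Correction

/-! ### Algebra of the resolvent of a random pencil -/

section Algebra

variable {ι : Type*} [Fintype ι] {r n : ℕ}

lemma mul_amp_single_mul_apply (X Z : Matrix ι ι (Matrix (Fin n) (Fin n) ℂ)) (b : Matrix ι ι ℂ)
    (k l : Fin n) (p q : ι) (k' l' : Fin n) : (X * amp b (Matrix.single k l (1 : ℂ)) * Z :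
      Matrix ι ι (Matrix (Fin n) (Fin n) ℂ)) p q k' l'
      = ∑ u, ∑ v, b u v * (X p u k' k * Z v q l l') := by
  have h : (X * amp b (Matrix.single k l (1 : ℂ)) * Z : Matrix ι ι (Matrix (Fin n) (Fin n) ℂ)) p q
      = ∑ u, ∑ v, b u v • (X p u * (Matrix.single k l (1 : ℂ) * Z v q)) := by
    rw [mul_assoc, Matrix.mul_apply]
    simp only [amp_mul_apply, Finset.mul_sum, mul_smul_comm]
  rw [h]
  simp only [Matrix.sum_apply, Matrix.smul_apply, smul_eq_mul]
  refine Finset.sum_congr rfl fun u _ => Finset.sum_congr rfl fun v _ => ?_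
  rw [← mul_assoc, Matrix.mul_apply, Finset.sum_eq_single l]
  · rw [Matrix.mul_single_apply_same, mul_one]
  · intro s _ hs
    rw [Matrix.mul_single_apply_of_ne _ _ _ _ _ hs, zero_mul]
  · simp

/-- The insertion e_lk read at the entry (l, k) pairs diagonal entries X_ll and X_kk, and the sums
over l and k separate into two traces. -/
lemma sum_mul_mul_amp_single (X : Matrix ι ι (Matrix (Fin n) (Fin n) ℂ)) (b c : Matrix ι ι ℂ)
    (i q : ι) : ((n : ℂ)⁻¹ * (n : ℂ)⁻¹) * ∑ k, ∑ l, ∑ p, b i p *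
      (X * amp c (Matrix.single l k (1 : ℂ)) * X : Matrix ι ι (Matrix (Fin n) (Fin n) ℂ)) p q l k
      = (b * sliceMap (normTrace n) X * c * sliceMap (normTrace n) X) i q := by
  have h1 : (b * sliceMap (normTrace n) X * c * sliceMap (normTrace n) X) i q
      = ∑ p, b i p * ∑ u, ∑ v, c u v * (normTrace n (X p u) * normTrace n (X v q)) := by
    rw [mul_assoc, mul_assoc, Matrix.mul_apply]
    refine Finset.sum_congr rfl fun p _ => ?_
    simp only [Matrix.mul_apply, sliceMap_apply, Finset.mul_sum]
    exact Finset.sum_congr rfl fun u _ => Finset.sum_congr rfl fun v _ => by ring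
  rw [h1]
  have h2 : ∑ k, ∑ l, ∑ p, b i p * (X * amp c (Matrix.single l k (1 : ℂ)) * X :
      Matrix ι ι (Matrix (Fin n) (Fin n) ℂ)) p q l k
      = ∑ p, b i p * ∑ u, ∑ v, c u v * ((∑ l, X p u l l) * ∑ k, X v q k k) := by
    simp only [mul_amp_single_mul_apply, Finset.mul_sum, Finset.sum_mul]
    rw [Finset.sum_comm]
    simp only [Finset.sum_comm (s := (Finset.univ : Finset (Fin n))) (t := (Finset.univ : Finset ι))]
    refine Finset.sum_congr rfl fun p _ => Finset.sum_congr rfl fun u _ =>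
      Finset.sum_congr rfl fun v _ => Finset.sum_comm
  rw [h2]
  simp only [normTrace_apply, Finset.mul_sum]
  refine Finset.sum_congr rfl fun p _ => Finset.sum_congr rfl fun u _ =>
    Finset.sum_congr rfl fun v _ => ?_
  simp only [Finset.sum_mul, Finset.mul_sum]
  refine Finset.sum_congr rfl fun k _ => Finset.sum_congr rfl fun l _ => by ring

/-- Here both factors are read at the same entry (l, k), so the double sum is a single trace of a
transposed block times a block. Only one of the two factors 1/n is absorbed by a normalised trace.
-/
lemma sum_mul_mul_amp_single' (X : Matrix ι ι (Matrix (Fin n) (Fin n) ℂ)) (b c : Matrix ι ι ℂ)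
    (i q : ι) : ((n : ℂ)⁻¹ * (n : ℂ)⁻¹) * ∑ k, ∑ l, ∑ p, b i p *
      (X * amp c (Matrix.single k l (1 : ℂ)) * X : Matrix ι ι (Matrix (Fin n) (Fin n) ℂ)) p q l k
      = (n : ℂ)⁻¹ * ∑ p, ∑ u, ∑ v, b i p * c u v * normTrace n ((X p u)ᵀ * X v q) := by
  have h2 : ∑ k, ∑ l, ∑ p, b i p * (X * amp c (Matrix.single k l (1 : ℂ)) * X :
      Matrix ι ι (Matrix (Fin n) (Fin n) ℂ)) p q l k
      = ∑ p, ∑ u, ∑ v, b i p * c u v * (∑ k, ∑ l, X p u l k * X v q l k) := by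
    simp only [mul_amp_single_mul_apply, Finset.mul_sum]
    simp only [Finset.sum_comm (s := (Finset.univ : Finset (Fin n))) (t := (Finset.univ : Finset ι))]
    refine Finset.sum_congr rfl fun p _ => Finset.sum_congr rfl fun u _ =>
      Finset.sum_congr rfl fun v _ => Finset.sum_congr rfl fun k _ =>
      Finset.sum_congr rfl fun l _ => by ring
  rw [h2, mul_assoc]
  congr 1
  simp only [normTrace_apply, Finset.mul_sum, Matrix.mul_apply, Matrix.transpose_apply]
  refine Finset.sum_congr rfl fun p _ => Finset.sum_congr rfl fun u _ =>
    Finset.sum_congr rfl fun v _ => Finset.sum_congr rfl fun k _ =>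
      Finset.sum_congr rfl fun l _ => by ring

end Algebra

/-! ### Transposition of the resolvent -/

section Transpose

variable {ι : Type*} [Fintype ι] [DecidableEq ι] {r n : ℕ}
  {a₀ : Matrix ι ι ℂ} {a : Fin r → Matrix ι ι ℂ} {δ : ℝ} {z : Matrix ι ι ℂ}

omit [Fintype ι] [DecidableEq ι] in
lemma conjLinPencil_entryMat_apply (h₀ : a₀ᴴ = a₀) (x : Fin r × Fin n × Fin n → ℝ) (p q : ι) :
    conjLinPencil a₀ a (entryMat x) p q = (linPencil a₀ a (entryMat x) q p)ᵀ := by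
  have e : ∀ (b₀ : Matrix ι ι ℂ) (b : Fin r → Matrix ι ι ℂ) p q k l,
      linPencil b₀ b (entryMat x) p q k l = b₀ p q * (1 : Matrix (Fin n) (Fin n) ℂ) k l
        + ∑ j, (b j p q * x (j, k, l) + (b j)ᴴ p q * x (j, l, k)) := fun b₀ b p q k l => by
    rw [← linPart_entryMat_apply]; rfl
  ext k l
  rw [Matrix.transpose_apply, conjLinPencil, e, e]
  congr 1
  · rw [Matrix.map_apply, ← Matrix.conjTranspose_apply, h₀, Matrix.one_apply, Matrix.one_apply]
    simp only [eq_comm]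
  · refine Finset.sum_congr rfl fun j _ => ?_
    simp only [Matrix.conjTranspose_apply, Matrix.map_apply, star_star]
    ring

/-- Transposition in both tensor factors reverses products and sends z - s to zᵗ - s̄, as the
entries are real and a₀ is Hermitian. It therefore carries the resolvent of s to that of s̄. -/
lemma res_conjLinPencil_apply (h₀ : a₀ᴴ = a₀) (hδ : 0 < δ) (hz : ImGE δ z)
    (x : Fin r × Fin n × Fin n → ℝ) (u p : ι) :
    res zᵀ (conjLinPencil a₀ a (entryMat x)) u p = (res z (linPencil a₀ a (entryMat x)) p u)ᵀ := by
  have hs := linPencil_conjTranspose h₀ a (entryMat x)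
  set X := res z (linPencil a₀ a (entryMat x))
  let θ : Matrix ι ι (Matrix (Fin n) (Fin n) ℂ) → Matrix ι ι (Matrix (Fin n) (Fin n) ℂ) :=
    fun M => Matrix.of fun i j => (M j i)ᵀ
  have hθ : ∀ M N, θ M * θ N = θ (N * M) := fun M N => by
    ext1 i j
    simp [θ, Matrix.mul_apply, Matrix.transpose_sum]
  have h1 : θ 1 = 1 := by
    ext1 i j
    by_cases h : i = j
    · subst h; simp [θ]
    · simp [θ, h, Ne.symm h]
  have h2 : amp zᵀ 1 - conjLinPencil a₀ a (entryMat x)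
      = θ (amp z 1 - linPencil a₀ a (entryMat x)) := by
    ext1 i j
    simp [θ, amp_apply, conjLinPencil_entryMat_apply h₀]
  have h3 : res zᵀ (conjLinPencil a₀ a (entryMat x)) = θ X := by
    rw [res, h2]
    refine ring_inverse_eq ?_ ?_
    · rw [hθ, res_mul_sub hδ hz hs, h1]
    · rw [hθ, sub_mul_res hδ hz hs, h1]
  rw [h3]; rfl

end Transpose

section

open MeasureTheory

/-! ### The Schwinger–Dyson equation -/

section Bounds

variable {ι : Type*} [Fintype ι] [DecidableEq ι] {r n : ℕ}
  {a₀ : Matrix ι ι ℂ} {a : Fin r → Matrix ι ι ℂ} {δ : ℝ} {z : Matrix ι ι ℂ}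

omit [DecidableEq ι] in
lemma exists_linear_bound (φ : Matrix ι ι (Matrix (Fin n) (Fin n) ℂ) →ₗ[ℂ] ℂ) (t : ℝ) :
    ∃ C, ∀ X : Matrix ι ι (Matrix (Fin n) (Fin n) ℂ), (∀ i j, ‖X i j‖ ≤ t) → ‖φ X‖ ≤ C := by
  let φ' : (ι → ι → Matrix (Fin n) (Fin n) ℂ) →L[ℂ] ℂ :=
    LinearMap.toContinuousLinearMap (𝕜 := ℂ) (E := ι → ι → Matrix (Fin n) (Fin n) ℂ) φ
  refine ⟨‖φ'‖ * |t|, fun X hX => (φ'.le_opNorm X).trans ?_⟩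
  refine mul_le_mul_of_nonneg_left ?_ (norm_nonneg _)
  refine (pi_norm_le_iff_of_nonneg (abs_nonneg t)).2 fun i =>
    (pi_norm_le_iff_of_nonneg (abs_nonneg t)).2 fun j => (hX i j).trans (le_abs_self t)

lemma exists_linear_res_bound (h₀ : a₀ᴴ = a₀) (hδ : 0 < δ) (hz : ImGE δ z)
    (φ : Matrix ι ι (Matrix (Fin n) (Fin n) ℂ) →ₗ[ℂ] ℂ) :
    ∃ C, ∀ x, ‖φ (res z (linPencil a₀ a (entryMat x)))‖ ≤ C := by
  obtain ⟨C, hC⟩ := exists_linear_bound φ δ⁻¹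
  exact ⟨C, fun x => hC _ (norm_res_entry_le hδ hz (linPencil_conjTranspose h₀ a _))⟩

lemma exists_linear_res_mul_bound (h₀ : a₀ᴴ = a₀) (hδ : 0 < δ) (hz : ImGE δ z)
    (φ : Matrix ι ι (Matrix (Fin n) (Fin n) ℂ) →ₗ[ℂ] ℂ)
    (W : Matrix ι ι (Matrix (Fin n) (Fin n) ℂ)) :
    ∃ C, ∀ x, ‖φ (res z (linPencil a₀ a (entryMat x)) * W *
      res z (linPencil a₀ a (entryMat x)))‖ ≤ C := by
  obtain ⟨C, hC⟩ := exists_linear_bound φ (∑ v, ∑ u, δ⁻¹ * ‖W u v‖ * δ⁻¹)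
  refine ⟨C, fun x => hC _ fun i j => ?_⟩
  have h := norm_res_entry_le hδ hz (linPencil_conjTranspose h₀ a (entryMat x))
  rw [Matrix.mul_apply]
  refine (norm_sum_le _ _).trans (Finset.sum_le_sum fun v _ => ?_)
  rw [Matrix.mul_apply, Finset.sum_mul]
  refine (norm_sum_le _ _).trans (Finset.sum_le_sum fun u _ => ?_)
  refine (norm_mul_le _ _).trans ?_
  gcongr
  · exact (norm_mul_le _ _).trans (mul_le_mul_of_nonneg_right (h _ _) (norm_nonneg _))
  · exact h _ _

lemma continuous_linear_res (h₀ : a₀ᴴ = a₀) (hδ : 0 < δ) (hz : ImGE δ z)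
    (φ : Matrix ι ι (Matrix (Fin n) (Fin n) ℂ) →ₗ[ℂ] ℂ) :
    Continuous fun x => φ (res z (linPencil a₀ a (entryMat x))) := by
  obtain ⟨f', -, h, -⟩ := exists_hasFDerivAt_res (a := a) h₀ hδ hz φ
  exact continuous_iff_continuousAt.2 fun x => (h x).continuousAt

/-- Stein's identity for linear functionals of the resolvent. -/
lemma integral_mul_linear_res {v : ℝ≥0} (hv : v ≠ 0) (h₀ : a₀ᴴ = a₀) (hδ : 0 < δ) (hz : ImGE δ z)
    (φ : Matrix ι ι (Matrix (Fin n) (Fin n) ℂ) →ₗ[ℂ] ℂ) (j : Fin r) (k l : Fin n) :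
    ∫ x, (x (j, k, l) : ℂ) * φ (res z (linPencil a₀ a (entryMat x)))
        ∂gaussPi (Fin r × Fin n × Fin n) v
      = v * ∫ x, φ (res z (linPencil a₀ a (entryMat x)) * (amp (a j) (Matrix.single k l (1 : ℂ))
        + amp (a j)ᴴ (Matrix.single l k (1 : ℂ))) * res z (linPencil a₀ a (entryMat x)))
        ∂gaussPi (Fin r × Fin n × Fin n) v := by
  obtain ⟨f', h1, h2, h3⟩ := exists_hasFDerivAt_res (a := a) h₀ hδ hz φ
  obtain ⟨C, hC⟩ := exists_linear_res_bound (a := a) h₀ hδ hz φ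
  obtain ⟨C', hC'⟩ := exists_linear_res_mul_bound (a := a) h₀ hδ hz φ
    (amp (a j) (Matrix.single k l (1 : ℂ)) + amp (a j)ᴴ (Matrix.single l k (1 : ℂ)))
  have e : ∀ x, f' x (Pi.single (j, k, l) 1) = _ := fun x => h3 x (Pi.single (j, k, l) 1)
  simp only [linPart_entryMat_single] at e
  refine integral_mul_gaussPi hv (j, k, l) (continuous_linear_res h₀ hδ hz φ) ?_ (fun x s => ?_)
    hC hC'
  · simp only [← e]
    exact h1.clm_apply continuous_const
  · rw [← e]
    exact (h2 _).comp_hasDerivAt s (hasDerivAt_update x (j, k, l) s)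

end Bounds

/-! ### Norm bounds for the correction term. -/

section CorrBound

variable {ι : Type*} [Fintype ι] [DecidableEq ι] {r : ℕ} {A : Type*} [CStarAlgebra A]
  {τ : A →ₗ[ℂ] ℂ} {a₀ : Matrix ι ι ℂ} {a : Fin r → Matrix ι ι ℂ} {y : Fin r → A}
  {δ : ℝ} {z : Matrix ι ι ℂ}

lemma IsState.norm_corrTerm_le (hτ : IsState τ) (h₀ : a₀ᴴ = a₀) (hδ : 0 < δ) (hz : ImGE δ z)
    {κ : ℝ} {b : Matrix ι ι ℂ} (hb : ‖b‖ ≤ κ) :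
    ‖corrTerm τ a₀ a y z b‖ ≤ (Fintype.card ι : ℝ) ^ 6 * κ ^ 2 * δ⁻¹ ^ 2 := by
  have hκ : 0 ≤ κ := (norm_nonneg _).trans hb
  have h : ∀ k l, ‖b * Matrix.single k l (1 : ℂ) * sliceMap τ (res zᵀ (conjLinPencil a₀ a y) *
      amp (Matrix.single k l (1 : ℂ) * b) 1 * res z (linPencil a₀ a y))‖
      ≤ (Fintype.card ι : ℝ) ^ 4 * κ ^ 2 * δ⁻¹ ^ 2 := fun k l => by
    have h1 : ‖b * Matrix.single k l (1 : ℂ)‖ ≤ κ :=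
      (norm_mul_le _ _).trans ((mul_le_of_le_one_right (norm_nonneg _) (norm_single_le k l)).trans hb)
    have h2 : ‖Matrix.single k l (1 : ℂ) * b‖ ≤ κ :=
      (norm_mul_le _ _).trans ((mul_le_of_le_one_left (norm_nonneg _) (norm_single_le k l)).trans hb)
    have h3 := hτ.norm_sliceMap_mul_amp_mul_le (c := Matrix.single k l (1 : ℂ) * b)
      (norm_res_entry_le hδ hz.transpose (linPencil_conjTranspose (map_star_conjTranspose h₀)
        (fun j => (a j).map star) y)) (norm_res_entry_le hδ hz (linPencil_conjTranspose h₀ a y))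
    have h4 : (Fintype.card ι : ℝ) ^ 4 * (δ⁻¹ * ‖Matrix.single k l (1 : ℂ) * b‖ * δ⁻¹)
        ≤ (Fintype.card ι : ℝ) ^ 4 * (δ⁻¹ * κ * δ⁻¹) := by gcongr
    refine (norm_mul_le _ _).trans ((mul_le_mul h1 (h3.trans h4) (norm_nonneg _) hκ).trans
      (le_of_eq (by ring)))
  refine (norm_sum_le _ _).trans ((Finset.sum_le_sum fun k _ => (norm_sum_le _ _).trans
    (Finset.sum_le_sum fun l _ => h k l)).trans (le_of_eq ?_))
  simp only [Finset.sum_const, Finset.card_univ, nsmul_eq_mul]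
  ring

lemma IsState.norm_corr_le (hτ : IsState τ) (h₀ : a₀ᴴ = a₀) (hδ : 0 < δ) (hz : ImGE δ z)
    {κ : ℝ} (ha : ∀ j, ‖a j‖ ≤ κ) :
    ‖corr τ a₀ a y z‖ ≤ 2 * r * (Fintype.card ι : ℝ) ^ 6 * κ ^ 2 * δ⁻¹ ^ 2 := by
  have h : ∀ j, ‖corrTerm τ a₀ a y z (a j) + corrTerm τ a₀ a y z (a j)ᴴ‖
      ≤ 2 * ((Fintype.card ι : ℝ) ^ 6 * κ ^ 2 * δ⁻¹ ^ 2) := fun j => by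
    rw [two_mul]
    refine (norm_add_le _ _).trans (add_le_add (hτ.norm_corrTerm_le h₀ hδ hz (ha j))
      (hτ.norm_corrTerm_le h₀ hδ hz ?_))
    rw [Matrix.l2_opNorm_conjTranspose]; exact ha j
  refine (norm_sum_le _ _).trans ((Finset.sum_le_sum fun j _ => h j).trans (le_of_eq ?_))
  simp only [Finset.sum_const, Finset.card_univ, Fintype.card_fin, nsmul_eq_mul]
  ring

end CorrBound

/-! ### Expectations over the entries, and the Schwinger–Dyson equation of the mean. -/

section Integral

variable {ι : Type*} [Fintype ι] [DecidableEq ι] {r n : ℕ}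

/-- The law of the entries of `r` independent real Gaussian random matrices of variance `1/n`. -/
def entryLaw (r n : ℕ) : Measure (Fin r × Fin n × Fin n → ℝ) :=
  gaussPi (Fin r × Fin n × Fin n) (n : ℝ≥0)⁻¹

instance : IsProbabilityMeasure (entryLaw r n) := by unfold entryLaw; infer_instance

lemma integrable_of_continuous_of_bound {E : Type*} [NormedAddCommGroup E]
    {f : (Fin r × Fin n × Fin n → ℝ) → E} (hf : Continuous f) {C : ℝ} (hC : ∀ x, ‖f x‖ ≤ C) :
    Integrable f (entryLaw r n) :=
  Integrable.of_bound hf.aestronglyMeasurable C (Filter.Eventually.of_forall hC)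

lemma integral_linearMap {E F : Type*} [NormedAddCommGroup E] [NormedSpace ℂ E]
    [FiniteDimensional ℂ E] [NormedAddCommGroup F] [NormedSpace ℂ F] [FiniteDimensional ℂ F]
    {Ω : Type*} [MeasurableSpace Ω] {μ : Measure Ω} (L : E →ₗ[ℂ] F) {f : Ω → E}
    (hf : Integrable f μ) : ∫ x, L (f x) ∂μ = L (∫ x, f x ∂μ) := by
  have : CompleteSpace E := FiniteDimensional.complete ℂ E
  have : CompleteSpace F := FiniteDimensional.complete ℂ F
  exact (LinearMap.toContinuousLinearMap L).integral_comp_comm hf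

lemma integral_matrix_apply {Ω : Type*} [MeasurableSpace Ω] {μ : Measure Ω} {f : Ω → Matrix ι ι ℂ}
    (hf : Integrable f μ) (i j : ι) : (∫ x, f x ∂μ) i j = ∫ x, f x i j ∂μ :=
  (integral_linearMap (Matrix.entryLinearMap ℂ ℂ i j) hf).symm

variable {a₀ : Matrix ι ι ℂ} {a : Fin r → Matrix ι ι ℂ} {δ : ℝ} {z : Matrix ι ι ℂ}

lemma continuous_cauchy_entryMat (h₀ : a₀ᴴ = a₀) (hδ : 0 < δ) (hz : ImGE δ z) :
    Continuous fun x => cauchy (normTrace n) a₀ a (entryMat x) z :=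
  continuous_matrix fun i j => continuous_linear_res h₀ hδ hz
    ((normTrace n).comp (Matrix.entryLinearMap ℂ _ i j))

lemma continuous_corrTerm_entryMat (h₀ : a₀ᴴ = a₀) (hδ : 0 < δ) (hz : ImGE δ z)
    (b : Matrix ι ι ℂ) : Continuous fun x => corrTerm (normTrace n) a₀ a (entryMat x) z b := by
  have h : ∀ p q k l, Continuous fun x => res z (linPencil a₀ a (entryMat x)) p q k l :=
    fun p q k l => continuous_linear_res (n := n) h₀ hδ hz
      ((Matrix.entryLinearMap ℂ ℂ k l).comp (Matrix.entryLinearMap ℂ _ p q))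
  refine continuous_matrix fun i q => ?_
  simp only [corrTerm_apply, res_conjLinPencil_apply h₀ hδ hz, normTrace_apply, Matrix.mul_apply,
    Matrix.transpose_apply]
  fun_prop

lemma continuous_corr_entryMat (h₀ : a₀ᴴ = a₀) (hδ : 0 < δ) (hz : ImGE δ z) :
    Continuous fun x => corr (normTrace n) a₀ a (entryMat x) z :=
  continuous_finsetSum _ fun _ _ => (continuous_corrTerm_entryMat h₀ hδ hz _).add
    (continuous_corrTerm_entryMat h₀ hδ hz _)

lemma integrable_cauchy_entryMat (hn : 0 < n) (h₀ : a₀ᴴ = a₀) (hδ : 0 < δ) (hz : ImGE δ z) :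
    Integrable (fun x => cauchy (normTrace n) a₀ a (entryMat x) z) (entryLaw r n) :=
  integrable_of_continuous_of_bound (continuous_cauchy_entryMat h₀ hδ hz) fun _ =>
    (isState_normTrace hn).norm_cauchy_le h₀ hδ hz

lemma integrable_corr_entryMat (hn : 0 < n) (h₀ : a₀ᴴ = a₀) (hδ : 0 < δ) (hz : ImGE δ z) :
    Integrable (fun x => corr (normTrace n) a₀ a (entryMat x) z) (entryLaw r n) := by
  obtain ⟨κ, hκ⟩ := Finite.bddAbove_range fun j => ‖a j‖
  exact integrable_of_continuous_of_bound (continuous_corr_entryMat h₀ hδ hz) fun _ =>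
    (isState_normTrace hn).norm_corr_le h₀ hδ hz fun j => hκ ⟨j, rfl⟩

lemma integrable_covMap_cauchy_mul (hn : 0 < n) (h₀ : a₀ᴴ = a₀) (hδ : 0 < δ) (hz : ImGE δ z) :
    Integrable (fun x => covMap a (cauchy (normTrace n) a₀ a (entryMat x) z) *
      cauchy (normTrace n) a₀ a (entryMat x) z) (entryLaw r n) := by
  obtain ⟨κ, hκ⟩ := Finite.bddAbove_range fun j => ‖a j‖
  have hc := continuous_cauchy_entryMat (n := n) (a := a) h₀ hδ hz
  refine integrable_of_continuous_of_bound (((continuous_covMap a).comp hc).mul hc) (C :=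
    2 * r * κ ^ 2 * ((Fintype.card ι : ℝ) ^ 2 * δ⁻¹) * ((Fintype.card ι : ℝ) ^ 2 * δ⁻¹)) fun x => ?_
  have h := (isState_normTrace hn).norm_cauchy_le (a := a) (y := entryMat x) h₀ hδ hz
  refine (norm_mul_le _ _).trans (mul_le_mul ((norm_covMap_le (fun j => hκ ⟨j, rfl⟩) _).trans
    (mul_le_mul_of_nonneg_left h (by positivity))) h (norm_nonneg _) (by positivity))

/-- The linear functional of the resolvent multiplying a given entry in the Schwinger–Dyson
equation. -/
def entryFun (a : Fin r → Matrix ι ι ℂ) (i q : ι) (j : Fin r) (k l : Fin n) :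
    Matrix ι ι (Matrix (Fin n) (Fin n) ℂ) →ₗ[ℂ] ℂ where
  toFun X := ∑ p, (a j i p * X p q l k + (a j)ᴴ i p * X p q k l)
  map_add' X Y := by
    rw [← Finset.sum_add_distrib]
    exact Finset.sum_congr rfl fun p _ => by simp only [Matrix.add_apply]; ring
  map_smul' c X := by
    rw [RingHom.id_apply, smul_eq_mul, Finset.mul_sum]
    exact Finset.sum_congr rfl fun p _ => by simp only [Matrix.smul_apply, smul_eq_mul]; ring

/-- This is (z - s) X = 1, sliced and expanded in the entries. Each entry multiplies a linear
functional of the resolvent, which is the form needed for Stein's identity. -/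
lemma sub_mul_cauchy_apply (hn : 0 < n) (h₀ : a₀ᴴ = a₀) (hδ : 0 < δ) (hz : ImGE δ z)
    (x : Fin r × Fin n × Fin n → ℝ) (i q : ι) :
    ((z - a₀) * cauchy (normTrace n) a₀ a (entryMat x) z) i q = (1 : Matrix ι ι ℂ) i q
      + (n : ℂ)⁻¹ * ∑ j, ∑ k, ∑ l, (x (j, k, l) : ℂ) *
        entryFun a i q j k l (res z (linPencil a₀ a (entryMat x))) := by
  set X := res z (linPencil a₀ a (entryMat x)) with hX
  have h1 := sub_mul_res hδ hz (linPencil_conjTranspose h₀ a (entryMat x))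
  rw [← hX] at h1
  have h2 : amp z 1 - linPencil a₀ a (entryMat x) = amp (z - a₀) 1 - linPart a (entryMat x) := by
    rw [linPencil, amp_sub, linPart]; abel
  rw [h2, sub_mul] at h1
  have h3 : (z - a₀) * cauchy (normTrace n) a₀ a (entryMat x) z
      = 1 + sliceMap (normTrace n) (linPart a (entryMat x) * X) := by
    rw [cauchy, ← sliceMap_amp_mul, ← hX, ← sub_eq_iff_eq_add, ← sliceMap_sub, h1,
      ← amp_one, sliceMap_amp _ (isState_normTrace hn).map_one]
  rw [h3, Matrix.add_apply, sliceMap_apply, normTrace_apply]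
  congr 2
  have h4 : ∀ k, (linPart a (entryMat x) * X) i q k k = ∑ l, ∑ p,
      ∑ j, (a j i p * x (j, k, l) * X p q l k + (a j)ᴴ i p * x (j, l, k) * X p q l k) := fun k => by
    rw [Matrix.mul_apply, Matrix.sum_apply, Finset.sum_comm]
    refine Finset.sum_congr rfl fun p _ => ?_
    rw [Matrix.mul_apply]
    refine Finset.sum_congr rfl fun l _ => ?_
    rw [linPart_entryMat_apply, Finset.sum_mul]
    exact Finset.sum_congr rfl fun j _ => by ring
  simp only [h4, Finset.sum_add_distrib]
  have h5 : ∑ k, ∑ l, ∑ p, ∑ j, (a j)ᴴ i p * x (j, l, k) * X p q l k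
      = ∑ k, ∑ l, ∑ p, ∑ j, (a j)ᴴ i p * x (j, k, l) * X p q k l := Finset.sum_comm
  rw [h5]
  simp only [← Finset.sum_add_distrib, entryFun, LinearMap.coe_mk, AddHom.coe_mk]
  simp only [Finset.sum_comm (s := (Finset.univ : Finset ι)) (t := (Finset.univ : Finset (Fin r))),
    Finset.sum_comm (s := (Finset.univ : Finset (Fin n))) (t := (Finset.univ : Finset (Fin r))),
    Finset.mul_sum]
  refine Finset.sum_congr rfl fun j _ => Finset.sum_congr rfl fun k _ =>
    Finset.sum_congr rfl fun l _ => Finset.sum_congr rfl fun p _ => by ring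

lemma sum_entryFun_mul (h₀ : a₀ᴴ = a₀) (hδ : 0 < δ) (hz : ImGE δ z)
    (x : Fin r × Fin n × Fin n → ℝ) (i q : ι) :
    ((n : ℂ)⁻¹ * (n : ℂ)⁻¹) * ∑ j, ∑ k, ∑ l, entryFun a i q j k l
        (res z (linPencil a₀ a (entryMat x)) * (amp (a j) (Matrix.single k l (1 : ℂ))
        + amp (a j)ᴴ (Matrix.single l k (1 : ℂ))) * res z (linPencil a₀ a (entryMat x)))
      = (covMap a (cauchy (normTrace n) a₀ a (entryMat x) z) *
          cauchy (normTrace n) a₀ a (entryMat x) z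
        + (n : ℂ)⁻¹ • corr (normTrace n) a₀ a (entryMat x) z) i q := by
  set X := res z (linPencil a₀ a (entryMat x)) with hX
  have hH : cauchy (normTrace n) a₀ a (entryMat x) z = sliceMap (normTrace n) X := rfl
  have hc : ∀ b, corrTerm (normTrace n) a₀ a (entryMat x) z b i q
      = ∑ p, ∑ u, ∑ v, b i p * b u v * normTrace n ((X p u)ᵀ * X v q) := fun b => by
    rw [corrTerm_apply]
    simp only [res_conjLinPencil_apply h₀ hδ hz, ← hX]
  rw [hH, covMap, corr, Finset.sum_mul, Matrix.add_apply, Matrix.sum_apply, Matrix.smul_apply,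
    Matrix.sum_apply, smul_eq_mul, Finset.mul_sum, Finset.mul_sum, ← Finset.sum_add_distrib]
  refine Finset.sum_congr rfl fun j _ => ?_
  rw [add_mul, Matrix.add_apply, Matrix.add_apply, hc, hc, mul_add,
    ← sum_mul_mul_amp_single, ← sum_mul_mul_amp_single, ← sum_mul_mul_amp_single',
    ← sum_mul_mul_amp_single']
  have e : ∀ f : Fin n → Fin n → ℂ, ∑ k, ∑ l, f k l = ∑ k, ∑ l, f l k :=
    fun f => Finset.sum_comm
  -- The adjoint half of `entryFun` reads the entry (k, l) instead of (l, k), so k and l are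
  -- interchanged there.
  rw [e fun k l => ∑ p, (a j)ᴴ i p * (X * amp (a j) (Matrix.single l k (1 : ℂ)) * X :
      Matrix ι ι (Matrix (Fin n) (Fin n) ℂ)) p q l k,
    e fun k l => ∑ p, (a j)ᴴ i p * (X * amp (a j)ᴴ (Matrix.single k l (1 : ℂ)) * X :
      Matrix ι ι (Matrix (Fin n) (Fin n) ℂ)) p q l k]
  simp only [← mul_add, ← Finset.sum_add_distrib]
  congr 1
  refine Finset.sum_congr rfl fun k _ => Finset.sum_congr rfl fun l _ => ?_
  refine Finset.sum_congr rfl fun p _ => ?_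
  rw [mul_add X, add_mul, Matrix.add_apply, Matrix.add_apply, Matrix.add_apply]
  ring

/-- The Schwinger–Dyson equation for the mean Cauchy transform. -/
theorem sub_mul_integral_cauchy (hn : 0 < n) (h₀ : a₀ᴴ = a₀) (hδ : 0 < δ) (hz : ImGE δ z) :
    (z - a₀) * ∫ x, cauchy (normTrace n) a₀ a (entryMat x) z ∂entryLaw r n
      = 1 + ∫ x, covMap a (cauchy (normTrace n) a₀ a (entryMat x) z) *
          cauchy (normTrace n) a₀ a (entryMat x) z ∂entryLaw r n
        + (n : ℂ)⁻¹ • ∫ x, corr (normTrace n) a₀ a (entryMat x) z ∂entryLaw r n := by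
  have hn0 : (n : ℝ≥0)⁻¹ ≠ 0 := inv_ne_zero (Nat.cast_ne_zero.2 hn.ne')
  have iH := integrable_cauchy_entryMat (a := a) hn h₀ hδ hz
  have iC := integrable_corr_entryMat (a := a) hn h₀ hδ hz
  have iHH := integrable_covMap_cauchy_mul (a := a) hn h₀ hδ hz
  have e0 := integral_linearMap (LinearMap.mulLeft ℂ (z - a₀)) iH
  simp only [LinearMap.mulLeft_apply] at e0
  rw [← e0]
  ext i q
  have iX : ∀ j k l, Integrable (fun x => (x (j, k, l) : ℂ) *
      entryFun a i q j k l (res z (linPencil a₀ a (entryMat x)))) (entryLaw r n) := fun j k l => by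
    obtain ⟨C, hC⟩ := exists_linear_res_bound (a := a) h₀ hδ hz (entryFun a i q j k l)
    exact Integrable.mul_bdd (c := C) (integrable_eval_gaussPi _ (j, k, l)).ofReal
      (continuous_linear_res h₀ hδ hz _).aestronglyMeasurable (Filter.Eventually.of_forall hC)
  have iX' : ∀ j k l, Integrable (fun x => entryFun a i q j k l
        (res z (linPencil a₀ a (entryMat x)) * (amp (a j) (Matrix.single k l (1 : ℂ))
        + amp (a j)ᴴ (Matrix.single l k (1 : ℂ))) * res z (linPencil a₀ a (entryMat x))))
      (entryLaw r n) := fun j k l => by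
    obtain ⟨C, hC⟩ := exists_linear_res_mul_bound (a := a) h₀ hδ hz (entryFun a i q j k l)
      (amp (a j) (Matrix.single k l (1 : ℂ)) + amp (a j)ᴴ (Matrix.single l k (1 : ℂ)))
    obtain ⟨f', h1, -, h3⟩ := exists_hasFDerivAt_res (a := a) h₀ hδ hz (entryFun a i q j k l)
    have e : ∀ x, f' x (Pi.single (j, k, l) 1) = _ := fun x => h3 x (Pi.single (j, k, l) 1)
    simp only [linPart_entryMat_single] at e
    refine integrable_of_continuous_of_bound ?_ hC
    simp only [← e]
    exact h1.clm_apply continuous_const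
  rw [integral_matrix_apply (iH.const_mul (z - a₀))]
  simp only [sub_mul_cauchy_apply hn h₀ hδ hz]
  rw [integral_add (integrable_const _) ((integrable_finsetSum _ fun j _ =>
    integrable_finsetSum _ fun k _ => integrable_finsetSum _ fun l _ => iX j k l).const_mul _),
    integral_const_mul, integral_finsetSum _ fun j _ =>
    integrable_finsetSum _ fun k _ => integrable_finsetSum _ fun l _ => iX j k l]
  -- Stein's identity with variance 1/n supplies the second factor 1/n.
  have hst : ∀ j, ∫ x, ∑ k, ∑ l, (x (j, k, l) : ℂ) *
      entryFun a i q j k l (res z (linPencil a₀ a (entryMat x))) ∂entryLaw r n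
      = (n : ℂ)⁻¹ * ∫ x, ∑ k, ∑ l, entryFun a i q j k l
        (res z (linPencil a₀ a (entryMat x)) * (amp (a j) (Matrix.single k l (1 : ℂ))
        + amp (a j)ᴴ (Matrix.single l k (1 : ℂ))) * res z (linPencil a₀ a (entryMat x)))
        ∂entryLaw r n := fun j => by
    rw [integral_finsetSum _ fun k _ => integrable_finsetSum _ fun l _ => iX j k l,
      integral_finsetSum _ fun k _ => integrable_finsetSum _ fun l _ => iX' j k l,
      Finset.mul_sum]
    refine Finset.sum_congr rfl fun k _ => ?_
    rw [integral_finsetSum _ fun l _ => iX j k l, integral_finsetSum _ fun l _ => iX' j k l,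
      Finset.mul_sum]
    refine Finset.sum_congr rfl fun l _ => ?_
    rw [entryLaw, integral_mul_linear_res hn0 h₀ hδ hz]
    simp
  simp only [hst]
  rw [← Finset.mul_sum, ← integral_finsetSum _ fun j _ =>
    integrable_finsetSum _ fun k _ => integrable_finsetSum _ fun l _ => iX' j k l, ← mul_assoc,
    ← integral_const_mul]
  simp only [sum_entryFun_mul h₀ hδ hz]
  have iC' : Integrable (fun x => (n : ℂ)⁻¹ • corr (normTrace n) a₀ a (entryMat x) z)
      (entryLaw r n) := iC.smul (n : ℂ)⁻¹
  have i1 : Integrable (fun x => covMap a (cauchy (normTrace n) a₀ a (entryMat x) z) *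
      cauchy (normTrace n) a₀ a (entryMat x) z + (n : ℂ)⁻¹ • corr (normTrace n) a₀ a (entryMat x) z)
      (entryLaw r n) := iHH.add iC'
  have e1 := integral_matrix_apply i1 i q
  rw [integral_add iHH iC', integral_smul] at e1
  rw [← e1, add_assoc, Matrix.add_apply 1]
  simp

end Integral

end

section

open MeasureTheory

/-! ### The covariance of the Cauchy transform -/

section Covariance

variable {ι : Type*} [Fintype ι] [DecidableEq ι] {r n : ℕ}
  {a₀ : Matrix ι ι ℂ} {a : Fin r → Matrix ι ι ℂ} {δ : ℝ} {z : Matrix ι ι ℂ}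

-- By cyclicity the derivative of the normalised trace in one coordinate is 1/n times an entry of a
-- fixed matrix M. The squares over all entries then sum to n⁻² times the Hilbert–Schmidt norm
-- squared of M, at most n⁻¹ ‖M‖². With the entry variance 1/n this gives a total variance of order
-- n⁻².
omit [DecidableEq ι] in
lemma normTrace_mul_linPart_mul_apply (X : Matrix ι ι (Matrix (Fin n) (Fin n) ℂ))
    (b : Matrix ι ι ℂ) (k l : Fin n) (i q : ι) :
    normTrace n ((X * amp b (Matrix.single k l (1 : ℂ)) * X :
      Matrix ι ι (Matrix (Fin n) (Fin n) ℂ)) i q)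
      = (n : ℂ)⁻¹ * (∑ u, ∑ v, b u v • (X v q * X i u)) l k := by
  rw [normTrace_apply]
  simp only [mul_amp_single_mul_apply, Matrix.sum_apply, Matrix.smul_apply, smul_eq_mul,
    Matrix.mul_apply]
  congr 1
  rw [Finset.sum_comm]
  refine Finset.sum_congr rfl fun u _ => ?_
  rw [Finset.sum_comm]
  refine Finset.sum_congr rfl fun v _ => ?_
  rw [Finset.mul_sum]
  exact Finset.sum_congr rfl fun s _ => by ring

lemma norm_sum_smul_mul_le {X : Matrix ι ι (Matrix (Fin n) (Fin n) ℂ)} {t κ : ℝ}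
    (hX : ∀ i j, ‖X i j‖ ≤ t) {b : Matrix ι ι ℂ} (hb : ‖b‖ ≤ κ) (i q : ι) :
    ‖∑ u, ∑ v, b u v • (X v q * X i u)‖ ≤ (Fintype.card ι : ℝ) ^ 2 * (κ * t ^ 2) := by
  have h : ∀ u v, ‖b u v • (X v q * X i u)‖ ≤ κ * t ^ 2 := fun u v => by
    have ht : 0 ≤ t := (norm_nonneg _).trans (hX i u)
    rw [norm_smul, sq]
    exact mul_le_mul ((norm_entry_le b u v).trans hb) ((norm_mul_le _ _).trans
      (mul_le_mul (hX _ _) (hX _ _) (norm_nonneg _) ht)) (norm_nonneg _)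
      ((norm_nonneg _).trans hb)
  refine (norm_sum_le _ _).trans ((Finset.sum_le_sum fun u _ => (norm_sum_le _ _).trans
    (Finset.sum_le_sum fun v _ => h u v)).trans (le_of_eq ?_))
  simp only [Finset.sum_const, Finset.card_univ, nsmul_eq_mul]
  ring

lemma sum_norm_sq_deriv_le {X : Matrix ι ι (Matrix (Fin n) (Fin n) ℂ)} {t κ : ℝ} (hn : 0 < n)
    (hX : ∀ i j, ‖X i j‖ ≤ t) (ha : ∀ j, ‖a j‖ ≤ κ) (i q : ι) :
    ∑ e : Fin r × Fin n × Fin n, ‖normTrace n ((X * (amp (a e.1) (Matrix.single e.2.1 e.2.2 (1 : ℂ))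
        + amp (a e.1)ᴴ (Matrix.single e.2.2 e.2.1 (1 : ℂ))) * X :
        Matrix ι ι (Matrix (Fin n) (Fin n) ℂ)) i q)‖ ^ 2
      ≤ (n : ℝ)⁻¹ * (4 * r * (Fintype.card ι : ℝ) ^ 4 * κ ^ 2 * t ^ 4) := by
  let M : Matrix ι ι ℂ → Matrix (Fin n) (Fin n) ℂ := fun b => ∑ u, ∑ v, b u v • (X v q * X i u)
  have hM : ∀ b, ‖b‖ ≤ κ → ‖M b‖ ^ 2 ≤ ((Fintype.card ι : ℝ) ^ 2 * (κ * t ^ 2)) ^ 2 := fun b hb =>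
    pow_le_pow_left₀ (norm_nonneg _) (norm_sum_smul_mul_le hX hb i q) 2
  have hn' : (0 : ℝ) < n := Nat.cast_pos.2 hn
  have h1 : ∀ j k l, ‖normTrace n ((X * (amp (a j) (Matrix.single k l (1 : ℂ))
        + amp (a j)ᴴ (Matrix.single l k (1 : ℂ))) * X :
        Matrix ι ι (Matrix (Fin n) (Fin n) ℂ)) i q)‖ ^ 2
      ≤ (n : ℝ)⁻¹ ^ 2 * (2 * (‖M (a j) l k‖ ^ 2 + ‖M (a j)ᴴ k l‖ ^ 2)) := fun j k l => by
    rw [mul_add X, add_mul, Matrix.add_apply, map_add, normTrace_mul_linPart_mul_apply,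
      normTrace_mul_linPart_mul_apply, ← mul_add, norm_mul, mul_pow, norm_inv, Complex.norm_natCast]
    refine mul_le_mul_of_nonneg_left ?_ (by positivity)
    refine (pow_le_pow_left₀ (norm_nonneg _) (norm_add_le _ _) 2).trans ?_
    nlinarith [sq_nonneg (‖M (a j) l k‖ - ‖M (a j)ᴴ k l‖)]
  have h2 : ∀ j, ∑ k, ∑ l, (n : ℝ)⁻¹ ^ 2 * (2 * (‖M (a j) l k‖ ^ 2 + ‖M (a j)ᴴ k l‖ ^ 2))
      ≤ (n : ℝ)⁻¹ * (4 * (Fintype.card ι : ℝ) ^ 4 * κ ^ 2 * t ^ 4) := fun j => by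
    have e : ∑ k, ∑ l, (n : ℝ)⁻¹ ^ 2 * (2 * (‖M (a j) l k‖ ^ 2 + ‖M (a j)ᴴ k l‖ ^ 2))
        = (n : ℝ)⁻¹ ^ 2 * (2 * (∑ k, ∑ l, ‖M (a j) k l‖ ^ 2 + ∑ k, ∑ l, ‖M (a j)ᴴ k l‖ ^ 2)) := by
      rw [Finset.sum_comm (f := fun k l => ‖M (a j) k l‖ ^ 2)]
      simp only [← Finset.mul_sum, ← Finset.sum_add_distrib]
    have b1 := (sum_norm_sq_le (M (a j))).trans
      (mul_le_mul_of_nonneg_left (hM _ (ha j)) hn'.le)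
    have b2 := (sum_norm_sq_le (M (a j)ᴴ)).trans (mul_le_mul_of_nonneg_left
      (hM _ (by rw [Matrix.l2_opNorm_conjTranspose]; exact ha j)) hn'.le)
    rw [e]
    refine (mul_le_mul_of_nonneg_left (mul_le_mul_of_nonneg_left (add_le_add b1 b2)
      zero_le_two) (by positivity)).trans (le_of_eq ?_)
    field_simp
    ring
  simp only [Fintype.sum_prod_type]
  refine (Finset.sum_le_sum fun j _ => (Finset.sum_le_sum fun k _ => Finset.sum_le_sum fun l _ =>
    h1 j k l).trans (h2 j)).trans (le_of_eq ?_)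
  simp only [Finset.sum_const, Finset.card_univ, nsmul_eq_mul, Fintype.card_fin]
  ring

lemma integral_norm_cauchy_entry_sub_sq_le (hn : 0 < n) (h₀ : a₀ᴴ = a₀) (hδ : 0 < δ)
    (hz : ImGE δ z) {κ : ℝ} (ha : ∀ j, ‖a j‖ ≤ κ) (i q : ι) :
    ∫ x, ‖cauchy (normTrace n) a₀ a (entryMat x) z i q
        - ∫ x, cauchy (normTrace n) a₀ a (entryMat x) z i q ∂entryLaw r n‖ ^ 2 ∂entryLaw r n
      ≤ ((n : ℝ) ^ 2)⁻¹ * (16 * r * (Fintype.card ι : ℝ) ^ 4 * κ ^ 2 * δ⁻¹ ^ 4) := by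
  obtain ⟨f', h1, h2, h3⟩ := exists_hasFDerivAt_res (a := a) h₀ hδ hz
    ((normTrace n).comp (Matrix.entryLinearMap ℂ _ i q))
  obtain ⟨C, hC⟩ := exists_linear_res_bound (a := a) h₀ hδ hz
    ((normTrace n).comp (Matrix.entryLinearMap ℂ _ i q))
  have h := integral_norm_sub_integral_sq_le (n : ℝ≥0)⁻¹ h2 h1 hC
    (K := (n : ℝ)⁻¹ * (4 * r * (Fintype.card ι : ℝ) ^ 4 * κ ^ 2 * δ⁻¹ ^ 4)) fun x => ?_
  · refine h.trans ?_
    have hpi : (Real.pi / 2) ^ 2 ≤ 4 := by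
      have := Real.pi_le_four; have := Real.pi_pos; nlinarith
    have hK : 0 ≤ (n : ℝ)⁻¹ * (4 * r * (Fintype.card ι : ℝ) ^ 4 * κ ^ 2 * δ⁻¹ ^ 4) := by positivity
    refine (mul_le_mul_of_nonneg_right hpi (mul_nonneg NNReal.zero_le_coe hK)).trans (le_of_eq ?_)
    push_cast
    field_simp
    ring
  · refine le_trans (le_of_eq ?_) (sum_norm_sq_deriv_le hn (norm_res_entry_le hδ hz
      (linPencil_conjTranspose h₀ a (entryMat x))) ha i q)
    refine Finset.sum_congr rfl fun e _ => ?_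
    have := h3 x (Pi.single e 1)
    rw [show e = (e.1, e.2.1, e.2.2) from rfl, linPart_entryMat_single] at this
    rw [this]; rfl

/-- The mean Cauchy transform of a random pencil. -/
def meanC (a₀ : Matrix ι ι ℂ) (a : Fin r → Matrix ι ι ℂ) (n : ℕ) (z : Matrix ι ι ℂ) :
    Matrix ι ι ℂ := ∫ x, cauchy (normTrace n) a₀ a (entryMat x) z ∂entryLaw r n

/-- The mean correction term of a random pencil. -/
def meanCorr (a₀ : Matrix ι ι ℂ) (a : Fin r → Matrix ι ι ℂ) (n : ℕ) (z : Matrix ι ι ℂ) :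
    Matrix ι ι ℂ := ∫ x, corr (normTrace n) a₀ a (entryMat x) z ∂entryLaw r n

lemma norm_sq_le_sum_entries (M : Matrix ι ι ℂ) :
    ‖M‖ ^ 2 ≤ (Fintype.card ι : ℝ) ^ 4 * ∑ i, ∑ j, ‖M i j‖ ^ 2 := by
  have h : ∀ i j, ‖M i j‖ ≤ Real.sqrt (∑ i, ∑ j, ‖M i j‖ ^ 2) := fun i j => by
    refine Real.le_sqrt_of_sq_le ?_
    refine (Finset.single_le_sum (f := fun j => ‖M i j‖ ^ 2) (fun _ _ => sq_nonneg _)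
      (Finset.mem_univ j)).trans ?_
    exact Finset.single_le_sum (f := fun i => ∑ j, ‖M i j‖ ^ 2)
      (fun _ _ => Finset.sum_nonneg fun _ _ => sq_nonneg _) (Finset.mem_univ i)
  refine (pow_le_pow_left₀ (norm_nonneg _) (norm_le_of_entries_le h) 2).trans (le_of_eq ?_)
  rw [mul_pow, Real.sq_sqrt (Finset.sum_nonneg fun _ _ => Finset.sum_nonneg fun _ _ => sq_nonneg _)]
  ring

lemma integral_norm_cauchy_sub_meanC_sq_le (hn : 0 < n) (h₀ : a₀ᴴ = a₀) (hδ : 0 < δ)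
    (hz : ImGE δ z) {κ : ℝ} (ha : ∀ j, ‖a j‖ ≤ κ) :
    ∫ x, ‖cauchy (normTrace n) a₀ a (entryMat x) z - meanC a₀ a n z‖ ^ 2 ∂entryLaw r n
      ≤ ((n : ℝ) ^ 2)⁻¹ * (16 * r * (Fintype.card ι : ℝ) ^ 10 * κ ^ 2 * δ⁻¹ ^ 4) := by
  have iH := integrable_cauchy_entryMat (a := a) hn h₀ hδ hz
  have hc := continuous_cauchy_entryMat (n := n) (a := a) h₀ hδ hz
  have hb : ∀ x, ‖cauchy (normTrace n) a₀ a (entryMat x) z - meanC a₀ a n z‖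
      ≤ (Fintype.card ι : ℝ) ^ 2 * δ⁻¹ + ‖meanC a₀ a n z‖ := fun x =>
    (norm_sub_le _ _).trans (add_le_add_left ((isState_normTrace hn).norm_cauchy_le h₀ hδ hz) _)
  have i1 : Integrable (fun x => ‖cauchy (normTrace n) a₀ a (entryMat x) z - meanC a₀ a n z‖ ^ 2)
      (entryLaw r n) := by
    refine integrable_of_continuous_of_bound (C := ((Fintype.card ι : ℝ) ^ 2 * δ⁻¹
      + ‖meanC a₀ a n z‖) ^ 2) (by fun_prop) fun x => ?_
    rw [norm_pow, norm_norm]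
    exact pow_le_pow_left₀ (norm_nonneg _) (hb x) 2
  have i2 : ∀ i j, Integrable (fun x => ‖(cauchy (normTrace n) a₀ a (entryMat x) z
      - meanC a₀ a n z) i j‖ ^ 2) (entryLaw r n) := fun i j => by
    refine integrable_of_continuous_of_bound (C := ((Fintype.card ι : ℝ) ^ 2 * δ⁻¹
      + ‖meanC a₀ a n z‖) ^ 2) ?_ fun x => ?_
    · exact (((hc.sub continuous_const).matrix_elem i j).norm).pow 2
    · rw [norm_pow, norm_norm]
      exact pow_le_pow_left₀ (norm_nonneg _) ((norm_entry_le _ i j).trans (hb x)) 2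
  have i3 := integrable_finsetSum Finset.univ fun i _ =>
    integrable_finsetSum Finset.univ fun j _ => i2 i j
  refine (integral_mono i1 (i3.const_mul ((Fintype.card ι : ℝ) ^ 4)) fun x =>
    norm_sq_le_sum_entries _).trans ?_
  rw [integral_const_mul, integral_finsetSum _ fun i _ =>
    integrable_finsetSum Finset.univ fun j _ => i2 i j]
  have h : ∀ i j, ∫ x, ‖(cauchy (normTrace n) a₀ a (entryMat x) z - meanC a₀ a n z) i j‖ ^ 2
      ∂entryLaw r n ≤ ((n : ℝ) ^ 2)⁻¹ * (16 * r * (Fintype.card ι : ℝ) ^ 4 * κ ^ 2 * δ⁻¹ ^ 4) :=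
    fun i j => by
      have := integral_norm_cauchy_entry_sub_sq_le hn h₀ hδ hz ha i j
      rw [← integral_matrix_apply iH] at this
      exact this
  have h' : ∑ i, ∫ x, ∑ j, ‖(cauchy (normTrace n) a₀ a (entryMat x) z - meanC a₀ a n z) i j‖ ^ 2
      ∂entryLaw r n ≤ ∑ i : ι, ∑ j : ι, ((n : ℝ) ^ 2)⁻¹ *
        (16 * r * (Fintype.card ι : ℝ) ^ 4 * κ ^ 2 * δ⁻¹ ^ 4) := Finset.sum_le_sum fun i _ => by
    rw [integral_finsetSum _ fun j _ => i2 i j]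
    exact Finset.sum_le_sum fun j _ => h i j
  refine (mul_le_mul_of_nonneg_left h' (by positivity)).trans (le_of_eq ?_)
  simp only [Finset.sum_const, Finset.card_univ, nsmul_eq_mul]
  ring

/-- The mean Cauchy transform satisfies the Dyson equation up to an explicit term of order `1/n`
and a covariance of order `1/n²`. -/
theorem exists_dyson_meanC (hn : 0 < n) (h₀ : a₀ᴴ = a₀) (hδ : 0 < δ) (hz : ImGE δ z) {κ : ℝ}
    (ha : ∀ j, ‖a j‖ ≤ κ) : ∃ V : Matrix ι ι ℂ,
      (z - a₀ - covMap a (meanC a₀ a n z)) * meanC a₀ a n z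
        = 1 + (n : ℂ)⁻¹ • meanCorr a₀ a n z + V ∧
      ‖V‖ ≤ ((n : ℝ) ^ 2)⁻¹ * (32 * r ^ 2 * (Fintype.card ι : ℝ) ^ 10 * κ ^ 4 * δ⁻¹ ^ 4) := by
  have iH := integrable_cauchy_entryMat (a := a) hn h₀ hδ hz
  have iHH := integrable_covMap_cauchy_mul (a := a) hn h₀ hδ hz
  have hc := continuous_cauchy_entryMat (n := n) (a := a) h₀ hδ hz
  set g := meanC a₀ a n z with hg
  have hgi : ∫ x, cauchy (normTrace n) a₀ a (entryMat x) z ∂entryLaw r n = g := rfl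
  let η : Matrix ι ι ℂ →ₗ[ℂ] Matrix ι ι ℂ := ⟨⟨covMap a, covMap_add a⟩, covMap_smul a⟩
  have e1 := integral_linearMap (LinearMap.mulLeft ℂ (covMap a g)) iH
  have e2 := integral_linearMap ((LinearMap.mulRight ℂ g).comp η) iH
  have j1 := (LinearMap.toContinuousLinearMap (LinearMap.mulLeft ℂ (covMap a g))).integrable_comp iH
  have j2 := (LinearMap.toContinuousLinearMap ((LinearMap.mulRight ℂ g).comp η)).integrable_comp iH
  simp only [LinearMap.coe_toContinuousLinearMap', LinearMap.mulLeft_apply, LinearMap.coe_comp,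
    Function.comp_apply, LinearMap.mulRight_apply, hgi] at e1 e2 j1 j2
  change Integrable (fun x => covMap a (cauchy (normTrace n) a₀ a (entryMat x) z) * g) _ at j2
  change ∫ x, covMap a (cauchy (normTrace n) a₀ a (entryMat x) z) * g ∂_ = covMap a g * g at e2
  -- V is the covariance term E[η(H - g) (H - g)], which is what E[η(H) H] exceeds η(g) g by. It is
  -- at most ‖η‖ times the variance of H.
  refine ⟨∫ x, covMap a (cauchy (normTrace n) a₀ a (entryMat x) z - g) *
    (cauchy (normTrace n) a₀ a (entryMat x) z - g) ∂entryLaw r n, ?_, ?_⟩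
  · have h1 := sub_mul_integral_cauchy (a := a) hn h₀ hδ hz
    have h2 : ∀ x, covMap a (cauchy (normTrace n) a₀ a (entryMat x) z - g) *
        (cauchy (normTrace n) a₀ a (entryMat x) z - g)
        = (covMap a (cauchy (normTrace n) a₀ a (entryMat x) z) *
            cauchy (normTrace n) a₀ a (entryMat x) z
          - covMap a (cauchy (normTrace n) a₀ a (entryMat x) z) * g)
          - (covMap a g * cauchy (normTrace n) a₀ a (entryMat x) z - covMap a g * g) := fun x => by
      rw [covMap_sub]; noncomm_ring
    rw [hgi] at h1
    rw [sub_mul, h1]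
    simp only [h2]
    have k1 := iHH.sub j2
    have k2 := j1.sub (integrable_const (μ := entryLaw r n) (covMap a g * g))
    have e3 := integral_sub k1 k2
    simp only [Pi.sub_apply] at e3
    rw [e3, integral_sub iHH j2, integral_sub j1 (integrable_const _), e1, e2]
    simp [meanCorr]
    abel
  · have i1 : Integrable (fun x => ‖cauchy (normTrace n) a₀ a (entryMat x) z - g‖ ^ 2)
        (entryLaw r n) := by
      refine integrable_of_continuous_of_bound (C := ((Fintype.card ι : ℝ) ^ 2 * δ⁻¹ + ‖g‖) ^ 2)
        (by fun_prop) fun x => ?_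
      rw [norm_pow, norm_norm]
      exact pow_le_pow_left₀ (norm_nonneg _) ((norm_sub_le _ _).trans
        (add_le_add_left ((isState_normTrace hn).norm_cauchy_le h₀ hδ hz) _)) 2
    have h3 := norm_integral_le_of_norm_le (i1.const_mul (2 * r * κ ^ 2))
      (f := fun x => covMap a (cauchy (normTrace n) a₀ a (entryMat x) z - g) *
        (cauchy (normTrace n) a₀ a (entryMat x) z - g)) (Filter.Eventually.of_forall fun x => by
        refine (norm_mul_le _ _).trans ((mul_le_mul_of_nonneg_right (norm_covMap_le ha _)
          (norm_nonneg _)).trans (le_of_eq (by ring))))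
    refine h3.trans ?_
    rw [integral_const_mul]
    refine (mul_le_mul_of_nonneg_left (integral_norm_cauchy_sub_meanC_sq_le hn h₀ hδ hz ha)
      (by positivity)).trans (le_of_eq (by ring))

lemma norm_meanCorr_le (hn : 0 < n) (h₀ : a₀ᴴ = a₀) (hδ : 0 < δ) (hz : ImGE δ z) {κ : ℝ}
    (ha : ∀ j, ‖a j‖ ≤ κ) :
    ‖meanCorr a₀ a n z‖ ≤ 2 * r * (Fintype.card ι : ℝ) ^ 6 * κ ^ 2 * δ⁻¹ ^ 2 := by
  have := norm_integral_le_of_norm_le_const (μ := entryLaw r n) (Filter.Eventually.of_forall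
    fun x => (isState_normTrace hn).norm_corr_le (y := entryMat x) h₀ hδ hz ha)
  simpa [meanCorr] using this

lemma norm_meanC_le (hn : 0 < n) (h₀ : a₀ᴴ = a₀) (hδ : 0 < δ) (hz : ImGE δ z) :
    ‖meanC a₀ a n z‖ ≤ (Fintype.card ι : ℝ) ^ 2 * δ⁻¹ := by
  have := norm_integral_le_of_norm_le_const (μ := entryLaw r n) (Filter.Eventually.of_forall
    fun x => (isState_normTrace hn).norm_cauchy_le (a := a) (y := entryMat x) h₀ hδ hz)
  simpa [meanC] using this

/-- The sign passes from the random transform to its mean by linearity. It is needed to place the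
mean within the scope of `dyson_unique`. -/
lemma imForm_meanC_nonpos (hn : 0 < n) (h₀ : a₀ᴴ = a₀) (hδ : 0 < δ) (hz : ImGE δ z) (u : ι → ℂ) :
    imForm (meanC a₀ a n z) u ≤ 0 := by
  have iH := integrable_cauchy_entryMat (a := a) hn h₀ hδ hz
  let L : Matrix ι ι ℂ →ₗ[ℂ] ℂ :=
    { toFun := fun M => star u ⬝ᵥ M *ᵥ u
      map_add' := fun M N => by rw [Matrix.add_mulVec, dotProduct_add]
      map_smul' := fun c M => by rw [Matrix.smul_mulVec, dotProduct_smul]; rfl }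
  have e := integral_linearMap L iH
  have j := (LinearMap.toContinuousLinearMap L).integrable_comp iH
  have e' : imForm (meanC a₀ a n z) u
      = ∫ x, imForm (cauchy (normTrace n) a₀ a (entryMat x) z) u ∂entryLaw r n := by
    have h1 : imForm (meanC a₀ a n z) u = (L (meanC a₀ a n z)).im := rfl
    rw [h1, meanC, ← e]
    exact (integral_im (𝕜 := ℂ) j).symm
  rw [e']
  exact integral_nonpos fun x => (isState_normTrace hn).imForm_cauchy_nonpos h₀ hδ hz u

end Covariance

end

/-! ### First order comparison with the limit -/

section FirstOrder

variable {ι : Type*} [Fintype ι] [DecidableEq ι] {r : ℕ}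

/-- Since 1 + e is invertible, m = (1 + e)⁻¹ w inverts g. The identity m = w - e m with ‖e‖ ≤ 1/2
gives ‖m‖ ≤ 2 ‖w‖. -/
lemma exists_inverse_of_mul_eq_one_add {w g e : Matrix ι ι ℂ} (h : w * g = 1 + e)
    (he : ‖e‖ ≤ 1 / 2) : ∃ m, m * g = 1 ∧ ‖m‖ ≤ 2 * ‖w‖ := by
  have hu : IsUnit (1 + e) := by
    have := isUnit_one_sub_of_norm_lt_one (x := -e) (by rw [norm_neg]; linarith)
    rwa [sub_neg_eq_add] at this
  obtain ⟨u, hu⟩ := hu.exists_left_inv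
  have h1 : u * w * g = 1 := by rw [mul_assoc, h, hu]
  refine ⟨u * w, h1, ?_⟩
  set m := u * w
  have h2 : m = w - e * m := by
    have h3 : w * (g * m) = (1 + e) * m := by rw [← mul_assoc, h]
    rw [mul_eq_one_comm.1 h1, mul_one] at h3
    rw [h3]; noncomm_ring
  have h3 : ‖m‖ ≤ ‖w‖ + ‖e‖ * ‖m‖ := by
    conv_lhs => rw [h2]
    exact (norm_sub_le _ _).trans (add_le_add_right (norm_mul_le _ _) _)
  nlinarith [norm_nonneg m]

lemma norm_sub_sub_covMap_le {a₀ z g : Matrix ι ι ℂ} {a : Fin r → Matrix ι ι ℂ} {κ t B : ℝ}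
    (hκ : 0 ≤ κ) (ht : 0 ≤ t) (hB : 1 ≤ B) (h₀ : ‖a₀‖ ≤ κ) (ha : ∀ j, ‖a j‖ ≤ κ)
    (hz : ‖z‖ ≤ B) (hg : ‖g‖ ≤ (Fintype.card ι : ℝ) ^ 2 * t) :
    ‖z - a₀ - covMap a g‖ ≤ (1 + κ + 2 * r * κ ^ 2 * (Fintype.card ι : ℝ) ^ 2) * (B + t) := by
  have h1 : ‖covMap a g‖ ≤ 2 * r * κ ^ 2 * ((Fintype.card ι : ℝ) ^ 2 * t) :=
    (norm_covMap_le ha g).trans (mul_le_mul_of_nonneg_left hg (by positivity))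
  have h2 := (norm_sub_le (z - a₀) (covMap a g)).trans
    (add_le_add (norm_sub_le z a₀) h1)
  refine h2.trans ?_
  have h3 : 0 ≤ 2 * r * κ ^ 2 * (Fintype.card ι : ℝ) ^ 2 := by positivity
  nlinarith [mul_nonneg h3 (by linarith : 0 ≤ B), mul_nonneg hκ ht, mul_nonneg hκ (sub_nonneg.2 hB)]

set_option maxHeartbeats 1000000 in
/-- The mean Cauchy transform of a random pencil is within order `1/n` of its limit. -/
theorem exists_norm_meanC_sub_cauchy_le (ι : Type*) [Fintype ι] [DecidableEq ι] [Nonempty ι]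
    (r : ℕ) {κ : ℝ} (hκ : 0 ≤ κ) : ∃ C, 0 ≤ C ∧
      ∀ (a₀ : Matrix ι ι ℂ) (a : Fin r → Matrix ι ι ℂ), a₀ᴴ = a₀ → ‖a₀‖ ≤ κ → (∀ j, ‖a j‖ ≤ κ) →
      ∀ {A : Type*} [CStarAlgebra A] (τ : A →ₗ[ℂ] ℂ) (y : Fin r → A),
        IsState τ → IsCircularSystem τ y →
      ∀ (δ : ℝ) (z : Matrix ι ι ℂ), 0 < δ → ImGE δ z → ∀ n : ℕ, 0 < n →
        ‖meanC a₀ a n z - cauchy τ a₀ a y z‖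
          ≤ C * (δ⁻¹ ^ 4 * (‖z‖ + 1 + δ⁻¹)) / n := by
  set d : ℝ := (Fintype.card ι : ℝ) with hd
  set C₃ : ℝ := 2 * r * d ^ 6 * κ ^ 2 + 32 * r ^ 2 * d ^ 10 * κ ^ 4
  set C₄ : ℝ := 1 + κ + 2 * r * κ ^ 2 * d ^ 2
  set C₅ : ℝ := 2 * C₃ * C₄ with hC₅
  -- The three summands ensure, for n ≥ C₆ t³ (B + t), that ‖e‖ ≤ 1/2, that ‖e m‖ ≤ δ/2 and that t²
  -- ≤ n.
  set C₆ : ℝ := 2 * C₃ + 2 * C₅ + 1 with hC₆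
  have hd0 : 0 ≤ d := Nat.cast_nonneg _
  have hC₃0 : 0 ≤ C₃ := by positivity
  have hC₄0 : 0 ≤ C₄ := by positivity
  have hC₅0 : 0 ≤ C₅ := by positivity
  have hC₆0 : 0 ≤ C₆ := by positivity
  refine ⟨2 * d ^ 4 * C₅ + 2 * d ^ 2 * C₆, by positivity, ?_⟩
  intro a₀ a h₀ hκ₀ ha A _ τ y hτ hy δ z hδ hz n hn
  set t := δ⁻¹ with ht
  set B := ‖z‖ + 1 with hB
  have ht0 : 0 < t := inv_pos.2 hδ
  have hzB : ‖z‖ ≤ B := by linarith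
  have hB1 : 1 ≤ B := by linarith [norm_nonneg z]
  have hBt : 1 ≤ B * t := by
    have h1 : δ * t = 1 := mul_inv_cancel₀ hδ.ne'
    have h2 := mul_le_mul_of_nonneg_right (hz.le_norm.trans hzB) ht0.le
    linarith
  have hN : (1 : ℝ) ≤ n := by exact_mod_cast hn
  have hN0 : (0 : ℝ) < n := by linarith
  have hg := norm_meanC_le (a := a) hn h₀ hδ hz
  have hG := hτ.norm_cauchy_le (a := a) (y := y) h₀ hδ hz
  -- If n is below the threshold, the trivial bounds on g and G suffice, since the right-hand side
  -- is then at least as large.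
  rcases le_or_gt (C₆ * (t ^ 3 * (B + t))) n with hgood | hbad
  · have hQ : t ^ 2 ≤ t ^ 3 * (B + t) := by
      have h1 := mul_le_mul_of_nonneg_left hBt (sq_nonneg t)
      have h2 := pow_pos ht0 4
      linarith
    have hQ0 : 0 ≤ t ^ 3 * (B + t) := by positivity
    have hsplit : C₆ * (t ^ 3 * (B + t)) = 2 * (C₃ * (t ^ 3 * (B + t)))
        + 2 * (C₅ * (t ^ 3 * (B + t))) + t ^ 3 * (B + t) := by rw [hC₆]; ring
    have ht2 : t ^ 2 ≤ n := by
      have : t ^ 3 * (B + t) ≤ C₆ * (t ^ 3 * (B + t)) :=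
        le_mul_of_one_le_left hQ0 (by linarith)
      linarith
    obtain ⟨V, hV, hVn⟩ := exists_dyson_meanC hn h₀ hδ hz ha
    set g := meanC a₀ a n z with hgdef
    set e := (n : ℂ)⁻¹ • meanCorr a₀ a n z + V with he
    rw [add_assoc, ← he] at hV
    have hen : ‖e‖ ≤ C₃ * (t ^ 2 / n) := by
      have h1 : ‖(n : ℂ)⁻¹ • meanCorr a₀ a n z‖ ≤ (n : ℝ)⁻¹ * (2 * r * d ^ 6 * κ ^ 2 * t ^ 2) := by
        rw [norm_smul, norm_inv, Complex.norm_natCast]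
        exact mul_le_mul_of_nonneg_left (norm_meanCorr_le hn h₀ hδ hz ha) (by positivity)
      have h2 : ((n : ℝ) ^ 2)⁻¹ * (32 * r ^ 2 * d ^ 10 * κ ^ 4 * t ^ 4)
          ≤ (n : ℝ)⁻¹ * (32 * r ^ 2 * d ^ 10 * κ ^ 4 * t ^ 2) := by
        have h3 : ((n : ℝ) ^ 2)⁻¹ * t ^ 4 ≤ (n : ℝ)⁻¹ * t ^ 2 := by
          have : ((n : ℝ) ^ 2)⁻¹ * t ^ 4 = ((n : ℝ)⁻¹ * t ^ 2) * ((n : ℝ)⁻¹ * t ^ 2) := by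
            rw [sq (n : ℝ), mul_inv]; ring
          rw [this]
          refine mul_le_of_le_one_right (by positivity) ?_
          rw [inv_mul_le_iff₀ hN0]; linarith
        have := mul_le_mul_of_nonneg_left h3
          (by positivity : 0 ≤ 32 * (r : ℝ) ^ 2 * d ^ 10 * κ ^ 4)
        linarith
      refine (norm_add_le _ _).trans ((add_le_add h1 (hVn.trans h2)).trans (le_of_eq ?_))
      simp only [C₃]
      ring
    have hehalf : ‖e‖ ≤ 1 / 2 := by
      refine hen.trans ?_
      rw [← mul_div_assoc, div_le_iff₀ hN0]
      have h1 := mul_le_mul_of_nonneg_left hQ hC₃0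
      have h2 := mul_nonneg hC₅0 hQ0
      linarith
    obtain ⟨m, hm, hmn⟩ := exists_inverse_of_mul_eq_one_add hV hehalf
    have hwn := norm_sub_sub_covMap_le hκ ht0.le hB1 hκ₀ ha hzB hg
    have hem : ‖e * m‖ ≤ C₅ * (t ^ 2 * (B + t)) / n := by
      refine (norm_mul_le _ _).trans ((mul_le_mul hen (hmn.trans
        (mul_le_mul_of_nonneg_left hwn zero_le_two)) (norm_nonneg _) (by positivity)).trans
        (le_of_eq ?_))
      simp only [C₅, C₄]
      ring
    have hem' : ‖-(e * m)‖ ≤ δ / 2 := by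
      rw [norm_neg]
      refine hem.trans ?_
      have h1 : δ = t⁻¹ := by rw [ht, inv_inv]
      rw [h1, div_le_div_iff₀ hN0 two_pos, ← div_eq_inv_mul, le_div_iff₀ ht0]
      have h2 := mul_nonneg hC₃0 hQ0
      have h3 : C₅ * (t ^ 2 * (B + t)) * 2 * t = 2 * (C₅ * (t ^ 3 * (B + t))) := by ring
      linarith
    have hw : ImGE (δ / 2) (z + -(e * m)) := by
      have := hz.add_of_norm_le hem'
      rwa [sub_half] at this
    have hδ2 : 0 < δ / 2 := half_pos hδ
    -- The error e equals (e m) g, so it can be moved into the argument: g solves the exact Dyson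
    -- equation at z - e m. Uniqueness identifies g with the limit transform there.
    have hgG : g = cauchy τ a₀ a y (z + -(e * m)) := by
      refine dyson_unique h₀ hδ2 hw (imForm_meanC_nonpos hn h₀ hδ hz) ?_
        (hτ.imForm_cauchy_nonpos h₀ hδ2 hw) (hy.dyson hτ h₀ hδ2 hw)
      have h1 : (z + -(e * m) - a₀ - covMap a g) * g
          = (z - a₀ - covMap a g) * g - e * (m * g) := by noncomm_ring
      rw [h1, hV, hm, mul_one, add_sub_cancel_right]
    rw [hgG, cauchy_sub_cauchy h₀ hδ2 hw hδ hz]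
    have hs := linPencil_conjTranspose h₀ a y
    refine (hτ.norm_sliceMap_mul_amp_mul_le (norm_res_entry_le hδ2 hw hs)
      (norm_res_entry_le hδ hz hs)).trans ?_
    have h2 : ‖z - (z + -(e * m))‖ ≤ C₅ * (t ^ 2 * (B + t)) / n := by
      rw [sub_add_cancel_left, neg_neg]; exact hem
    have h3 : (δ / 2)⁻¹ = 2 * t := by rw [inv_div, ht]; ring
    rw [h3, ← ht]
    calc d ^ 4 * (2 * t * ‖z - (z + -(e * m))‖ * t)
        ≤ d ^ 4 * (2 * t * (C₅ * (t ^ 2 * (B + t)) / n) * t) := by gcongr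
      _ = 2 * d ^ 4 * C₅ * (t ^ 4 * (B + t)) / n := by ring
      _ ≤ _ := by
        gcongr
        exact le_add_of_nonneg_right (by positivity)
  · refine (norm_sub_le _ _).trans ((add_le_add hg hG).trans ?_)
    rw [le_div_iff₀ hN0]
    have h1 : d ^ 2 * t * n ≤ d ^ 2 * t * (C₆ * (t ^ 3 * (B + t))) :=
      mul_le_mul_of_nonneg_left hbad.le (by positivity)
    have h2 : 0 ≤ 2 * d ^ 4 * C₅ * (t ^ 4 * (B + t)) := by positivity
    linarith

end FirstOrder

section

open MeasureTheory

/-! ### Block pencils and convergence of the correction term -/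

section Block

variable {ι : Type*} [Fintype ι] [DecidableEq ι] {r : ℕ}

/-- The block diagonal matrix with blocks `ā` and `a`. -/
def conjBlock (a : Matrix ι ι ℂ) : Matrix (ι ⊕ ι) (ι ⊕ ι) ℂ := Matrix.fromBlocks (a.map star) 0 0 a

/-- The upper triangular block matrix at which the Cauchy transform of the block pencil is
evaluated. -/
def blockArg (z c : Matrix ι ι ℂ) (ε : ℝ) : Matrix (ι ⊕ ι) (ι ⊕ ι) ℂ :=
  Matrix.fromBlocks zᵀ (-((ε : ℂ) • c)) 0 z

omit [Fintype ι] [DecidableEq ι] in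
lemma conjTranspose_map_star (a : Matrix ι ι ℂ) : (a.map star)ᴴ = aᴴ.map star := by
  ext i j; simp [Matrix.conjTranspose_apply]

omit [Fintype ι] [DecidableEq ι] in
lemma conjBlock_conjTranspose (a : Matrix ι ι ℂ) : (conjBlock a)ᴴ = conjBlock aᴴ := by
  rw [conjBlock, Matrix.fromBlocks_conjTranspose, conjTranspose_map_star]
  simp [conjBlock]

lemma norm_fromBlocks_le {a b c d : Matrix ι ι ℂ} {κ : ℝ} (ha : ∀ i j, ‖a i j‖ ≤ κ)
    (hb : ∀ i j, ‖b i j‖ ≤ κ) (hc : ∀ i j, ‖c i j‖ ≤ κ) (hd : ∀ i j, ‖d i j‖ ≤ κ) :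
    ‖Matrix.fromBlocks a b c d‖ ≤ 4 * (Fintype.card ι : ℝ) ^ 2 * κ := by
  refine (norm_le_of_entries_le (c := κ) fun i j => ?_).trans (le_of_eq ?_)
  · rcases i with i | i <;> rcases j with j | j
    exacts [ha i j, hb i j, hc i j, hd i j]
  · rw [Fintype.card_sum]; push_cast; ring

lemma norm_conjBlock_le {a : Matrix ι ι ℂ} {κ : ℝ} (ha : ‖a‖ ≤ κ) :
    ‖conjBlock a‖ ≤ 4 * (Fintype.card ι : ℝ) ^ 2 * κ := by
  have hκ := (norm_nonneg _).trans ha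
  refine norm_fromBlocks_le (fun i j => ?_) (fun i j => ?_) (fun i j => ?_) fun i j => ?_
  · rw [Matrix.map_apply, norm_star]; exact (norm_entry_le a i j).trans ha
  · simpa using hκ
  · simpa using hκ
  · exact (norm_entry_le a i j).trans ha

lemma norm_blockArg_sub_le {c : Matrix ι ι ℂ} {κ ε : ℝ} (hε : 0 ≤ ε) (hc : ‖c‖ ≤ κ) :
    ‖Matrix.fromBlocks (0 : Matrix ι ι ℂ) (-((ε : ℂ) • c)) 0 (0 : Matrix ι ι ℂ)‖
      ≤ 4 * (Fintype.card ι : ℝ) ^ 2 * (ε * κ) := by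
  have hκ : 0 ≤ ε * κ := mul_nonneg hε ((norm_nonneg _).trans hc)
  refine norm_fromBlocks_le (fun i j => ?_) (fun i j => ?_) (fun i j => ?_) fun i j => ?_
  · simpa using hκ
  · rw [Matrix.neg_apply, norm_neg, Matrix.smul_apply, norm_smul, Complex.norm_real,
      Real.norm_of_nonneg hε]
    exact mul_le_mul_of_nonneg_left ((norm_entry_le c i j).trans hc) hε
  · simpa using hκ
  · simpa using hκ

omit [Fintype ι] [DecidableEq ι] in
lemma blockArg_eq (z c : Matrix ι ι ℂ) (ε : ℝ) : blockArg z c ε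
    = Matrix.fromBlocks zᵀ 0 0 z + Matrix.fromBlocks 0 (-((ε : ℂ) • c)) 0 0 := by
  simp [blockArg, Matrix.fromBlocks_add]

variable {A : Type*} [CStarAlgebra A] {τ : A →ₗ[ℂ] ℂ} {a₀ : Matrix ι ι ℂ}
  {a : Fin r → Matrix ι ι ℂ} {y : Fin r → A} {δ ε : ℝ} {z c : Matrix ι ι ℂ}

omit [Fintype ι] [DecidableEq ι] in
lemma linPencil_conjBlock (a₀ : Matrix ι ι ℂ) (a : Fin r → Matrix ι ι ℂ) (y : Fin r → A) :
    linPencil (conjBlock a₀) (fun j => conjBlock (a j)) y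
      = Matrix.fromBlocks (conjLinPencil a₀ a y) 0 0 (linPencil a₀ a y) := by
  ext1 i j
  rcases i with i | i <;> rcases j with j | j <;>
    simp [linPencil, conjLinPencil, conjBlock, amp_apply, Matrix.sum_apply,
      Matrix.conjTranspose_apply]

/-- The slice of a product of resolvents in the correction term. -/
def corrSlice {A : Type*} [Ring A] [Algebra ℂ A] [Star A] (τ : A →ₗ[ℂ] ℂ) (a₀ : Matrix ι ι ℂ)
    (a : Fin r → Matrix ι ι ℂ) (y : Fin r → A) (z c : Matrix ι ι ℂ) : Matrix ι ι ℂ :=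
  sliceMap τ (res zᵀ (conjLinPencil a₀ a y) * amp c 1 * res z (linPencil a₀ a y))

lemma corrTerm_eq {A : Type*} [Ring A] [Algebra ℂ A] [Star A] (τ : A →ₗ[ℂ] ℂ) (a₀ : Matrix ι ι ℂ)
    (a : Fin r → Matrix ι ι ℂ) (y : Fin r → A) (z b : Matrix ι ι ℂ) : corrTerm τ a₀ a y z b
      = ∑ k, ∑ l, b * Matrix.single k l (1 : ℂ) *
        corrSlice τ a₀ a y z (Matrix.single k l (1 : ℂ) * b) := rfl

/-- The slice of the product of resolvents in the correction term is a block of a Cauchy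
transform. -/
lemma corrSlice_eq (h₀ : a₀ᴴ = a₀) (hδ : 0 < δ) (hz : ImGE δ z) (hε : ε ≠ 0) :
    corrSlice τ a₀ a y z c
      = (ε : ℂ)⁻¹ • (cauchy τ (conjBlock a₀) (fun j => conjBlock (a j)) y
          (blockArg z c ε)).submatrix Sum.inl Sum.inr := by
  have hs := linPencil_conjTranspose h₀ a y
  have hs' : (conjLinPencil a₀ a y)ᴴ = conjLinPencil a₀ a y :=
    linPencil_conjTranspose (map_star_conjTranspose h₀) _ y
  set X := res z (linPencil a₀ a y) with hX
  set X' := res zᵀ (conjLinPencil a₀ a y) with hX'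
  have h1 := sub_mul_res hδ hz hs
  have h2 := res_mul_sub hδ hz hs
  have h3 := sub_mul_res hδ hz.transpose hs'
  have h4 := res_mul_sub hδ hz.transpose hs'
  rw [← hX] at h1 h2
  rw [← hX'] at h3 h4
  have hamp : amp (blockArg z c ε) (1 : A) = Matrix.fromBlocks (amp zᵀ 1)
      (-((ε : ℂ) • amp c 1)) 0 (amp z 1) := by
    ext1 i j
    rcases i with i | i <;> rcases j with j | j <;>
      simp [blockArg, amp_apply, Matrix.neg_apply, mul_smul]
  -- The resolvent of the block diagonal pencil at an upper triangular argument is upper triangular,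
  -- with corner ε X' c X. Dividing by ε recovers the slice.
  have hres : res (blockArg z c ε) (linPencil (conjBlock a₀) (fun j => conjBlock (a j)) y)
      = Matrix.fromBlocks X' ((ε : ℂ) • (X' * amp c 1 * X)) 0 X := by
    rw [res, hamp, linPencil_conjBlock, sub_eq_add_neg, Matrix.fromBlocks_neg,
      Matrix.fromBlocks_add]
    simp only [neg_zero, add_zero, ← sub_eq_add_neg]
    refine ring_inverse_eq ?_ ?_
    · rw [Matrix.fromBlocks_multiply, ← Matrix.fromBlocks_one]
      congr 1
      · rw [h3]; simp
      · rw [mul_smul_comm, mul_assoc X', ← mul_assoc _ X', h3]; simp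
      · simp
      · rw [h1]; simp
    · rw [Matrix.fromBlocks_multiply, ← Matrix.fromBlocks_one]
      congr 1
      · rw [h4]; simp
      · rw [smul_mul_assoc, mul_assoc _ X, h2]; simp
      · simp
      · rw [h2]; simp
  rw [corrSlice, cauchy, hres, ← hX, ← hX']
  have hε' : (ε : ℂ) ≠ 0 := Complex.ofReal_ne_zero.2 hε
  ext i j
  simp [sliceMap_apply, hε']

lemma norm_submatrix_inl_inr_le (M : Matrix (ι ⊕ ι) (ι ⊕ ι) ℂ) :
    ‖M.submatrix Sum.inl Sum.inr‖ ≤ (Fintype.card ι : ℝ) ^ 2 * ‖M‖ :=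
  norm_le_of_entries_le fun i j => norm_entry_le M (Sum.inl i) (Sum.inr j)

lemma integral_submatrix_inl_inr {Ω : Type*} [MeasurableSpace Ω] {μ : Measure Ω}
    {f : Ω → Matrix (ι ⊕ ι) (ι ⊕ ι) ℂ} (hf : Integrable f μ) :
    Integrable (fun x => (f x).submatrix (Sum.inl : ι → ι ⊕ ι) (Sum.inr : ι → ι ⊕ ι)) μ ∧
    ∫ x, (f x).submatrix (Sum.inl : ι → ι ⊕ ι) (Sum.inr : ι → ι ⊕ ι) ∂μ
      = (∫ x, f x ∂μ).submatrix Sum.inl Sum.inr := by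
  let L : Matrix (ι ⊕ ι) (ι ⊕ ι) ℂ →ₗ[ℂ] Matrix ι ι ℂ :=
    { toFun := fun M => M.submatrix Sum.inl Sum.inr
      map_add' := fun _ _ => rfl
      map_smul' := fun _ _ => rfl }
  exact ⟨(LinearMap.toContinuousLinearMap L).integrable_comp hf, integral_linearMap L hf⟩

lemma ImGE.blockArg {κ : ℝ} (hz : ImGE δ z) (hε : 0 ≤ ε) (hc : ‖c‖ ≤ κ)
    (h : 4 * (Fintype.card ι : ℝ) ^ 2 * (ε * κ) ≤ δ / 2) : ImGE (δ / 2) (blockArg z c ε) := by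
  rw [blockArg_eq]
  have := (hz.transpose.fromBlocks hz).add_of_norm_le ((norm_blockArg_sub_le hε hc).trans h)
  rwa [sub_half] at this

lemma norm_blockArg_le {κ : ℝ} [Nonempty ι] (hz : ImGE δ z) (hε : 0 ≤ ε) (hc : ‖c‖ ≤ κ) (hδ : 0 < δ)
    (h : 4 * (Fintype.card ι : ℝ) ^ 2 * (ε * κ) ≤ δ / 2) :
    ‖RealGaussian.blockArg z c ε‖ ≤ (4 * (Fintype.card ι : ℝ) ^ 2 + 1) * ‖z‖ := by
  have h1 : ‖Matrix.fromBlocks zᵀ 0 0 z‖ ≤ 4 * (Fintype.card ι : ℝ) ^ 2 * ‖z‖ :=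
    norm_fromBlocks_le (fun i j => norm_entry_le z j i) (by simp) (by simp) (norm_entry_le z)
  rw [blockArg_eq]
  refine (norm_add_le _ _).trans ((add_le_add h1 ((norm_blockArg_sub_le hε hc).trans h)).trans ?_)
  have := hz.le_norm
  linarith

/-- The mean correction term of a random pencil is within order `1/n` of its limit. -/
theorem exists_norm_meanCorr_sub_corr_le (ι : Type*) [Fintype ι] [DecidableEq ι] [Nonempty ι]
    (r : ℕ) {κ : ℝ} (hκ : 0 ≤ κ) : ∃ C, 0 ≤ C ∧
      ∀ (a₀ : Matrix ι ι ℂ) (a : Fin r → Matrix ι ι ℂ), a₀ᴴ = a₀ → ‖a₀‖ ≤ κ → (∀ j, ‖a j‖ ≤ κ) →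
      ∀ {A : Type*} [CStarAlgebra A] (τ : A →ₗ[ℂ] ℂ) (y : Fin r → A),
        IsState τ → IsCircularSystem τ y →
      ∀ (δ : ℝ) (z : Matrix ι ι ℂ), 0 < δ → ImGE δ z → ∀ n : ℕ, 0 < n →
        ‖meanCorr a₀ a n z - corr τ a₀ a y z‖
          ≤ C * (δ⁻¹ ^ 5 * (‖z‖ + 1 + δ⁻¹)) / n := by
  set d : ℝ := (Fintype.card ι : ℝ) with hd
  have hd0 : 0 ≤ d := Nat.cast_nonneg _
  have hd1 : 1 ≤ d := by rw [hd]; exact_mod_cast Fintype.card_pos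
  obtain ⟨C, hC0, hC⟩ := exists_norm_meanC_sub_cauchy_le (ι ⊕ ι) r
    (κ := 4 * d ^ 2 * κ) (by positivity)
  -- With ε = δ/M the off-diagonal block has norm at most δ/2 for every c with ‖c‖ ≤ κ; the summand
  -- 1 covers κ = 0. Dividing by ε later costs M t, hence one more power of t than in the first
  -- order bound.
  set M : ℝ := 8 * d ^ 2 * (κ + 1) with hM
  have hM0 : 0 < M := by positivity
  set C' : ℝ := M * d ^ 2 * (C * (16 * (4 * d ^ 2 + 2))) with hC'
  have hC'0 : 0 ≤ C' := by positivity
  refine ⟨2 * r * d ^ 2 * κ * C', by positivity, ?_⟩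
  intro a₀ a h₀ hκ₀ ha A _ τ y hτ hy δ z hδ hz n hn
  set t := δ⁻¹ with ht
  have ht0 : 0 < t := inv_pos.2 hδ
  have hN0 : (0 : ℝ) < n := Nat.cast_pos.2 hn
  set ε : ℝ := δ / M with hε
  have hε0 : 0 < ε := by positivity
  have hb₀ : (conjBlock a₀)ᴴ = conjBlock a₀ := by rw [conjBlock_conjTranspose, h₀]
  have hδ2 : 0 < δ / 2 := half_pos hδ
  have hsmall : 4 * d ^ 2 * (ε * κ) ≤ δ / 2 := by
    rw [hε, hM]
    have : 4 * d ^ 2 * (δ / (8 * d ^ 2 * (κ + 1)) * κ) = δ / 2 * (κ / (κ + 1)) := by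
      field_simp; ring
    rw [this]
    exact mul_le_of_le_one_right hδ2.le (div_le_one_of_le₀ (by linarith) (by linarith))
  have key : ∀ c : Matrix ι ι ℂ, ‖c‖ ≤ κ →
      Integrable (fun x => corrSlice (normTrace n) a₀ a (entryMat x) z c) (entryLaw r n) ∧
      ‖∫ x, corrSlice (normTrace n) a₀ a (entryMat x) z c ∂entryLaw r n - corrSlice τ a₀ a y z c‖
        ≤ C' * (t ^ 5 * (‖z‖ + 1 + t)) / n := fun c hc => by
    have hΛ := hz.blockArg hε0.le hc hsmall
    have i0 := integrable_cauchy_entryMat (a := fun j => conjBlock (a j)) hn hb₀ hδ2 hΛ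
    obtain ⟨i1, i2⟩ := integral_submatrix_inl_inr i0
    have e1 : ∀ x, corrSlice (normTrace n) a₀ a (entryMat x) z c = _ := fun x => corrSlice_eq (τ := normTrace n) (a := a) (y := entryMat x)
      (c := c) h₀ hδ hz hε0.ne'
    simp only [e1]
    refine ⟨i1.smul (ε : ℂ)⁻¹, ?_⟩
    rw [integral_smul, i2, corrSlice_eq h₀ hδ hz hε0.ne', ← smul_sub]
    have e2 := hC (conjBlock a₀) (fun j => conjBlock (a j)) hb₀ (norm_conjBlock_le hκ₀)
      (fun j => norm_conjBlock_le (ha j)) τ y hτ hy (δ / 2) (RealGaussian.blockArg z c ε) hδ2 hΛ n hn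
    have e3 := norm_submatrix_inl_inr_le (meanC (conjBlock a₀) (fun j => conjBlock (a j)) n
      (RealGaussian.blockArg z c ε) - cauchy τ (conjBlock a₀) (fun j => conjBlock (a j)) y
      (RealGaussian.blockArg z c ε))
    have e4 : ‖RealGaussian.blockArg z c ε‖ ≤ (4 * d ^ 2 + 1) * ‖z‖ :=
      norm_blockArg_le hz hε0.le hc hδ hsmall
    have e5 : (δ / 2)⁻¹ = 2 * t := by rw [inv_div, ht]; ring
    have e6 : ‖((ε : ℂ)⁻¹)‖ = M * t := by
      rw [norm_inv, Complex.norm_real, Real.norm_of_nonneg hε0.le, hε, inv_div, ht, div_eq_mul_inv]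
    have e7 : ‖RealGaussian.blockArg z c ε‖ + 1 + 2 * t ≤ (4 * d ^ 2 + 2) * (‖z‖ + 1 + t) := by
      have := norm_nonneg z
      nlinarith [mul_nonneg (sq_nonneg d) ht0.le, sq_nonneg d]
    rw [norm_smul, e6]
    rw [e5] at e2
    calc M * t * ‖_‖ ≤ M * t * (d ^ 2 * (C * ((2 * t) ^ 4 *
          ((4 * d ^ 2 + 2) * (‖z‖ + 1 + t))) / n)) := by
          refine mul_le_mul_of_nonneg_left (e3.trans (mul_le_mul_of_nonneg_left
            (e2.trans ?_) (by positivity))) (by positivity)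
          gcongr
      _ = _ := by rw [hC']; ring
  set Q := C' * (t ^ 5 * (‖z‖ + 1 + t)) / n with hQ
  have hQ0 : 0 ≤ Q := by
    have := norm_nonneg z
    positivity
  have hterm : ∀ b : Matrix ι ι ℂ, ‖b‖ ≤ κ →
      Integrable (fun x => corrTerm (normTrace n) a₀ a (entryMat x) z b) (entryLaw r n) ∧
      ‖∫ x, corrTerm (normTrace n) a₀ a (entryMat x) z b ∂entryLaw r n - corrTerm τ a₀ a y z b‖
        ≤ d ^ 2 * (κ * Q) := fun b hb => by
    have hc : ∀ k l : ι, ‖Matrix.single k l (1 : ℂ) * b‖ ≤ κ := fun k l =>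
      (norm_mul_le _ _).trans ((mul_le_of_le_one_left (norm_nonneg _) (norm_single_le k l)).trans hb)
    have hb' : ∀ k l : ι, ‖b * Matrix.single k l (1 : ℂ)‖ ≤ κ := fun k l =>
      (norm_mul_le _ _).trans ((mul_le_of_le_one_right (norm_nonneg _) (norm_single_le k l)).trans hb)
    have i1 : ∀ k l : ι, Integrable (fun x => b * Matrix.single k l (1 : ℂ) * corrSlice
        (normTrace n) a₀ a (entryMat x) z (Matrix.single k l (1 : ℂ) * b)) (entryLaw r n) :=
      fun k l => (LinearMap.toContinuousLinearMap (LinearMap.mulLeft ℂ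
      (b * Matrix.single k l (1 : ℂ)))).integrable_comp (key _ (hc k l)).1
    have i2 : ∀ k l : ι, ∫ x, b * Matrix.single k l (1 : ℂ) * corrSlice (normTrace n) a₀ a
        (entryMat x) z (Matrix.single k l (1 : ℂ) * b) ∂entryLaw r n = _ := fun k l => integral_linearMap (LinearMap.mulLeft ℂ
      (b * Matrix.single k l (1 : ℂ))) (key _ (hc k l)).1
    simp only [LinearMap.mulLeft_apply] at i2
    refine ⟨integrable_finsetSum _ fun k _ => integrable_finsetSum _ fun l _ => i1 k l, ?_⟩
    simp only [corrTerm_eq]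
    rw [integral_finsetSum _ fun k _ => integrable_finsetSum _ fun l _ => i1 k l,
      ← Finset.sum_sub_distrib]
    refine (norm_sum_le_of_le _ (fun k _ => ?_) : _ ≤ ∑ k : ι, d * (κ * Q)).trans (le_of_eq ?_)
    · rw [integral_finsetSum _ fun l _ => i1 k l, ← Finset.sum_sub_distrib]
      refine (norm_sum_le_of_le _ (fun l _ => ?_) : _ ≤ ∑ l : ι, κ * Q).trans (le_of_eq ?_)
      · rw [i2, ← mul_sub]
        exact (norm_mul_le _ _).trans (mul_le_mul (hb' k l) (key _ (hc k l)).2 (norm_nonneg _) hκ)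
      · simp [hd]
    · simp only [Finset.sum_const, Finset.card_univ, nsmul_eq_mul, ← hd]; ring
  have ha' : ∀ j, ‖(a j)ᴴ‖ ≤ κ := fun j => by rw [Matrix.l2_opNorm_conjTranspose]; exact ha j
  have i3 : ∀ j, Integrable (fun x => corrTerm (normTrace n) a₀ a (entryMat x) z (a j)
      + corrTerm (normTrace n) a₀ a (entryMat x) z (a j)ᴴ) (entryLaw r n) := fun j =>
    (hterm _ (ha j)).1.add (hterm _ (ha' j)).1
  rw [meanCorr]
  simp only [corr]
  rw [integral_finsetSum _ fun j _ => i3 j, ← Finset.sum_sub_distrib]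
  refine (norm_sum_le_of_le _ (fun j _ => ?_) :
    _ ≤ ∑ j : Fin r, 2 * (d ^ 2 * (κ * Q))).trans (le_of_eq ?_)
  · rw [integral_add (hterm _ (ha j)).1 (hterm _ (ha' j)).1, add_sub_add_comm, two_mul]
    exact (norm_add_le _ _).trans (add_le_add (hterm _ (ha j)).2 (hterm _ (ha' j)).2)
  · simp only [Finset.sum_const, Finset.card_univ, nsmul_eq_mul, Fintype.card_fin, hQ]; ring

end Block

end

/-! ### Second order expansion -/

section SecondOrder

variable {ι : Type*} [Fintype ι] [DecidableEq ι] {r : ℕ}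

/-- The `1/n` correction `L(z)` of the Cauchy transform. -/
def corrL {A : Type*} [CStarAlgebra A] (τ : A →ₗ[ℂ] ℂ) (a₀ : Matrix ι ι ℂ)
    (a : Fin r → Matrix ι ι ℂ) (y : Fin r → A) (z : Matrix ι ι ℂ) : Matrix ι ι ℂ :=
  sliceMap τ (res z (linPencil a₀ a y) *
    amp (corr τ a₀ a y z * (z - a₀ - covMap a (cauchy τ a₀ a y z))) 1 * res z (linPencil a₀ a y))

set_option maxHeartbeats 1000000 in
/-- The mean Cauchy transform is expanded to order `1/n²`. -/
theorem exists_norm_cauchy_sub_meanC_add_le (ι : Type*) [Fintype ι] [DecidableEq ι] [Nonempty ι]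
    (r : ℕ) {κ : ℝ} (hκ : 0 ≤ κ) : ∃ C, 0 ≤ C ∧
      ∀ (a₀ : Matrix ι ι ℂ) (a : Fin r → Matrix ι ι ℂ), a₀ᴴ = a₀ → ‖a₀‖ ≤ κ → (∀ j, ‖a j‖ ≤ κ) →
      ∀ {A : Type*} [CStarAlgebra A] (τ : A →ₗ[ℂ] ℂ) (y : Fin r → A),
        IsState τ → IsCircularSystem τ y →
      ∀ (δ : ℝ) (z : Matrix ι ι ℂ), 0 < δ → ImGE δ z → ∀ n : ℕ, 0 < n →
        ‖cauchy τ a₀ a y z - meanC a₀ a n z + (n : ℂ)⁻¹ • corrL τ a₀ a y z‖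
          ≤ ((n : ℝ) ^ 2)⁻¹ * (C * ((‖z‖ + 1) ^ 3 * (1 + δ⁻¹) ^ 13)) := by
  set d : ℝ := (Fintype.card ι : ℝ) with hd
  have hd0 : 0 ≤ d := Nat.cast_nonneg _
  obtain ⟨C₁, hC₁0, hC₁⟩ := exists_norm_meanC_sub_cauchy_le ι r hκ
  obtain ⟨C₂, hC₂0, hC₂⟩ := exists_norm_meanCorr_sub_corr_le ι r hκ
  set C₃ : ℝ := 32 * r ^ 2 * d ^ 10 * κ ^ 4
  set C₄ : ℝ := 1 + κ + 2 * r * κ ^ 2 * d ^ 2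
  have hC₃0 : 0 ≤ C₃ := by positivity
  have hC₄0 : 0 ≤ C₄ := by positivity
  refine ⟨d ^ 4 * (2 * r * κ ^ 2 * C₁ ^ 2 + C₃ + C₂) * C₄, by positivity, ?_⟩
  intro a₀ a h₀ hκ₀ ha A _ τ y hτ hy δ z hδ hz n hn
  have hN0 : (0 : ℝ) < n := Nat.cast_pos.2 hn
  have hg := hC₁ a₀ a h₀ hκ₀ ha τ y hτ hy δ z hδ hz n hn
  have hρ := hC₂ a₀ a h₀ hκ₀ ha τ y hτ hy δ z hδ hz n hn
  obtain ⟨V, hV, hVn⟩ := exists_dyson_meanC hn h₀ hδ hz ha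
  have hdy := hy.dyson (a := a) hτ h₀ hδ hz
  have hLe := hy.linearized_dyson (a := a) hτ h₀ hδ hz
    (corr τ a₀ a y z * (z - a₀ - covMap a (cauchy τ a₀ a y z)))
  have hGn := hτ.norm_cauchy_le (a := a) (y := y) h₀ hδ hz
  change corrL τ a₀ a y z = _ * (_ + covMap a (corrL τ a₀ a y z)) * _ at hLe
  set t := δ⁻¹ with ht
  set B := ‖z‖ + 1 with hB
  have ht0 : 0 < t := inv_pos.2 hδ
  have hzB : ‖z‖ ≤ B := by linarith
  have hB1 : 1 ≤ B := by linarith [norm_nonneg z]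
  have hwn := norm_sub_sub_covMap_le hκ ht0.le hB1 hκ₀ ha hzB hGn
  set G := cauchy τ a₀ a y z with hGdef
  set g := meanC a₀ a n z with hgdef
  set ρ := corr τ a₀ a y z with hρdef
  set ρn := meanCorr a₀ a n z with hρndef
  set l := corrL τ a₀ a y z with hldef
  set w := z - a₀ - covMap a G with hwdef
  have hGw : G * w = 1 := mul_eq_one_comm.1 hdy
  -- All three terms are O(n⁻²): the first and the last by the first order comparisons, the second
  -- by the variance bound.
  set W : Matrix ι ι ℂ := covMap a (g - G) * (g - G) + V + (n : ℂ)⁻¹ • (ρn - ρ) with hWdef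
  set F : Matrix ι ι ℂ := (g - G) - (n : ℂ)⁻¹ • l with hFdef
  -- The linearised Dyson equation in the direction ρ w; the factor w cancels the right-hand G,
  -- which explains the factor G⁻¹ in the definition of L.
  have hl : l = G * ρ + G * covMap a l * G := by
    conv_lhs => rw [hLe]
    rw [mul_add, add_mul, mul_assoc G (ρ * w), mul_assoc ρ, hdy, mul_one]
  have hD : g - G = G * covMap a (g - G) * G + G * (covMap a (g - G) * (g - G) + V
      + (n : ℂ)⁻¹ • ρn) := by
    have h1 : z - a₀ - covMap a g = w - covMap a (g - G) := by rw [covMap_sub, hwdef]; abel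
    rw [h1] at hV
    have h2 : w * (g - G) = covMap a (g - G) * G + (covMap a (g - G) * (g - G) + V
        + (n : ℂ)⁻¹ • ρn) := by
      have h3 : w * g = 1 + (n : ℂ)⁻¹ • ρn + V + covMap a (g - G) * g := by
        rw [← hV]; noncomm_ring
      rw [mul_sub w, h3, hdy]
      noncomm_ring
    calc g - G = G * (w * (g - G)) := by rw [← mul_assoc, hGw, one_mul]
      _ = _ := by rw [h2, mul_add, mul_assoc]
  -- Subtracting the equation for l/n from that for g - G leaves the linear operator acting on F and
  -- the source G W, since ρ/n is removed from ρn/n.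
  have hF : F = G * covMap a F * G + G * W := by
    have h1 : covMap a F = covMap a (g - G) - (n : ℂ)⁻¹ • covMap a l := by
      rw [hFdef, covMap_sub, covMap_smul]
    have h2 : F = (G * covMap a (g - G) * G + G * (covMap a (g - G) * (g - G) + V
        + (n : ℂ)⁻¹ • ρn)) - (n : ℂ)⁻¹ • (G * ρ + G * covMap a l * G) := by
      rw [← hl, ← hD]
    rw [h1, h2, hWdef]
    simp only [mul_add, mul_sub, sub_mul, smul_add, smul_sub, mul_smul_comm, smul_mul_assoc]
    abel
  have hFeq := hy.eq_of_linearized_dyson hτ h₀ hδ hz hF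
  have hs := linPencil_conjTranspose h₀ a y
  have hFn := hτ.norm_sliceMap_mul_amp_mul_le (c := W * w) (norm_res_entry_le hδ hz hs)
    (norm_res_entry_le hδ hz hs)
  rw [← hGdef, ← hwdef] at hFeq
  rw [← hFeq, ← ht] at hFn
  have hWn : ‖W‖ ≤ ((n : ℝ) ^ 2)⁻¹ * ((2 * r * κ ^ 2 * C₁ ^ 2 + C₃ + C₂)
      * (B ^ 2 * t ^ 4 * (1 + t) ^ 6)) := by
    have hBt : B + t ≤ B * (1 + t) := by linarith [mul_le_mul_of_nonneg_right hB1 ht0.le]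
    have h1t : 1 ≤ 1 + t := by linarith
    have ht1 : t ≤ 1 + t := by linarith
    have b1 : ‖covMap a (g - G) * (g - G)‖ ≤ ((n : ℝ) ^ 2)⁻¹ * (2 * r * κ ^ 2 * C₁ ^ 2 *
        (B ^ 2 * t ^ 4 * (1 + t) ^ 6)) := by
      calc ‖covMap a (g - G) * (g - G)‖ ≤ ‖covMap a (g - G)‖ * ‖g - G‖ := norm_mul_le _ _
        _ ≤ 2 * r * κ ^ 2 * ‖g - G‖ * ‖g - G‖ := by gcongr; exact norm_covMap_le ha _
        _ ≤ 2 * r * κ ^ 2 * (C₁ * (t ^ 4 * (B + t)) / n) * (C₁ * (t ^ 4 * (B + t)) / n) := by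
          gcongr
        _ = ((n : ℝ) ^ 2)⁻¹ * (2 * r * κ ^ 2 * C₁ ^ 2 * (t ^ 4 * (t ^ 4 * (B + t) ^ 2))) := by
          field_simp
        _ ≤ ((n : ℝ) ^ 2)⁻¹ * (2 * r * κ ^ 2 * C₁ ^ 2 * (t ^ 4 * ((1 + t) ^ 4 *
            (B * (1 + t)) ^ 2))) := by gcongr
        _ = _ := by ring
    have b2 : ‖V‖ ≤ ((n : ℝ) ^ 2)⁻¹ * (C₃ * (B ^ 2 * t ^ 4 * (1 + t) ^ 6)) := by
      refine hVn.trans ?_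
      have : t ^ 4 ≤ B ^ 2 * t ^ 4 * (1 + t) ^ 6 := by
        have h1 : 1 ≤ B ^ 2 := one_le_pow₀ hB1
        have h2 : 1 ≤ (1 + t) ^ 6 := one_le_pow₀ h1t
        calc t ^ 4 = 1 * t ^ 4 * 1 := by ring
          _ ≤ _ := by gcongr
      exact mul_le_mul_of_nonneg_left (mul_le_mul_of_nonneg_left this hC₃0) (by positivity)
    have b3 : ‖(n : ℂ)⁻¹ • (ρn - ρ)‖ ≤ ((n : ℝ) ^ 2)⁻¹ * (C₂ * (B ^ 2 * t ^ 4 * (1 + t) ^ 6)) := by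
      rw [norm_smul, norm_inv, Complex.norm_natCast]
      have h1 : t * (B + t) ≤ B ^ 2 * (1 + t) ^ 6 := by
        calc t * (B + t) ≤ (1 + t) * (B * (1 + t)) := by gcongr
          _ = B ^ 1 * (1 + t) ^ 2 := by ring
          _ ≤ B ^ 2 * (1 + t) ^ 6 := by gcongr <;> first | assumption | norm_num
      calc (n : ℝ)⁻¹ * ‖ρn - ρ‖ ≤ (n : ℝ)⁻¹ * (C₂ * (t ^ 5 * (B + t)) / n) := by gcongr
        _ = ((n : ℝ) ^ 2)⁻¹ * (C₂ * (t ^ 4 * (t * (B + t)))) := by field_simp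
        _ ≤ ((n : ℝ) ^ 2)⁻¹ * (C₂ * (t ^ 4 * (B ^ 2 * (1 + t) ^ 6))) := by gcongr
        _ = _ := by ring
    refine (norm_add₃_le).trans ((add_le_add_three b1 b2 b3).trans (le_of_eq (by ring)))
  have hgoal : G - g + (n : ℂ)⁻¹ • l = -F := by rw [hFdef]; abel
  rw [hgoal, norm_neg]
  refine hFn.trans ?_
  set Q : ℝ := 2 * r * κ ^ 2 * C₁ ^ 2 + C₃ + C₂ with hQ
  have hQ0 : 0 ≤ Q := by positivity
  have hB0 : 0 < B := by linarith
  -- Two resolvents give t², W gives B² t⁴ (1 + t)⁶ and w gives B (1 + t). The total is B³ times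
  -- degree 13 in t.
  calc d ^ 4 * (t * ‖W * w‖ * t) ≤ d ^ 4 * (t * (‖W‖ * ‖w‖) * t) := by
        gcongr; exact norm_mul_le _ _
    _ ≤ d ^ 4 * (t * (((n : ℝ) ^ 2)⁻¹ * (Q * (B ^ 2 * t ^ 4 * (1 + t) ^ 6)) *
        (C₄ * (B * (1 + t)))) * t) := by
        have : ‖w‖ ≤ C₄ * (B * (1 + t)) :=
          hwn.trans (mul_le_mul_of_nonneg_left (by linarith [mul_le_mul_of_nonneg_right hB1 ht0.le])
            hC₄0)
        gcongr
    _ = ((n : ℝ) ^ 2)⁻¹ * (d ^ 4 * Q * C₄ * (B ^ 3 * (t ^ 6 * (1 + t) ^ 7))) := by ring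
    _ ≤ ((n : ℝ) ^ 2)⁻¹ * (d ^ 4 * Q * C₄ * (B ^ 3 * ((1 + t) ^ 6 * (1 + t) ^ 7))) := by
        gcongr; linarith
    _ = _ := by ring

end SecondOrder

section

open MeasureTheory ProbabilityTheory

/-! ### Positive definite imaginary parts -/

section ImPart

/-- Write Im z = q* q and s = q⁻¹. Then ‖(Im z)⁻¹‖ = ‖s‖² and |u|² ≤ ‖s‖² |q u|², where |q u|² is
the imaginary part of the form of z. The assumption m > 0 makes the norm of the inverse nonzero. -/
lemma imGE_of_posDef {m : ℕ} (hm : 0 < m) {z : Matrix (Fin m) (Fin m) ℂ} (h : (imPart z).PosDef) :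
    0 < ‖(imPart z)⁻¹‖⁻¹ ∧ ImGE ‖(imPart z)⁻¹‖⁻¹ z := by
  have : Nonempty (Fin m) := Fin.pos_iff_nonempty.1 hm
  set p := imPart z with hp
  have hu : IsUnit p := h.isUnit
  obtain ⟨q, hq⟩ : ∃ q : Matrix (Fin m) (Fin m) ℂ, p = star q * q := by
    open scoped MatrixOrder in exact CStarAlgebra.nonneg_iff_eq_star_mul_self.1 h.posSemidef.nonneg
  rw [Matrix.star_eq_conjTranspose] at hq
  have hpinv : p⁻¹ * p = 1 := Matrix.nonsing_inv_mul p ((Matrix.isUnit_iff_isUnit_det p).1 hu)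
  have hq1 : (p⁻¹ * qᴴ) * q = 1 := by rw [mul_assoc, ← hq, hpinv]
  set s := p⁻¹ * qᴴ with hs
  have hps : p⁻¹ = s * sᴴ := by
    refine Matrix.inv_eq_left_inv ?_
    rw [hq, mul_assoc, ← mul_assoc sᴴ, ← Matrix.conjTranspose_mul, mul_eq_one_comm.1 hq1,
      Matrix.conjTranspose_one, one_mul, hq1]
  have hn : ‖p⁻¹‖ = ‖s‖ ^ 2 := by
    rw [hps, sq, ← Matrix.l2_opNorm_conjTranspose s, ← Matrix.l2_opNorm_conjTranspose_mul_self,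
      Matrix.conjTranspose_conjTranspose]
  have hpos : 0 < ‖p⁻¹‖ := by
    rw [norm_pos_iff]
    intro h0
    rw [h0, zero_mul] at hpinv
    exact zero_ne_one hpinv
  refine ⟨inv_pos.2 hpos, fun u => ?_⟩
  have h1 : sqNorm u ≤ ‖s‖ ^ 2 * sqNorm (q *ᵥ u) := by
    have := sqNorm_mulVec_le s (q *ᵥ u)
    rwa [Matrix.mulVec_mulVec, hq1, Matrix.one_mulVec] at this
  have h2 : imForm z u = sqNorm (q *ᵥ u) := by
    have h3 : z - zᴴ = (2 * Complex.I) • p := by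
      rw [hp, imPart, smul_smul, mul_inv_cancel₀ (by simp), one_smul]
    have h4 := imForm_sub z zᴴ u
    rw [imForm_conjTranspose, h3, hq, imForm, Matrix.smul_mulVec, dotProduct_smul,
      ← Matrix.mulVec_mulVec, dotProduct_mulVec_adjoint, Matrix.conjTranspose_conjTranspose] at h4
    have h5 : star (q *ᵥ u) ⬝ᵥ q *ᵥ u = (sqNorm (q *ᵥ u) : ℂ) := by
      simp only [dotProduct, sqNorm, Pi.star_apply, Complex.ofReal_sum]
      refine Finset.sum_congr rfl fun i _ => ?_
      rw [Complex.star_def, ← Complex.normSq_eq_conj_mul_self, Complex.normSq_eq_norm_sq]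
    rw [h5] at h4
    simp at h4
    linarith
  rw [h2, inv_mul_le_iff₀ hpos, hn]
  exact h1

end ImPart

/-! ### The joint law of the entries -/

section Law

variable {Ω : Type*} [MeasurableSpace Ω] {P : Measure Ω} [IsProbabilityMeasure P] {r n : ℕ}

lemma hasLaw_entries {Y : Fin r → Ω → Matrix (Fin n) (Fin n) ℝ}
    (hY : ∀ j, IsGRMReal P n (n : ℝ≥0)⁻¹ (Y j))
    (hi : iIndepFun (fun j ω (q : Fin n × Fin n) => Y j ω q.1 q.2) P) :
    HasLaw (fun ω (e : Fin r × Fin n × Fin n) => Y e.1 ω e.2.1 e.2.2) (entryLaw r n) P := by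
  have hae : ∀ j (q : Fin n × Fin n), AEMeasurable (fun ω => Y j ω q.1 q.2) P := fun j q =>
    ((hY j).hasLaw q.1 q.2).aemeasurable
  -- The laws give only almost everywhere measurability, whereas joining the two levels of
  -- independence is done for measurable functions; hence measurable versions.
  let Z : Fin r → Fin n × Fin n → Ω → ℝ := fun j q => (hae j q).mk _
  have hZ : ∀ j q, (fun ω => Y j ω q.1 q.2) =ᵐ[P] Z j q := fun j q => (hae j q).ae_eq_mk
  have hZm : ∀ j q, Measurable (Z j q) := fun j q => (hae j q).measurable_mk
  have h1 : iIndepFun (fun j ω q => Z j q ω) P := hi.congr fun j => by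
    filter_upwards [ae_all_iff.2 (hZ j)] with ω hω
    exact funext fun q => hω q
  have h2 : ∀ j, iIndepFun (Z j) P := fun j => (hY j).indep.congr (hZ j)
  have h3 : iIndepFun (fun (e : Fin r × Fin n × Fin n) ω => Y e.1 ω e.2.1 e.2.2) P :=
    (iIndepFun_uncurry' hZm h1 h2).congr fun e => (hZ e.1 e.2).symm
  refine ⟨aemeasurable_pi_lambda _ fun e => hae e.1 e.2, ?_⟩
  refine ((iIndepFun_iff_map_fun_eq_pi_map (f := fun (e : Fin r × Fin n × Fin n) ω =>
    Y e.1 ω e.2.1 e.2.2) fun e => hae e.1 e.2).1 h3).trans ?_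
  rw [entryLaw, gaussPi]
  congr 1
  exact funext fun e => ((hY e.1).hasLaw e.2.1 e.2.2).map_eq

lemma integrable_and_integral_entries {Y : Fin r → Ω → Matrix (Fin n) (Fin n) ℝ}
    (hY : ∀ j, IsGRMReal P n (n : ℝ≥0)⁻¹ (Y j))
    (hi : iIndepFun (fun j ω (q : Fin n × Fin n) => Y j ω q.1 q.2) P)
    {f : (Fin r × Fin n × Fin n → ℝ) → ℂ} (hf : Integrable f (entryLaw r n)) :
    Integrable (fun ω => f fun e => Y e.1 ω e.2.1 e.2.2) P ∧
      ∫ ω, f (fun e => Y e.1 ω e.2.1 e.2.2) ∂P = ∫ x, f x ∂entryLaw r n := by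
  have h := hasLaw_entries hY hi
  have hf' := hf
  rw [← h.map_eq] at hf'
  refine ⟨(integrable_map_measure hf'.aestronglyMeasurable h.aemeasurable).1 hf', ?_⟩
  rw [← h.map_eq]
  exact (integral_map h.aemeasurable hf'.aestronglyMeasurable).symm

end Law

end

/-! ### The limit objects of the statement and those used in the proof. -/

section Bridge

variable {m r n : ℕ} {a₀ z : Matrix (Fin m) (Fin m) ℂ} {a : Fin r → Matrix (Fin m) (Fin m) ℂ}

variable {A : Type*} [CStarAlgebra A] {τ : A →ₗ[ℂ] ℂ} {y : Fin r → A} {δ : ℝ}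

lemma limitR_eq : limitR τ a₀ a y z = corr τ a₀ a y z := by
  rw [limitR, corr, Finset.sum_add_distrib]; rfl

/-- By the Dyson equation, G⁻¹ is z - a₀ - η(G), the factor used in `corrL`. -/
lemma limitL_eq (hτ : IsState τ) (hy : IsCircularSystem τ y) (h₀ : a₀ᴴ = a₀) (hδ : 0 < δ)
    (hz : ImGE δ z) : limitL τ a₀ a y z = corrL τ a₀ a y z := by
  have h : (limitCauchy τ a₀ a y z)⁻¹ = z - a₀ - covMap a (cauchy τ a₀ a y z) :=
    Matrix.inv_eq_left_inv (hy.dyson hτ h₀ hδ hz)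
  rw [limitL, limitR_eq, h]; rfl

end Bridge

end RealGaussian
end

/-! ### Proof of the expansion from the bounds above. -/

open RealGaussian MeasureTheory ProbabilityTheory in
theorem mainTheorem4 {r m : ℕ} (hr : 0 < r) (hm : 0 < m) (c₀ : ℝ) (c : Fin r → ℝ) :
    ∃ p : Polynomial ℝ, p.natDegree = 13 ∧ (∀ k, 0 ≤ p.coeff k) ∧
      ∀ (a₀ : Matrix (Fin m) (Fin m) ℂ) (a : Fin r → Matrix (Fin m) (Fin m) ℂ),
        a₀ᴴ = a₀ → ‖a₀‖ = c₀ → (∀ j, ‖a j‖ = c j) →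
      ∀ {Ω : Type*} [MeasurableSpace Ω] (P : Measure Ω) [IsProbabilityMeasure P]
        (Y : (n : ℕ) → Fin r → Ω → Matrix (Fin n) (Fin n) ℝ),
        (∀ n, 0 < n → (∀ j, IsGRMReal P n (n : ℝ≥0)⁻¹ (Y n j)) ∧
          iIndepFun (fun j ω (q : Fin n × Fin n) => Y n j ω q.1 q.2) P) →
      ∀ {A : Type*} [CStarAlgebra A] (τ : A →ₗ[ℂ] ℂ) (y : Fin r → A),
        IsState τ → IsCircularSystem τ y →
      ∀ z : Matrix (Fin m) (Fin m) ℂ, (imPart z).PosDef →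
        IsUnit (tensor z 1 - pencil a₀ a y) ∧
        IsUnit (tensor zᵀ 1 - conjPencil a₀ a y) ∧
        IsUnit (limitCauchy τ a₀ a y z) ∧
        ∀ n : ℕ, 0 < n →
          (∀ ω, IsUnit (tensor z 1 - randomPencil a₀ a (Y n) ω)) ∧
          (∀ i j, Integrable (fun ω => randomCauchy a₀ a (Y n) z ω i j) P) ∧
          ‖limitCauchy τ a₀ a y z - meanCauchy P a₀ a (Y n) z
              + ((n : ℂ)⁻¹) • limitL τ a₀ a y z‖
            ≤ ((n : ℝ) ^ 2)⁻¹ * (‖z‖ + (‖a₀‖ + 16 * ∑ j, ‖a j‖ + 1)) ^ 8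
                * p.eval ‖(imPart z)⁻¹‖ := by
  have : Nonempty (Fin m) := Fin.pos_iff_nonempty.1 hm
  -- A common bound for all coefficient norms. Absolute values are taken because c₀ and c are
  -- arbitrary reals when the polynomial is chosen.
  have hκ : 0 ≤ |c₀| + ∑ j, |c j| := by positivity
  obtain ⟨C, hC0, hC⟩ := exists_norm_cauchy_sub_meanC_add_le (Fin m) r hκ
  have hC1 : 0 < C + 1 := by linarith
  -- C + 1 rather than C keeps the leading coefficient nonzero, so the degree is exactly 13.
  refine ⟨Polynomial.C (C + 1) * (Polynomial.X + Polynomial.C 1) ^ 13, ?_, fun k => ?_, ?_⟩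
  · rw [Polynomial.natDegree_C_mul hC1.ne', Polynomial.natDegree_pow_X_add_C]
  · rw [Polynomial.coeff_C_mul, Polynomial.C_1, Polynomial.coeff_X_add_one_pow]
    positivity
  intro a₀ a h₀ hc₀ hc Ω _ P _ Y hY A _ τ y hτ hy z hz
  obtain ⟨hδ, hzδ⟩ := imGE_of_posDef hm hz
  have hdy := hy.dyson (a := a) hτ h₀ hδ hzδ
  have hκ₀ : ‖a₀‖ ≤ |c₀| + ∑ j, |c j| := by
    rw [hc₀]
    exact (le_abs_self _).trans (le_add_of_nonneg_right (by positivity))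
  have hκj : ∀ j, ‖a j‖ ≤ |c₀| + ∑ j, |c j| := fun j => by
    rw [hc j]
    exact (le_abs_self _).trans ((Finset.single_le_sum (f := fun j => |c j|)
      (fun _ _ => abs_nonneg _) (Finset.mem_univ j)).trans (le_add_of_nonneg_left (abs_nonneg _)))
  refine ⟨(resolvent_bound hδ hzδ (linPencil_conjTranspose h₀ a y)).1,
    (resolvent_bound hδ hzδ.transpose (linPencil_conjTranspose (map_star_conjTranspose h₀)
      (fun j => (a j).map star) y)).1, IsUnit.of_mul_eq_one_right _ hdy, fun n hn => ?_⟩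
  obtain ⟨hY₁, hY₂⟩ := hY n hn
  have hint := integrable_cauchy_entryMat (a := a) hn h₀ hδ hzδ
  have htr : ∀ i j, Integrable (fun ω => randomCauchy a₀ a (Y n) z ω i j) P ∧
      ∫ ω, randomCauchy a₀ a (Y n) z ω i j ∂P = meanC a₀ a n z i j := fun i j => by
    have h1 := (LinearMap.toContinuousLinearMap (Matrix.entryLinearMap ℂ ℂ i j)).integrable_comp hint
    have h2 := integrable_and_integral_entries hY₁ hY₂ h1
    refine ⟨h2.1, h2.2.trans (integral_matrix_apply hint i j).symm⟩
  refine ⟨fun ω => (resolvent_bound hδ hzδ (linPencil_conjTranspose h₀ a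
    fun j => (Y n j ω).map Complex.ofReal)).1, fun i j => (htr i j).1, ?_⟩
  have hmean : meanCauchy P a₀ a (Y n) z = meanC a₀ a n z := by
    ext i j
    exact (htr i j).2
  have h := hC a₀ a h₀ hκ₀ hκj τ y hτ hy _ z hδ hzδ n hn
  rw [hmean, limitL_eq hτ hy h₀ hδ hzδ]
  refine h.trans ?_
  rw [inv_inv, mul_assoc]
  refine mul_le_mul_of_nonneg_left ?_ (by positivity)
  have hs : 0 ≤ ∑ j, ‖a j‖ := Finset.sum_nonneg fun _ _ => norm_nonneg _
  set t := ‖(imPart z)⁻¹‖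
  have ht : 0 ≤ t := norm_nonneg _
  have e : Polynomial.eval t (Polynomial.C (C + 1) * (Polynomial.X + Polynomial.C 1) ^ 13)
      = (C + 1) * (t + 1) ^ 13 := by simp
  rw [e]
  -- The exponent 3 is raised to 8 because the base is at least 1, and K' ≥ 1 is all that is needed
  -- of K'.
  calc C * ((‖z‖ + 1) ^ 3 * (1 + t) ^ 13)
      ≤ (C + 1) * ((‖z‖ + 1) ^ 8 * (1 + t) ^ 13) := by
        gcongr ?_ * (?_ * _)
        · linarith
        · exact pow_le_pow_right₀ (by linarith [norm_nonneg z]) (by norm_num)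
    _ ≤ (C + 1) * ((‖z‖ + (‖a₀‖ + 16 * ∑ j, ‖a j‖ + 1)) ^ 8 * (1 + t) ^ 13) := by
        gcongr
        linarith [norm_nonneg a₀]
    _ = _ := by ring
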